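/- Let $\Omega\subset\mathbb R^N$ be open and $m\in\mathbb R$. A function $a\in C^\infty(\Omega\times(\mathbb R^n\setminus\{0\});\mathbb C)$ is a *pseudoanalytic amplitude of order $m$*, $a\in S^m_{\psi a}(\Omega)$, if there are an open complex neighbourhood $\Omega^{\mathbb C}\supset\Omega$ in $\mathbb C^N$ and a smooth extension of $a$ to $\Omega^{\mathbb C}\times(\mathbb R^n\setminus\{0\})$, still denoted $a$ and holomorphic in $z$, such that for every compact $K\subset\Omega^{\mathbb C}$ one has $\sup_{z\in K,\eta\neq0}(1+|\eta|)^{-m+|\gamma|}|\partial_\eta^\gamma a(z,\eta)|<\infty$ for every multi-index $\gamma$, and there are $M,C,R>0$ such that $|\partial^\gamma_\eta a(z,\eta)|\le M C^{|\gamma|}\gamma!\,|\eta|^{m-|\gamma|}$ for all $\gamma$, all $z\in K$ and all $\eta\ne0$ with $|\eta|\ge R\max\{1,|\gamma|\}$. Its *essential support* $\mathrm{ess\,supp}\,a\subset\Omega\times(\mathbb R^n\setminus\{0\})$ is defined by: $(z_0,\eta_0)\notin\mathrm{ess\,supp}\,a$ if for every multi-index $\alpha$ with $|\alpha|\le\max\{\lceil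 m\rceil+n+1,0\}$ there are $C,c>0$ such that $|\partial_\eta^\alpha a(z,\eta)|\le Ce^{-c|\eta|}$ for all $(z,\eta)\in\Omega^{\mathbb C}\times(\mathbb R^n\setminus\{0\})$ with $(z,\eta/|\eta|)$ in some neighbourhood of $(z_0,\eta_0/|\eta_0|)$. A real-valued $\varphi\in C^\infty(\Omega\times(\mathbb R^n\setminus\{0\}))$ is an *analytic phase* if it extends holomorphically to $\Omega^{\mathbb C}\times\Theta^{\mathbb C}$ for some open complex neighbourhood $\Omega^{\mathbb C}$ of $\Omega$ and some open conic neighbourhood $\Theta^{\mathbb C}$ of $\mathbb R^n\setminus\{0\}$ in $\mathbb C^n\setminus i\mathbb R^n$, and there satisfies $\varphi(z,\sigma\eta)=\sigma\varphi(z,\eta)$ for $\sigma>0$ and $\nabla_{(z,\eta)}\varphi(z,\eta)\neq0$. **Proposition.** Let $a\in S^m_{\psi a}(\Omega)$ and let $\varphi$ be an analytic phase. The oscillatory integral $$A(u)=\iint e^{i\varphi(z,\eta)}a(z,\eta)u(z)\,d\eta\,dz,\qquad u\in C_c^\infty(\Omega),$$ defined as the limit, as $\varepsilon\to0^+$, of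 the integrals with an additional factor $\chi(\varepsilon\eta)$ in the integrand, exists and has the same value for every $\chi\in C_c^\infty(\mathbb R^n)$ equal to $1$ near $0$; it defines a distribution $A\in\mathcal D'(\Omega)$, and $$\mathrm{WF}_{\mathrm a}(A)\subset\{(z,\varphi_z(z,\eta))\in T^*\Omega\setminus 0:\ (z,\eta)\in\mathrm{ess\,supp}\,a,\ \varphi_\eta(z,\eta)=0\}.$$ Here $\mathrm{WF}_{\mathrm a}(A)$ is the analytic wavefront set: a point $(x_0,\xi_0)\in\Omega\times(\mathbb R^N\setminus\{0\})$ is not in $\mathrm{WF}_{\mathrm a}(A)$ if and only if there are a neighbourhood $U\subset\Omega$ of $x_0$, an open conic neighbourhood $\Gamma$ of $\xi_0$, a constant $C>0$ and a bounded sequence $v_L\in\mathcal E'(\Omega)$ $(L=0,1,2,\dots)$ with $v_L=A$ in $U$ and $|\widehat{v_L}(\xi)|\le C\,(C(L+1)/|\xi|)^L$ for all $L$ and all $\xi\in\Gamma\setminus\{0\}$. -/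

import Mathlib

open Set Filter Topology MeasureTheory TopologicalSpace
open scoped ContDiff Distributions

namespace PseudoAnalytic

noncomputable section

/-- The inclusion of real space into complex space. -/
def toC {k : ℕ} (x : EuclideanSpace ℝ (Fin k)) : EuclideanSpace ℂ (Fin k) :=
  WithLp.toLp 2 (fun i => (x i : ℂ))

/-- The operator `g ↦ ∂g/∂η_i` on complex valued functions of `η ∈ ℝⁿ`. -/
def partialDeriv {n : ℕ} (i : Fin n) (g : EuclideanSpace ℝ (Fin n) → ℂ) :
    EuclideanSpace ℝ (Fin n) → ℂ :=
  fun η => lineDeriv ℝ g η (EuclideanSpace.single i 1)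

/-- The mixed partial derivative `∂^γ = ∂₁^{γ₁} ⋯ ∂ₙ^{γₙ}` for a multi-index `γ`. -/
def multiDeriv {n : ℕ} (γ : Fin n → ℕ) (g : EuclideanSpace ℝ (Fin n) → ℂ) :
    EuclideanSpace ℝ (Fin n) → ℂ :=
  (List.finRange n).foldr (fun i h => (partialDeriv i)^[γ i] h) g

/-- The length `|γ|` of a multi-index. -/
def multiLength {n : ℕ} (γ : Fin n → ℕ) : ℕ := ∑ i, γ i

/-- The factorial `γ!` of a multi-index. -/
def multiFactorial {n : ℕ} (γ : Fin n → ℕ) : ℕ := ∏ i, (γ i).factorial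

/-! ### Amplitudes

Functions of `(z, η)` with `z ∈ Ω`, `η ∈ ℝⁿ ∖ {0}` are total functions of which only the values
at `z ∈ Ω`, `η ≠ 0` are ever used. -/

/-- `aC` is a smooth extension of `a` from `Ω × (ℝⁿ ∖ {0})` to `ΩC × (ℝⁿ ∖ {0})`, where `ΩC` is an
open complex neighbourhood of `Ω`, and `aC` is holomorphic in the first variable. -/
structure IsHolomorphicExtension {N n : ℕ} (Ω : Opens (EuclideanSpace ℝ (Fin N)))
    (a : EuclideanSpace ℝ (Fin N) → EuclideanSpace ℝ (Fin n) → ℂ)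
    (ΩC : Set (EuclideanSpace ℂ (Fin N)))
    (aC : EuclideanSpace ℂ (Fin N) → EuclideanSpace ℝ (Fin n) → ℂ) : Prop where
  isOpen : IsOpen ΩC
  mem : ∀ z ∈ Ω, toC z ∈ ΩC
  smooth : ContDiffOn ℝ ∞
    (fun p : EuclideanSpace ℂ (Fin N) × EuclideanSpace ℝ (Fin n) => aC p.1 p.2) (ΩC ×ˢ {0}ᶜ)
  holomorphic : ∀ η, η ≠ 0 → DifferentiableOn ℂ (fun z => aC z η) ΩC
  extends_real : ∀ z ∈ Ω, ∀ η, η ≠ 0 → aC (toC z) η = a z η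

/-- `a` is a pseudoanalytic amplitude of order `m` on `Ω × (ℝⁿ ∖ {0})`. -/
def IsPseudoanalyticAmplitude {N n : ℕ} (Ω : Opens (EuclideanSpace ℝ (Fin N))) (m : ℝ)
    (a : EuclideanSpace ℝ (Fin N) → EuclideanSpace ℝ (Fin n) → ℂ) : Prop :=
  ContDiffOn ℝ ∞
    (fun p : EuclideanSpace ℝ (Fin N) × EuclideanSpace ℝ (Fin n) => a p.1 p.2)
    ((Ω : Set (EuclideanSpace ℝ (Fin N))) ×ˢ {0}ᶜ) ∧
  ∃ (ΩC : Set (EuclideanSpace ℂ (Fin N)))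
    (aC : EuclideanSpace ℂ (Fin N) → EuclideanSpace ℝ (Fin n) → ℂ),
    IsHolomorphicExtension Ω a ΩC aC ∧
    ∀ K : Set (EuclideanSpace ℂ (Fin N)), K ⊆ ΩC → IsCompact K →
      (∀ γ : Fin n → ℕ, ∃ B : ℝ, ∀ z ∈ K, ∀ η : EuclideanSpace ℝ (Fin n), η ≠ 0 →
        (1 + ‖η‖) ^ (-m + (multiLength γ : ℝ)) * ‖multiDeriv γ (aC z) η‖ ≤ B) ∧
      ∃ M C R : ℝ, 0 < M ∧ 0 < C ∧ 0 < R ∧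
        ∀ γ : Fin n → ℕ, ∀ z ∈ K, ∀ η : EuclideanSpace ℝ (Fin n), η ≠ 0 →
          R * max 1 (multiLength γ : ℝ) ≤ ‖η‖ →
          ‖multiDeriv γ (aC z) η‖ ≤
            M * C ^ multiLength γ * (multiFactorial γ : ℝ) * ‖η‖ ^ (m - (multiLength γ : ℝ))

/-- Exponential decay of an amplitude of order `m`, and of its `η`-derivatives up to order
`max {⌈m⌉ + n + 1, 0}`, in a complex-conic neighbourhood of `(z₀, η₀)`. By the identity theorem
the condition does not depend on the holomorphic extension. -/
def IsExpDecayingAt {N n : ℕ} (Ω : Opens (EuclideanSpace ℝ (Fin N))) (m : ℝ)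
    (a : EuclideanSpace ℝ (Fin N) → EuclideanSpace ℝ (Fin n) → ℂ)
    (z₀ : EuclideanSpace ℝ (Fin N)) (η₀ : EuclideanSpace ℝ (Fin n)) : Prop :=
  ∃ (ΩC : Set (EuclideanSpace ℂ (Fin N)))
    (aC : EuclideanSpace ℂ (Fin N) → EuclideanSpace ℝ (Fin n) → ℂ),
    IsHolomorphicExtension Ω a ΩC aC ∧
    ∀ α : Fin n → ℕ, (multiLength α : ℤ) ≤ max (⌈m⌉ + (n : ℤ) + 1) 0 →
      ∃ C c : ℝ, 0 < C ∧ 0 < c ∧ ∃ V ∈ 𝓝 (toC z₀, ‖η₀‖⁻¹ • η₀),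
        ∀ z ∈ ΩC, ∀ η : EuclideanSpace ℝ (Fin n), η ≠ 0 → (z, ‖η‖⁻¹ • η) ∈ V →
          ‖multiDeriv α (aC z) η‖ ≤ C * Real.exp (-c * ‖η‖)

/-- The essential support of an amplitude of order `m`, a subset of `Ω × (ℝⁿ ∖ {0})`. -/
def essSupp {N n : ℕ} (Ω : Opens (EuclideanSpace ℝ (Fin N))) (m : ℝ)
    (a : EuclideanSpace ℝ (Fin N) → EuclideanSpace ℝ (Fin n) → ℂ) :
    Set (EuclideanSpace ℝ (Fin N) × EuclideanSpace ℝ (Fin n)) :=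
  {p | p.1 ∈ Ω ∧ p.2 ≠ 0 ∧ ¬ IsExpDecayingAt Ω m a p.1 p.2}

/-! ### Phases -/

/-- `φ` is a (real valued) analytic phase on `Ω × (ℝⁿ ∖ {0})`: it extends holomorphically to
`ΩC × ΘC` with `ΩC` a complex neighbourhood of `Ω` and `ΘC` an open conic neighbourhood of
`ℝⁿ ∖ {0}` in `ℂⁿ ∖ iℝⁿ`, and the extension is positively homogeneous of degree one in the second
variable, with nowhere vanishing total differential. -/
def IsAnalyticPhase {N n : ℕ} (Ω : Opens (EuclideanSpace ℝ (Fin N)))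
    (φ : EuclideanSpace ℝ (Fin N) → EuclideanSpace ℝ (Fin n) → ℝ) : Prop :=
  ContDiffOn ℝ ∞
    (fun p : EuclideanSpace ℝ (Fin N) × EuclideanSpace ℝ (Fin n) => φ p.1 p.2)
    ((Ω : Set (EuclideanSpace ℝ (Fin N))) ×ˢ {0}ᶜ) ∧
  ∃ (ΩC : Set (EuclideanSpace ℂ (Fin N))) (ΘC : Set (EuclideanSpace ℂ (Fin n)))
    (φC : EuclideanSpace ℂ (Fin N) × EuclideanSpace ℂ (Fin n) → ℂ),
    IsOpen ΩC ∧ (∀ z ∈ Ω, toC z ∈ ΩC) ∧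
    IsOpen ΘC ∧ (∀ η : EuclideanSpace ℝ (Fin n), η ≠ 0 → toC η ∈ ΘC) ∧
    (∀ θ ∈ ΘC, ∀ σ : ℝ, 0 < σ → (σ : ℂ) • θ ∈ ΘC) ∧
    (∀ θ ∈ ΘC, ∃ i, (θ i).re ≠ 0) ∧
    DifferentiableOn ℂ φC (ΩC ×ˢ ΘC) ∧
    (∀ z ∈ Ω, ∀ η : EuclideanSpace ℝ (Fin n), η ≠ 0 → φC (toC z, toC η) = (φ z η : ℂ)) ∧
    ∀ z ∈ ΩC, ∀ θ ∈ ΘC,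
      (∀ σ : ℝ, 0 < σ → φC (z, (σ : ℂ) • θ) = (σ : ℂ) * φC (z, θ)) ∧
      fderiv ℂ φC (z, θ) ≠ 0

/-- The distribution `A` on `Ω` is the oscillatory integral
`u ↦ ∬ e^{iφ(z,η)} a(z,η) u(z) dη dz`: for every cut-off `χ ∈ C_c^∞(ℝⁿ)` equal to one near the
origin, the absolutely convergent integrals with `χ(εη)` inserted converge to `A u`
as `ε → 0+`. -/
def IsOscillatoryIntegral {N n : ℕ} (Ω : Opens (EuclideanSpace ℝ (Fin N)))
    (φ : EuclideanSpace ℝ (Fin N) → EuclideanSpace ℝ (Fin n) → ℝ)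
    (a : EuclideanSpace ℝ (Fin N) → EuclideanSpace ℝ (Fin n) → ℂ)
    (A : 𝓓(Ω, ℂ) →L[ℂ] ℂ) : Prop :=
  ∀ χ : EuclideanSpace ℝ (Fin n) → ℝ, ContDiff ℝ ∞ χ → HasCompactSupport χ →
    (∀ᶠ η in 𝓝 0, χ η = 1) →
    ∀ u : 𝓓(Ω, ℂ),
      Tendsto
        (fun ε : ℝ => ∫ z in (Ω : Set (EuclideanSpace ℝ (Fin N))),
          ∫ η in ({0}ᶜ : Set (EuclideanSpace ℝ (Fin n))),
            (χ (ε • η) : ℂ) * (Complex.exp (Complex.I * (φ z η : ℂ)) * a z η * u z))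
        (𝓝[>] 0) (𝓝 (A u))

/-! ### The analytic wavefront set -/

/-- The space `C^∞(ℝ^N)` of complex valued smooth functions. -/
def smoothFunctions (N : ℕ) : Submodule ℂ (EuclideanSpace ℝ (Fin N) → ℂ) where
  carrier := {f | ContDiff ℝ ∞ f}
  add_mem' {f g} (hf : ContDiff ℝ ∞ f) (hg : ContDiff ℝ ∞ g) := hf.add hg
  zero_mem' := (contDiff_const : ContDiff ℝ ∞ fun _ : EuclideanSpace ℝ (Fin N) => (0 : ℂ))
  smul_mem' c f (hf : ContDiff ℝ ∞ f) :=
    ((contDiff_const : ContDiff ℝ ∞ fun _ : EuclideanSpace ℝ (Fin N) => c).mul hf)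

/-- A test function as an element of `C^∞(ℝ^N)`. -/
def ofTest {N : ℕ} {Ω : Opens (EuclideanSpace ℝ (Fin N))} (f : 𝓓(Ω, ℂ)) : smoothFunctions N :=
  ⟨f, f.contDiff⟩

/-- The function `x ↦ e^{-i⟨x,ξ⟩}`. -/
def planeWave {N : ℕ} (ξ : EuclideanSpace ℝ (Fin N)) : smoothFunctions N :=
  ⟨fun x => Complex.exp (-Complex.I * ((inner ℝ x ξ : ℝ) : ℂ)), by
    have h : ContDiff ℝ ∞ (fun x : EuclideanSpace ℝ (Fin N) => ((inner ℝ x ξ : ℝ) : ℂ)) :=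
      Complex.ofRealCLM.contDiff.comp (contDiff_id.inner ℝ contDiff_const)
    exact (contDiff_const.mul h).cexp⟩

/-- A bounded sequence in the space `ℰ'(Ω)` of distributions with compact support in `Ω`. The
elements of `ℰ'(Ω)` are regarded as linear forms on `C^∞(ℝ^N)`; a sequence of these is bounded if
it satisfies a common estimate by finitely many derivatives on one compact subset of `Ω`. -/
def IsBoundedInCompactlySupported {N : ℕ} (Ω : Opens (EuclideanSpace ℝ (Fin N)))
    (v : ℕ → smoothFunctions N →ₗ[ℂ] ℂ) : Prop :=
  ∃ K : Set (EuclideanSpace ℝ (Fin N)), IsCompact K ∧ K ⊆ Ω ∧ ∃ (k : ℕ) (C : ℝ),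
    ∀ (L : ℕ) (f : smoothFunctions N) (B : ℝ), 0 ≤ B →
      (∀ j ≤ k, ∀ x ∈ K,
        ‖iteratedFDeriv ℝ j (f : EuclideanSpace ℝ (Fin N) → ℂ) x‖ ≤ B) →
      ‖v L f‖ ≤ C * B

/-- `u` is analytic in the direction `ξ₀ ≠ 0` at `x₀`: there is a bounded sequence `v_L` in
`ℰ'(Ω)`, equal to `u` in a neighbourhood of `x₀`, whose Fourier transforms satisfy
`|v̂_L(ξ)| ≤ C (C (L+1) / |ξ|)^L` in a conic neighbourhood of `ξ₀`. -/
def IsMicroAnalyticAt {N : ℕ} (Ω : Opens (EuclideanSpace ℝ (Fin N)))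
    (u : 𝓓(Ω, ℂ) →L[ℂ] ℂ) (x₀ ξ₀ : EuclideanSpace ℝ (Fin N)) : Prop :=
  ∃ U Γ : Set (EuclideanSpace ℝ (Fin N)),
    IsOpen U ∧ x₀ ∈ U ∧ U ⊆ Ω ∧
    IsOpen Γ ∧ ξ₀ ∈ Γ ∧ (∀ ξ ∈ Γ, ∀ σ : ℝ, 0 < σ → σ • ξ ∈ Γ) ∧
    ∃ v : ℕ → smoothFunctions N →ₗ[ℂ] ℂ,
      IsBoundedInCompactlySupported Ω v ∧
      (∀ (L : ℕ) (f : 𝓓(Ω, ℂ)), tsupport f ⊆ U → v L (ofTest f) = u f) ∧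
      ∃ C : ℝ, 0 < C ∧ ∀ (L : ℕ), ∀ ξ ∈ Γ, ξ ≠ 0 →
        ‖v L (planeWave ξ)‖ ≤ C * (C * ((L : ℝ) + 1) / ‖ξ‖) ^ L

/-- The analytic wavefront set of a distribution on `Ω`, a subset of `Ω × (ℝ^N ∖ {0})`. -/
def analyticWavefrontSet {N : ℕ} (Ω : Opens (EuclideanSpace ℝ (Fin N)))
    (u : 𝓓(Ω, ℂ) →L[ℂ] ℂ) :
    Set (EuclideanSpace ℝ (Fin N) × EuclideanSpace ℝ (Fin N)) :=
  {p | p.1 ∈ Ω ∧ p.2 ≠ 0 ∧ ¬ IsMicroAnalyticAt Ω u p.1 p.2}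

end

end PseudoAnalytic

open Set Filter Topology MeasureTheory TopologicalSpace
open scoped ContDiff Distributions

namespace PseudoAnalytic

noncomputable section

/-! Localized near `x₀`, the Fourier transform of `A` at `ξ = λw` is an oscillatory integral with
phase `φ(z,η) - λ⟨z,w⟩`. Frequencies are sorted by size, `η = μθ` with `θ` in a compact set away
from `0`. By homogeneity the phase is then `μ(φ(z,θ) - ⟨z,ρ⟩)` with `ρ = λw/μ`, so `μ` is the large
parameter. Near a point `(x₀,θ₀,ρ₀)` there are three cases (`isControlledAt`): if `φ_z ≠ ρ₀`,
integrate by parts in `z`; if `φ_η ≠ 0`, integrate by parts in `η`; if both equalities hold, use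
exponential decay of `a`. The third case is void for `ρ₀ = 0` because `dφ ≠ 0`. On the open ray
through `ξ₀` it is covered by the assumption that `(x₀,ξ₀)` is not in the set on the right-hand
side.

In each case a piece is `O(μ^(p+n) (CB/μ)^L)`, with `p ≥ |m|` and `B` at least a multiple of `L+1`.
The analytic content is that `L` integrations by parts cost only `(CB)^L`
(`norm_integral_cexp_mul_le`). The reciprocal of the phase derivative obeys Cauchy estimates `Q A^i
i!`, and multiplying by it is harmless for functions whose derivatives up to order `L` are bounded
by `M B^k`, once `B ≥ 2AL`. The amplitude is not holomorphic in `η`; the pseudoanalytic estimates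
replace Cauchy's, and their range `|η| ≥ R max(1,k)` with `k ≤ L` is reached because `μ ≥ C(L+1)`.
Cut-offs adapted to this calculus come from `exists_cutoff`, and compactness makes the local bounds
uniform (`exists_uniform_control`, `exists_uniform_control_segment`).

Existence is the case `ρ = 0` with fixed `L = p+n+1`: dyadic pieces at scale `μ` are `O(1/μ)`, so
regularizations converge at a uniform rate, and `A` has order at most `p+n+1` (`exists_isOscLimit`).
For the wavefront set, frequencies `|η| ≤ c₁λ` have `φ_z` too small to balance `λw`
(`exists_low_frequency_bound`). The others lie at scales `μ = 2^j c₁λ`, where `ρ = tw` with `t` in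
the compact interval `[0, 1/c₁]`, and the bounds sum geometrically in `j`
(`IsOscLimit.exists_norm_wave_mul_le`). Finally `v_L = χ_{L+q+1} A` with `q = p+n` has the required
Fourier decay (`IsOscLimit.isMicroAnalyticAt`). -/

/-! ### Directional derivatives of arbitrary order -/

section DirectionalDerivative

variable {E : Type*} [NormedAddCommGroup E] [NormedSpace ℝ E]

/-- The `k`-th derivative of `f` at `x` in the direction `e`. -/
def dirDeriv (e : E) (k : ℕ) (f : E → ℂ) (x : E) : ℂ :=
  iteratedDeriv k (fun τ : ℝ => f (x + τ • e)) 0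

@[simp] lemma dirDeriv_zero (e : E) (f : E → ℂ) : dirDeriv e 0 f = f := by
  ext x; simp [dirDeriv]

lemma dirDeriv_one (e : E) (f : E → ℂ) (x : E) : dirDeriv e 1 f x = lineDeriv ℝ f x e := by
  simp [dirDeriv, lineDeriv]

lemma dirDeriv_one_add_smul (e : E) (f : E → ℂ) (x : E) :
    (fun τ : ℝ => dirDeriv e 1 f (x + τ • e)) = deriv (fun τ : ℝ => f (x + τ • e)) := by
  ext τ
  rw [dirDeriv_one, lineDeriv]
  have := deriv_comp_const_add (f := fun τ : ℝ => f (x + τ • e)) τ 0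
  simp only [add_zero] at this
  rw [← this]
  congr 1
  ext s
  rw [add_smul, add_assoc]

lemma dirDeriv_succ' (e : E) (k : ℕ) (f : E → ℂ) :
    dirDeriv e (k + 1) f = dirDeriv e k (dirDeriv e 1 f) := by
  ext x
  rw [dirDeriv, iteratedDeriv_succ', dirDeriv, dirDeriv_one_add_smul]

lemma dirDeriv_eq_iterate (e : E) (k : ℕ) (f : E → ℂ) :
    dirDeriv e k f = (fun g : E → ℂ => fun x => lineDeriv ℝ g x e)^[k] f := by
  induction k generalizing f with
  | zero => simp
  | succ k ih =>
    rw [dirDeriv_succ', ih, Function.iterate_succ_apply]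
    congr 1
    ext x
    exact dirDeriv_one e f x

lemma dirDeriv_congr {e : E} {k : ℕ} {f g : E → ℂ} {x : E} (h : f =ᶠ[𝓝 x] g) :
    dirDeriv e k f x = dirDeriv e k g x := by
  have hc : Tendsto (fun τ : ℝ => x + τ • e) (𝓝 0) (𝓝 x) := by
    have : Continuous (fun τ : ℝ => x + τ • e) := by fun_prop
    simpa using this.tendsto 0
  exact Filter.EventuallyEq.iteratedDeriv_eq k (hc.eventually h)

lemma dirDeriv_eq_zero_of_notMem_tsupport {e : E} {k : ℕ} {f : E → ℂ} {x : E}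
    (h : x ∉ tsupport f) : dirDeriv e k f x = 0 := by
  rw [dirDeriv_congr (notMem_tsupport_iff_eventuallyEq.mp h)]
  simp [dirDeriv]

lemma tsupport_dirDeriv_subset (e : E) (k : ℕ) (f : E → ℂ) :
    tsupport (dirDeriv e k f) ⊆ tsupport f := by
  refine closure_minimal (fun x hx => ?_) (isClosed_tsupport f)
  by_contra h
  exact hx (dirDeriv_eq_zero_of_notMem_tsupport h)

lemma contDiffAt_line {f : E → ℂ} {x : E} (hf : ContDiffAt ℝ ∞ f x) (e : E) :
    ContDiffAt ℝ ∞ (fun τ : ℝ => f (x + τ • e)) 0 := by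
  have h1 : ContDiffAt ℝ ∞ (fun τ : ℝ => x + τ • e) 0 := by fun_prop
  refine ContDiffAt.comp (g := f) 0 ?_ h1
  simpa using hf

lemma dirDeriv_mul {e : E} {k : ℕ} {f g : E → ℂ} {x : E} (hf : ContDiffAt ℝ ∞ f x)
    (hg : ContDiffAt ℝ ∞ g x) :
    dirDeriv e k (fun y => f y * g y) x =
      ∑ i ∈ Finset.range (k + 1), (k.choose i : ℂ) * dirDeriv e i f x * dirDeriv e (k - i) g x :=
  iteratedDeriv_mul (((contDiffAt_line hf e)).of_le (mod_cast le_top))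
    ((contDiffAt_line hg e).of_le (mod_cast le_top))

lemma dirDeriv_add {e : E} {k : ℕ} {f g : E → ℂ} {x : E} (hf : ContDiffAt ℝ ∞ f x)
    (hg : ContDiffAt ℝ ∞ g x) :
    dirDeriv e k (fun y => f y + g y) x = dirDeriv e k f x + dirDeriv e k g x :=
  iteratedDeriv_fun_add (((contDiffAt_line hf e)).of_le (mod_cast le_top))
    ((contDiffAt_line hg e).of_le (mod_cast le_top))

lemma dirDeriv_const_mul (e : E) (k : ℕ) (c : ℂ) (f : E → ℂ) (x : E) :
    dirDeriv e k (fun y => c * f y) x = c * dirDeriv e k f x :=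
  iteratedDeriv_const_mul_field c _

lemma dirDeriv_comp_smul (e : E) (k : ℕ) (f : E → ℂ) (s : ℝ) (x : E) :
    dirDeriv e k (fun y => f (s • y)) x = (s : ℂ) ^ k * dirDeriv e k f (s • x) := by
  induction k generalizing f with
  | zero => simp
  | succ k ih =>
    have h : dirDeriv e 1 (fun y => f (s • y)) = fun y => (s : ℂ) * dirDeriv e 1 f (s • y) := by
      ext y
      rw [dirDeriv_one, dirDeriv_one, lineDeriv, lineDeriv]
      have := deriv_comp_mul_left s (fun τ : ℝ => f (s • y + τ • e)) 0
      simp only [mul_zero, Complex.real_smul] at this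
      rw [← this]
      congr 1
      ext τ
      rw [smul_add, smul_smul]
    rw [dirDeriv_succ' e k, h, dirDeriv_const_mul, ih, dirDeriv_succ' e k f]
    ring

lemma contDiff_dirDeriv {f : E → ℂ} (hf : ContDiff ℝ ∞ f) (e : E) (k : ℕ) :
    ContDiff ℝ ∞ (dirDeriv e k f) := by
  induction k generalizing f with
  | zero => simpa using hf
  | succ k ih =>
    rw [dirDeriv_succ']
    refine ih ?_
    have : dirDeriv e 1 f = fun x => fderiv ℝ f x e := by
      ext x
      rw [dirDeriv_one, DifferentiableAt.lineDeriv_eq_fderiv (hf.differentiable (by simp) x)]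
    rw [this]
    exact (hf.fderiv_right (m := ∞) (by simp)).clm_apply contDiff_const

lemma norm_dirDeriv_le {f : E → ℂ} (hf : ContDiff ℝ ∞ f) (e : E) (k : ℕ) (x : E) :
    ‖dirDeriv e k f x‖ ≤ ‖iteratedFDeriv ℝ k f x‖ * ‖e‖ ^ k := by
  have h1 : (fun τ : ℝ => f (x + τ • e)) =
      (fun y => f (x + y)) ∘ ContinuousLinearMap.toSpanSingleton ℝ e := by
    ext τ; simp
  have hf' : ContDiff ℝ ∞ (fun y => f (x + y)) := hf.comp (contDiff_const.add contDiff_id)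
  rw [dirDeriv, ← norm_iteratedFDeriv_eq_norm_iteratedDeriv, h1,
    ContinuousLinearMap.iteratedFDeriv_comp_right _ hf' _ (mod_cast le_top)]
  refine (ContinuousMultilinearMap.norm_compContinuousLinearMap_le _ _).trans ?_
  rw [iteratedFDeriv_comp_add_left]
  simp [ContinuousLinearMap.norm_toSpanSingleton]

/-- Products of a function with analytic bounds and a function with bounds up to a finite order. -/
lemma norm_dirDeriv_mul_le_of_analytic {e : E} {k : ℕ} {q f : E → ℂ} {x : E} {Q A M B : ℝ}
    (hq : ContDiffAt ℝ ∞ q x) (hf : ContDiffAt ℝ ∞ f x) (hA : 0 ≤ A) (hB : 2 * A * k ≤ B)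
    (hqb : ∀ i ≤ k, ‖dirDeriv e i q x‖ ≤ Q * A ^ i * i.factorial)
    (hfb : ∀ i ≤ k, ‖dirDeriv e i f x‖ ≤ M * B ^ i) :
    ‖dirDeriv e k (fun y => q y * f y) x‖ ≤ 2 * Q * M * B ^ k := by
  have hQ : 0 ≤ Q := by simpa using (norm_nonneg _).trans (hqb 0 (Nat.zero_le _))
  have hM : 0 ≤ M := by simpa using (norm_nonneg _).trans (hfb 0 (Nat.zero_le _))
  have hB0 : 0 ≤ B := le_trans (by positivity) hB
  rw [dirDeriv_mul hq hf]
  refine (norm_sum_le _ _).trans ?_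
  -- Since `choose k i * i! ≤ k ^ i` and `A k ≤ B / 2`, the `i`-th Leibniz term carries a factor
  -- `2^(-i)`. The whole sum thus costs a factor `2`, whatever `k` is.
  have key : ∀ i ∈ Finset.range (k + 1),
      ‖(k.choose i : ℂ) * dirDeriv e i q x * dirDeriv e (k - i) f x‖ ≤
        Q * M * B ^ k * (1 / 2) ^ i := by
    intro i hi
    have hik : i ≤ k := by simpa [Nat.lt_succ_iff] using hi
    rw [norm_mul, norm_mul, Complex.norm_natCast]
    have h1 : (k.choose i : ℝ) * i.factorial ≤ (k : ℝ) ^ i := by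
      have := Nat.descFactorial_le_pow k i
      rw [Nat.descFactorial_eq_factorial_mul_choose, mul_comm] at this
      exact_mod_cast this
    calc (k.choose i : ℝ) * ‖dirDeriv e i q x‖ * ‖dirDeriv e (k - i) f x‖
        ≤ (k.choose i : ℝ) * (Q * A ^ i * i.factorial) * (M * B ^ (k - i)) := by
          gcongr
          · exact hqb i hik
          · exact hfb _ (Nat.sub_le _ _)
      _ = Q * M * (((k.choose i : ℝ) * i.factorial) * A ^ i) * B ^ (k - i) := by ring
      _ ≤ Q * M * ((k : ℝ) ^ i * A ^ i) * B ^ (k - i) := by gcongr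
      _ = Q * M * (A * k) ^ i * B ^ (k - i) := by rw [mul_pow]; ring
      _ ≤ Q * M * (B * (1 / 2)) ^ i * B ^ (k - i) := by
          have := pow_le_pow_left₀ (by positivity) (show A * k ≤ B * (1 / 2) by linarith) i
          gcongr
      _ = Q * M * (B ^ i * B ^ (k - i)) * (1 / 2) ^ i := by rw [mul_pow]; ring
      _ = Q * M * B ^ k * (1 / 2) ^ i := by rw [← pow_add, Nat.add_sub_cancel' hik]
  refine (Finset.sum_le_sum key).trans ?_
  rw [← Finset.mul_sum]
  have := sum_geometric_two_le (k + 1)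
  have h0 : 0 ≤ Q * M * B ^ k := by positivity
  nlinarith

/-- Products of functions with bounds up to a finite order. -/
lemma norm_dirDeriv_mul_le {e : E} {k : ℕ} {f g : E → ℂ} {x : E} {M₁ M₂ B₁ B₂ : ℝ}
    (hf : ContDiffAt ℝ ∞ f x) (hg : ContDiffAt ℝ ∞ g x)
    (hfb : ∀ i ≤ k, ‖dirDeriv e i f x‖ ≤ M₁ * B₁ ^ i)
    (hgb : ∀ i ≤ k, ‖dirDeriv e i g x‖ ≤ M₂ * B₂ ^ i) :
    ‖dirDeriv e k (fun y => f y * g y) x‖ ≤ M₁ * M₂ * (B₁ + B₂) ^ k := by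
  rw [dirDeriv_mul hf hg, add_pow, Finset.mul_sum]
  refine (norm_sum_le _ _).trans (Finset.sum_le_sum fun i hi => ?_)
  have hik : i ≤ k := by simpa [Nat.lt_succ_iff] using hi
  rw [norm_mul, norm_mul, Complex.norm_natCast]
  have h0 := (norm_nonneg _).trans (hfb i hik)
  calc (k.choose i : ℝ) * ‖dirDeriv e i f x‖ * ‖dirDeriv e (k - i) g x‖
        ≤ (k.choose i : ℝ) * (M₁ * B₁ ^ i) * (M₂ * B₂ ^ (k - i)) := by
          gcongr
          · exact hfb i hik
          · exact hgb _ (Nat.sub_le _ _)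
    _ = _ := by ring

/-- Outside `S` the factor `q` may be arbitrary, but there `f` vanishes locally. This lets phases
and amplitudes that are smooth only on an open set enter integrals over the whole space. -/
lemma contDiff_mul_of_tsupport_subset {S : Set E} (hS : IsOpen S) {q f : E → ℂ}
    (hq : ContDiffOn ℝ ∞ q S) (hf : ContDiff ℝ ∞ f) (hfS : tsupport f ⊆ S) :
    ContDiff ℝ ∞ (fun x => q x * f x) := by
  rw [contDiff_iff_contDiffAt]
  intro x
  by_cases hx : x ∈ S
  · exact (hq.contDiffAt (hS.mem_nhds hx)).mul hf.contDiffAt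
  · have h := notMem_tsupport_iff_eventuallyEq.mp (fun h => hx (hfS h))
    have : (fun x => q x * f x) =ᶠ[𝓝 x] fun _ => 0 := by
      filter_upwards [h] with y hy
      simp [hy]
    exact contDiffAt_const.congr_of_eventuallyEq this

omit [NormedSpace ℝ E] in
lemma tsupport_mul_subset' (q f : E → ℂ) : tsupport (fun x => q x * f x) ⊆ tsupport f :=
  closure_mono fun x hx h => hx (by simp [h])

/-! ### Integration by parts with constants uniform in the number of steps -/

section IntegrationByParts

variable [FiniteDimensional ℝ E] [MeasurableSpace E] [BorelSpace E] (ν : Measure E)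
  [ν.IsAddHaarMeasure]

lemma integral_dirDeriv_eq_zero {f : E → ℂ} (hf : ContDiff ℝ ∞ f) (hc : HasCompactSupport f)
    (e : E) : ∫ x, dirDeriv e 1 f x ∂ν = 0 := by
  have hd : ContDiff ℝ ∞ (dirDeriv e 1 f) := contDiff_dirDeriv hf e 1
  have hdi : Integrable (dirDeriv e 1 f) ν :=
    hd.continuous.integrable_of_hasCompactSupport
      (hc.of_isClosed_subset (isClosed_tsupport _) (tsupport_dirDeriv_subset e 1 f))
  have hfi : Integrable f ν := hf.continuous.integrable_of_hasCompactSupport hc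
  have heq : ∀ x, fderiv ℝ f x e = dirDeriv e 1 f x := fun x => by
    rw [dirDeriv_one, DifferentiableAt.lineDeriv_eq_fderiv (hf.differentiable (by simp) x)]
  have := integral_mul_fderiv_eq_neg_fderiv_mul_of_integrable (μ := ν) (f := fun _ : E => (1 : ℂ))
    (g := f) (v := e) (by simp) (by simpa [heq] using hdi) (by simpa using hfi)
    (fun _ _ => differentiableAt_const _) (fun x _ => hf.differentiable (by simp) x)
  simpa [heq] using this

/-- Repeated integration by parts along a fixed direction, with control of the constants. -/
theorem norm_integral_cexp_mul_le {S K : Set E} (hS : IsOpen S) (hK : IsCompact K) (hKS : K ⊆ S)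
    {Φ q : E → ℂ} {e : E} (hΦ : ContDiffOn ℝ ∞ Φ S) (hq : ContDiffOn ℝ ∞ q S)
    (hΦre : ∀ x ∈ S, (Φ x).im = 0) (hqΦ : ∀ x ∈ S, q x * dirDeriv e 1 Φ x = 1)
    {Q A B : ℝ} (hA : 0 ≤ A) (L : ℕ) (hB : 2 * A * L ≤ B)
    (hqb : ∀ i ≤ L, ∀ x ∈ K, ‖dirDeriv e i q x‖ ≤ Q * A ^ i * i.factorial)
    {f : E → ℂ} (hf : ContDiff ℝ ∞ f) (hfK : tsupport f ⊆ K) {M : ℝ}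
    (hfb : ∀ i ≤ L, ∀ x ∈ K, ‖dirDeriv e i f x‖ ≤ M * B ^ i) :
    ‖∫ x, Complex.exp (Complex.I * Φ x) * f x ∂ν‖ ≤ ν.real K * (M * (2 * Q * B) ^ L) := by
  -- `B` stays fixed through the induction. One step replaces `f` by `∂_e (q f)`, multiplies `M` by
  -- `2 Q B`, and uses up one of the available derivatives.
  induction L generalizing f M with
  | zero =>
    have hsupp : ∀ x, x ∉ K → Complex.exp (Complex.I * Φ x) * f x = 0 := fun x hx => by
      rw [image_eq_zero_of_notMem_tsupport fun h => hx (hfK h), mul_zero]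
    rw [← setIntegral_eq_integral_of_forall_compl_eq_zero hsupp]
    refine (norm_setIntegral_le_of_norm_le_const hK.measure_lt_top (C := M) fun x hx => ?_).trans
      (by simp [mul_comm])
    rw [norm_mul, Complex.norm_exp]
    have h1 := hfb 0 le_rfl x hx
    simpa [hΦre x (hKS hx)] using h1
  | succ L ih =>
    set g : E → ℂ := fun x => q x * f x with hg
    have hgs : ContDiff ℝ ∞ g := contDiff_mul_of_tsupport_subset hS hq hf (hfK.trans hKS)
    have hgK : tsupport g ⊆ K := (tsupport_mul_subset' q f).trans hfK
    have hexp : ContDiffOn ℝ ∞ (fun x => Complex.exp (Complex.I * Φ x)) S :=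
      (contDiffOn_const.mul hΦ).cexp
    have hG := contDiff_mul_of_tsupport_subset hS hexp hgs (hgK.trans hKS)
    have hGK := (tsupport_mul_subset' (fun x => Complex.exp (Complex.I * Φ x)) g).trans hgK
    have h0 := integral_dirDeriv_eq_zero ν hG (hK.of_isClosed_subset (isClosed_tsupport _) hGK) e
    set g1 := dirDeriv e 1 g with hg1
    have hg1s : ContDiff ℝ ∞ g1 := contDiff_dirDeriv hgs e 1
    have hg1K : tsupport g1 ⊆ K := (tsupport_dirDeriv_subset e 1 g).trans hgK
    -- Because `q ∂_e Φ = 1`, the exact derivative of `e^{iΦ} q f` is `i e^{iΦ} f + e^{iΦ} ∂_e (q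
    -- f)`. Its integral vanishes, so the two terms have integrals of equal modulus.
    have hpt : ∀ x, dirDeriv e 1 (fun x => Complex.exp (Complex.I * Φ x) * g x) x =
        Complex.I * (Complex.exp (Complex.I * Φ x) * f x) +
          Complex.exp (Complex.I * Φ x) * g1 x := by
      intro x
      by_cases hx : x ∈ S
      · have hΦx := hΦ.contDiffAt (hS.mem_nhds hx)
        have hex := hexp.contDiffAt (hS.mem_nhds hx)
        have hl : HasLineDerivAt ℝ Φ (dirDeriv e 1 Φ x) x e := by
          rw [dirDeriv_one]
          exact (hΦx.differentiableAt (by simp)).lineDifferentiableAt.hasLineDerivAt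
        have h2 : dirDeriv e 1 (fun x => Complex.exp (Complex.I * Φ x)) x =
            Complex.exp (Complex.I * Φ x) * (Complex.I * dirDeriv e 1 Φ x) := by
          rw [dirDeriv_one]
          refine HasLineDerivAt.lineDeriv ?_
          have := (HasDerivAt.const_mul Complex.I hl).cexp
          simpa [HasLineDerivAt] using this
        rw [dirDeriv_mul hex hgs.contDiffAt]
        simp only [Finset.sum_range_succ, Finset.range_zero, Finset.sum_empty, dirDeriv_zero]
        simp only [Nat.choose_self, Nat.choose_zero_right, h2, hg]
        have := hqΦ x hx
        simp only [Nat.cast_one, one_mul, zero_add, Nat.sub_zero, Nat.sub_self, dirDeriv_zero]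
        linear_combination (Complex.exp (Complex.I * Φ x) * Complex.I * f x) * this
      · have hxf : x ∉ tsupport f := fun h => hx (hKS (hfK h))
        rw [dirDeriv_eq_zero_of_notMem_tsupport fun h => hx (hKS (hGK h)),
          image_eq_zero_of_notMem_tsupport hxf,
          image_eq_zero_of_notMem_tsupport fun h => hx (hKS (hg1K h))]
        simp
    have hi1 : Integrable (fun x => Complex.exp (Complex.I * Φ x) * f x) ν :=
      (contDiff_mul_of_tsupport_subset hS hexp hf
        (hfK.trans hKS)).continuous.integrable_of_hasCompactSupport
        (hK.of_isClosed_subset (isClosed_tsupport _) ((tsupport_mul_subset' _ _).trans hfK))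
    have hi2 : Integrable (fun x => Complex.exp (Complex.I * Φ x) * g1 x) ν :=
      (contDiff_mul_of_tsupport_subset hS hexp hg1s
        (hg1K.trans hKS)).continuous.integrable_of_hasCompactSupport
        (hK.of_isClosed_subset (isClosed_tsupport _) ((tsupport_mul_subset' _ _).trans hg1K))
    simp_rw [hpt] at h0
    rw [integral_add (hi1.const_mul _) hi2, integral_const_mul] at h0
    have hnorm : ‖∫ x, Complex.exp (Complex.I * Φ x) * f x ∂ν‖ =
        ‖∫ x, Complex.exp (Complex.I * Φ x) * g1 x ∂ν‖ := by
      rw [← norm_neg (∫ x, Complex.exp (Complex.I * Φ x) * g1 x ∂ν),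
        ← eq_neg_of_add_eq_zero_left h0, norm_mul, Complex.norm_I, one_mul]
    have hL : 2 * A * L ≤ B := by
      refine le_trans ?_ hB
      push_cast
      nlinarith
    -- The `i`-th derivative of the new function is the `(i+1)`-st of `q f`, of size `2 Q M B ^
    -- (i+1)`; the extra `B` goes into the new `M`.
    have := ih hL (fun i hi => hqb i (by omega)) hg1s hg1K (M := 2 * Q * M * B) (by
      intro i hi x hx
      rw [hg1, ← dirDeriv_succ']
      have h := norm_dirDeriv_mul_le_of_analytic (e := e) (k := i + 1) (x := x)
        (hq.contDiffAt (hS.mem_nhds (hKS hx))) hf.contDiffAt (B := B) hA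
        (le_trans (by push_cast; gcongr) hB)
        (fun j hj => hqb j (by omega) x hx) (fun j hj => hfb j (by omega) x hx)
      rw [hg]
      refine h.trans_eq (by ring))
    rw [hnorm]
    refine this.trans_eq (by ring)

end IntegrationByParts

end DirectionalDerivative

/-! ### Restrictions of holomorphic functions -/

section Holomorphic

lemma iteratedDeriv_comp_ofReal {F : ℂ → ℂ} {r : ℝ} (hF : DifferentiableOn ℂ F (Metric.ball 0 r))
    (k : ℕ) {τ : ℝ} (hτ : (τ : ℂ) ∈ Metric.ball (0 : ℂ) r) :
    iteratedDeriv k (fun t : ℝ => F t) τ = iteratedDeriv k F τ := by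
  induction k generalizing τ with
  | zero => simp
  | succ k ih =>
    have han : AnalyticOnNhd ℂ F (Metric.ball 0 r) := hF.analyticOnNhd Metric.isOpen_ball
    rw [iteratedDeriv_succ, iteratedDeriv_succ]
    have hev : iteratedDeriv k (fun t : ℝ => F t) =ᶠ[𝓝 τ] fun t : ℝ => iteratedDeriv k F t := by
      have : ∀ᶠ t : ℝ in 𝓝 τ, (t : ℂ) ∈ Metric.ball (0 : ℂ) r :=
        Complex.continuous_ofReal.continuousAt.eventually (Metric.isOpen_ball.mem_nhds hτ)
      filter_upwards [this] with t ht using ih ht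
    rw [hev.deriv_eq]
    have hd : DifferentiableAt ℂ (iteratedDeriv k F) τ := by
      rw [iteratedDeriv_eq_iterate]
      exact (han.iterated_deriv k _ hτ).differentiableAt
    exact hd.hasDerivAt.comp_ofReal.deriv

/-- Cauchy's estimates for a function which along a real line is the restriction of a holomorphic
function. -/
lemma norm_dirDeriv_le_of_holomorphic {E : Type*} [NormedAddCommGroup E] [NormedSpace ℝ E]
    {f : E → ℂ} {F : ℂ → ℂ} {x e : E} {r M : ℝ} (hr : 0 < r)
    (hF : DifferentiableOn ℂ F (Metric.ball 0 r)) (hM : ∀ ζ ∈ Metric.ball (0 : ℂ) r, ‖F ζ‖ ≤ M)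
    (hfF : ∀ᶠ τ : ℝ in 𝓝 0, f (x + τ • e) = F τ) (k : ℕ) :
    ‖dirDeriv e k f x‖ ≤ M * (2 / r) ^ k * k.factorial := by
  have h0 : ((0 : ℝ) : ℂ) ∈ Metric.ball (0 : ℂ) r := by simpa using hr
  have h1 : dirDeriv e k f x = iteratedDeriv k F 0 := by
    rw [dirDeriv, Filter.EventuallyEq.iteratedDeriv_eq k hfF, iteratedDeriv_comp_ofReal hF k h0]
    simp
  have hsub : Metric.closedBall (0 : ℂ) (r / 2) ⊆ Metric.ball 0 r :=
    Metric.closedBall_subset_ball (by linarith)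
  -- The bound on `F` is known on the open disc only, so the circle of radius `r / 2` is used. This
  -- is the source of the constant `2 / r` in all later Cauchy estimates.
  have h2 := Complex.norm_iteratedDeriv_le_of_forall_mem_sphere_norm_le (c := (0 : ℂ)) (R := r / 2)
    (f := F) (C := M) k (by positivity) ((hF.mono hsub).diffContOnCl_ball le_rfl)
    (fun z hz => hM z (hsub (Metric.sphere_subset_closedBall hz)))
  rw [h1]
  refine h2.trans_eq ?_
  rw [div_pow, div_pow]
  field_simp

variable {X : Type*} [NormedAddCommGroup X] [NormedSpace ℂ X]

lemma lineDeriv_add_smul (G : X → ℂ) (p v : X) (ζ : ℂ) :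
    lineDeriv ℂ G (p + ζ • v) v = deriv (fun w : ℂ => G (p + w • v)) ζ := by
  rw [lineDeriv]
  have := deriv_comp_const_add (f := fun w : ℂ => G (p + w • v)) ζ 0
  simp only [add_zero] at this
  rw [← this]
  congr 1
  ext s
  rw [add_smul, add_assoc]

lemma differentiableOn_line {G : X → ℂ} {W : Set X} (hG : DifferentiableOn ℂ G W) {p v : X}
    {U : Set ℂ} (hU : ∀ ζ ∈ U, p + ζ • v ∈ W) :
    DifferentiableOn ℂ (fun ζ : ℂ => G (p + ζ • v)) U :=
  hG.comp (by fun_prop) hU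

lemma differentiableOn_lineDeriv {G : X → ℂ} {W : Set X} (hG : DifferentiableOn ℂ G W) {p v : X}
    {U : Set ℂ} (hUo : IsOpen U) (hU : ∀ ζ ∈ U, p + ζ • v ∈ W) :
    DifferentiableOn ℂ (fun ζ : ℂ => lineDeriv ℂ G (p + ζ • v) v) U := by
  simp_rw [lineDeriv_add_smul]
  exact (differentiableOn_line hG hU).deriv hUo

/-- Cauchy's estimate on a small circle in direction `v` bounds the difference of two derivatives by
the supremum of a difference of values of `G`, which uniform continuity on a closed ball makes
small. -/
lemma continuousOn_lineDeriv [FiniteDimensional ℂ X] {G : X → ℂ} {W : Set X} (hW : IsOpen W)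
    (hG : DifferentiableOn ℂ G W) (v : X) : ContinuousOn (fun p => lineDeriv ℂ G p v) W := by
  have : ProperSpace X := FiniteDimensional.proper ℂ X
  intro p₀ hp₀
  refine ContinuousAt.continuousWithinAt ?_
  obtain ⟨δ, hδ, hδW⟩ := Metric.nhds_basis_closedBall.mem_iff.mp (hW.mem_nhds hp₀)
  have huc : UniformContinuousOn G (Metric.closedBall p₀ δ) :=
    (isCompact_closedBall p₀ δ).uniformContinuousOn_of_continuous (hG.continuousOn.mono hδW)
  set ρ : ℝ := δ / 2 / (‖v‖ + 1) with hρ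
  have hv : 0 < ‖v‖ + 1 := by positivity
  have hρ0 : 0 < ρ := by positivity
  have hmem : ∀ p ∈ Metric.ball p₀ (δ / 2), ∀ ζ ∈ Metric.closedBall (0 : ℂ) ρ,
      p + ζ • v ∈ Metric.closedBall p₀ δ := by
    intro p hp ζ hζ
    rw [mem_closedBall_zero_iff] at hζ
    rw [mem_ball_iff_norm] at hp
    rw [mem_closedBall_iff_norm]
    have h1 : ‖ζ • v‖ ≤ δ / 2 := by
      rw [norm_smul]
      calc ‖ζ‖ * ‖v‖ ≤ ρ * (‖v‖ + 1) := by gcongr; linarith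
        _ = δ / 2 := by rw [hρ]; field_simp
    calc ‖p + ζ • v - p₀‖ = ‖(p - p₀) + ζ • v‖ := by congr 1; abel
      _ ≤ ‖p - p₀‖ + ‖ζ • v‖ := norm_add_le _ _
      _ ≤ δ := by linarith
  rw [Metric.continuousAt_iff]
  intro ε hε
  obtain ⟨γ, hγ, hγG⟩ := Metric.uniformContinuousOn_iff.mp huc (ε * ρ / 2) (by positivity)
  refine ⟨min (δ / 2) γ, by positivity, fun {p} hp => ?_⟩
  have hp1 : p ∈ Metric.ball p₀ (δ / 2) := lt_of_lt_of_le hp (min_le_left _ _)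
  have hp2 : dist p p₀ < γ := lt_of_lt_of_le hp (min_le_right _ _)
  have hp0 : p₀ ∈ Metric.ball p₀ (δ / 2) := Metric.mem_ball_self (by positivity)
  have hd : ∀ p ∈ Metric.ball p₀ (δ / 2),
      DifferentiableOn ℂ (fun ζ : ℂ => G (p + ζ • v)) (Metric.closedBall 0 ρ) := fun p hp =>
    differentiableOn_line hG fun ζ hζ => hδW (hmem p hp ζ hζ)
  have hda : ∀ p ∈ Metric.ball p₀ (δ / 2), DifferentiableAt ℂ (fun ζ : ℂ => G (p + ζ • v)) 0 :=
    fun p hp => (hd p hp).differentiableAt (Metric.closedBall_mem_nhds _ hρ0)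
  rw [dist_eq_norm, lineDeriv, lineDeriv, ← deriv_fun_sub (hda p hp1) (hda p₀ hp0)]
  refine (Complex.norm_deriv_le_of_forall_mem_sphere_norm_le (C := ε * ρ / 2) hρ0
    (((hd p hp1).sub (hd p₀ hp0)).diffContOnCl_ball le_rfl) fun ζ hζ => ?_).trans_lt ?_
  · have hζ' := Metric.sphere_subset_closedBall hζ
    have := hγG _ (hmem p hp1 ζ hζ') _ (hmem p₀ hp0 ζ hζ') (by simpa using hp2)
    rw [dist_eq_norm] at this
    exact this.le
  · rw [div_lt_iff₀ hρ0]
    nlinarith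

end Holomorphic

/-! ### Real and complex coordinates -/

section Coordinates

variable {d : ℕ}

/-- The real coordinate vector. -/
abbrev er (i : Fin d) : EuclideanSpace ℝ (Fin d) := EuclideanSpace.single i 1

/-- The complex coordinate vector. -/
abbrev ec (i : Fin d) : EuclideanSpace ℂ (Fin d) := EuclideanSpace.single i 1

lemma toC_add (x y : EuclideanSpace ℝ (Fin d)) : toC (x + y) = toC x + toC y := by
  ext i; simp [toC]

lemma toC_smul (s : ℝ) (x : EuclideanSpace ℝ (Fin d)) : toC (s • x) = (s : ℂ) • toC x := by
  ext i; simp [toC]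

lemma toC_single (i : Fin d) : toC (er i) = ec i := by
  ext j
  by_cases h : j = i <;> simp [toC, h]

lemma toC_add_smul (x : EuclideanSpace ℝ (Fin d)) (τ : ℝ) (i : Fin d) :
    toC (x + τ • er i) = toC x + (τ : ℂ) • ec i := by
  rw [toC_add, toC_smul, toC_single]

lemma norm_toC (x : EuclideanSpace ℝ (Fin d)) : ‖toC x‖ = ‖x‖ := by
  simp [EuclideanSpace.norm_eq, toC]

lemma toC_sub (x y : EuclideanSpace ℝ (Fin d)) : toC (x - y) = toC x - toC y := by
  ext i; simp [toC]

lemma dist_toC (x y : EuclideanSpace ℝ (Fin d)) : dist (toC x) (toC y) = dist x y := by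
  rw [dist_eq_norm, dist_eq_norm, ← toC_sub, norm_toC]

lemma continuous_toC : Continuous (toC : EuclideanSpace ℝ (Fin d) → EuclideanSpace ℂ (Fin d)) :=
  (Isometry.of_dist_eq dist_toC).continuous

lemma norm_er (i : Fin d) : ‖er i‖ = 1 := by simp

lemma norm_ec (i : Fin d) : ‖ec i‖ = 1 := by simp

lemma eq_sum_ec (z : EuclideanSpace ℂ (Fin d)) : z = ∑ i, z i • ec i := by
  ext j
  simp [Finset.sum_apply, Pi.single_apply]

end Coordinates

/-! ### Multi-indices -/

lemma multiDeriv_zero {n : ℕ} (g : EuclideanSpace ℝ (Fin n) → ℂ) :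
    multiDeriv (0 : Fin n → ℕ) g = g := by
  simp [multiDeriv]

/-- Every integration by parts runs along one coordinate axis, so among the multi-index bounds of
the hypotheses only those for pure powers are needed. -/
lemma multiDeriv_single {n : ℕ} (i : Fin n) (k : ℕ) (g : EuclideanSpace ℝ (Fin n) → ℂ) :
    multiDeriv (Pi.single i k) g = dirDeriv (er i) k g := by
  have key : ∀ l : List (Fin n), l.Nodup →
      l.foldr (fun j h => (partialDeriv j)^[(Pi.single i k : Fin n → ℕ) j] h) g =
        if i ∈ l then (partialDeriv i)^[k] g else g := by
    intro l hl
    induction l with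
    | nil => simp
    | cons j l ih =>
      rw [List.nodup_cons] at hl
      rw [List.foldr_cons, ih hl.2]
      by_cases hji : i = j
      · subst hji
        simp [hl.1]
      · simp [hji]
  rw [multiDeriv, key _ (List.nodup_finRange n), if_pos (List.mem_finRange i),
    dirDeriv_eq_iterate]
  rfl

lemma multiLength_single {n : ℕ} (i : Fin n) (k : ℕ) : multiLength (Pi.single i k) = k := by
  simp [multiLength]

lemma multiFactorial_single {n : ℕ} (i : Fin n) (k : ℕ) :
    multiFactorial (Pi.single i k) = k.factorial := by
  unfold multiFactorial
  rw [Finset.prod_eq_single i]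
  · simp
  · intro j _ hj
    simp [Pi.single_eq_of_ne hj]
  · simp

/-! ### Functions with bounds on finitely many derivatives -/

/-- `f` is smooth and bounded by `M`, and its `k`-th derivatives along the coordinate axes are at most `M * B ^ k`
for `k ≤ L`. -/
structure HasBoundsUpTo {d : ℕ} (L : ℕ) (B M : ℝ) (f : EuclideanSpace ℝ (Fin d) → ℂ) : Prop where
  contDiff : ContDiff ℝ ∞ f
  -- For `d = 0` there is no axis, and the bound on axial derivatives would not even control `f`
  -- itself.
  norm_le : ∀ x, ‖f x‖ ≤ M
  bound : ∀ i, ∀ k ≤ L, ∀ x, ‖dirDeriv (er i) k f x‖ ≤ M * B ^ k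

namespace HasBoundsUpTo

variable {d L : ℕ} {B B₁ B₂ M M₁ M₂ : ℝ} {f g : EuclideanSpace ℝ (Fin d) → ℂ}

lemma nonneg (h : HasBoundsUpTo L B M f) : 0 ≤ M := (norm_nonneg _).trans (h.norm_le 0)

lemma mono (h : HasBoundsUpTo L B₁ M₁ f) (hB : 0 ≤ B₁) (hB' : B₁ ≤ B₂) (hM : M₁ ≤ M₂) :
    HasBoundsUpTo L B₂ M₂ f :=
  ⟨h.contDiff, fun x => (h.norm_le x).trans hM, fun i _ hk x => (h.bound i _ hk x).trans (by
    have := h.nonneg.trans hM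
    gcongr)⟩

lemma mul (hf : HasBoundsUpTo L B₁ M₁ f) (hg : HasBoundsUpTo L B₂ M₂ g) :
    HasBoundsUpTo L (B₁ + B₂) (M₁ * M₂) (fun x => f x * g x) :=
  ⟨hf.contDiff.mul hg.contDiff,
    fun x => by
      rw [norm_mul]
      exact mul_le_mul (hf.norm_le x) (hg.norm_le x) (norm_nonneg _) hf.nonneg,
    fun i _ hk x => norm_dirDeriv_mul_le hf.contDiff.contDiffAt hg.contDiff.contDiffAt
      (fun j hj => hf.bound i j (hj.trans hk) x) (fun j hj => hg.bound i j (hj.trans hk) x)⟩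

lemma add (hf : HasBoundsUpTo L B M₁ f) (hg : HasBoundsUpTo L B M₂ g) :
    HasBoundsUpTo L B (M₁ + M₂) (fun x => f x + g x) :=
  ⟨hf.contDiff.add hg.contDiff,
    fun x => (norm_add_le _ _).trans (add_le_add (hf.norm_le x) (hg.norm_le x)),
    fun i k hk x => by
      rw [dirDeriv_add hf.contDiff.contDiffAt hg.contDiff.contDiffAt, add_mul]
      exact (norm_add_le _ _).trans (add_le_add (hf.bound i k hk x) (hg.bound i k hk x))⟩

lemma neg (hf : HasBoundsUpTo L B M f) : HasBoundsUpTo L B M (fun x => -f x) :=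
  ⟨hf.contDiff.neg, fun x => by rw [norm_neg]; exact hf.norm_le x, fun i k hk x => by
    have := dirDeriv_const_mul (er i) k (-1) f x
    simp only [neg_one_mul] at this
    rw [this, norm_neg]
    exact hf.bound i k hk x⟩

lemma const (c : ℂ) (hB : 0 ≤ B) :
    HasBoundsUpTo L B ‖c‖ (fun _ : EuclideanSpace ℝ (Fin d) => c) :=
  ⟨contDiff_const, fun _ => le_rfl, fun _ k _ _ => by
    cases k with
    | zero => simp
    | succ k => simp [dirDeriv, iteratedDeriv_const]; positivity⟩

lemma comp_smul (hf : HasBoundsUpTo L B M f) {s : ℝ} (hs : 0 ≤ s) :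
    HasBoundsUpTo L (s * B) M (fun x => f (s • x)) :=
  ⟨hf.contDiff.comp (contDiff_const_smul s), fun x => hf.norm_le _, fun i k hk x => by
    rw [dirDeriv_comp_smul, norm_mul, norm_pow, Complex.norm_real, Real.norm_of_nonneg hs, mul_pow]
    have := mul_le_mul_of_nonneg_left (hf.bound i k hk (s • x)) (pow_nonneg hs k)
    linarith⟩

end HasBoundsUpTo

/-! ### Holomorphic extensions of phases and amplitudes -/

/-- `φC` is a holomorphic extension of the analytic phase `φ` to `ΩC × ΘC`. -/
structure IsPhaseExtension {N n : ℕ} (Ω : Opens (EuclideanSpace ℝ (Fin N)))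
    (φ : EuclideanSpace ℝ (Fin N) → EuclideanSpace ℝ (Fin n) → ℝ)
    (ΩC : Set (EuclideanSpace ℂ (Fin N))) (ΘC : Set (EuclideanSpace ℂ (Fin n)))
    (φC : EuclideanSpace ℂ (Fin N) × EuclideanSpace ℂ (Fin n) → ℂ) : Prop where
  smooth : ContDiffOn ℝ ∞
    (fun p : EuclideanSpace ℝ (Fin N) × EuclideanSpace ℝ (Fin n) => φ p.1 p.2)
    ((Ω : Set (EuclideanSpace ℝ (Fin N))) ×ˢ {0}ᶜ)
  isOpen_left : IsOpen ΩC
  mem_left : ∀ z ∈ Ω, toC z ∈ ΩC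
  isOpen_right : IsOpen ΘC
  mem_right : ∀ η : EuclideanSpace ℝ (Fin n), η ≠ 0 → toC η ∈ ΘC
  smul_mem : ∀ θ ∈ ΘC, ∀ σ : ℝ, 0 < σ → (σ : ℂ) • θ ∈ ΘC
  holomorphic : DifferentiableOn ℂ φC (ΩC ×ˢ ΘC)
  extends_real : ∀ z ∈ Ω, ∀ η : EuclideanSpace ℝ (Fin n), η ≠ 0 →
    φC (toC z, toC η) = (φ z η : ℂ)
  homogeneous : ∀ z ∈ ΩC, ∀ θ ∈ ΘC, ∀ σ : ℝ, 0 < σ →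
    φC (z, (σ : ℂ) • θ) = (σ : ℂ) * φC (z, θ)
  fderiv_ne_zero : ∀ z ∈ ΩC, ∀ θ ∈ ΘC, fderiv ℂ φC (z, θ) ≠ 0

lemma IsAnalyticPhase.exists_extension {N n : ℕ} {Ω : Opens (EuclideanSpace ℝ (Fin N))}
    {φ : EuclideanSpace ℝ (Fin N) → EuclideanSpace ℝ (Fin n) → ℝ} (h : IsAnalyticPhase Ω φ) :
    ∃ ΩC ΘC φC, IsPhaseExtension Ω φ ΩC ΘC φC := by
  obtain ⟨h0, ΩC, ΘC, φC, h1, h2, h3, h4, h5, -, h7, h8, h9⟩ := h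
  exact ⟨ΩC, ΘC, φC, h0, h1, h2, h3, h4, h5, h7, h8, fun z hz θ hθ => (h9 z hz θ hθ).1,
    fun z hz θ hθ => (h9 z hz θ hθ).2⟩

namespace IsPhaseExtension

variable {N n : ℕ} {Ω : Opens (EuclideanSpace ℝ (Fin N))}
  {φ : EuclideanSpace ℝ (Fin N) → EuclideanSpace ℝ (Fin n) → ℝ}
  {ΩC : Set (EuclideanSpace ℂ (Fin N))} {ΘC : Set (EuclideanSpace ℂ (Fin n))}
  {φC : EuclideanSpace ℂ (Fin N) × EuclideanSpace ℂ (Fin n) → ℂ}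

lemma isOpen_prod (h : IsPhaseExtension Ω φ ΩC ΘC φC) : IsOpen (ΩC ×ˢ ΘC) :=
  h.isOpen_left.prod h.isOpen_right

lemma smooth_left (h : IsPhaseExtension Ω φ ΩC ΘC φC) {η : EuclideanSpace ℝ (Fin n)}
    (hη : η ≠ 0) : ContDiffOn ℝ ∞ (fun z => φ z η) Ω :=
  h.smooth.comp (contDiff_id.prodMk contDiff_const).contDiffOn fun _ hz => ⟨hz, hη⟩

lemma smooth_right (h : IsPhaseExtension Ω φ ΩC ΘC φC) {z : EuclideanSpace ℝ (Fin N)}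
    (hz : z ∈ Ω) : ContDiffOn ℝ ∞ (fun η => φ z η) {0}ᶜ :=
  h.smooth.comp (contDiff_const.prodMk contDiff_id).contDiffOn fun _ hη => ⟨hz, hη⟩

/-- The homogeneity identity may be differentiated in `z` with `θ` fixed. Thus `φ_z` grows like `μ`
at frequencies of size `μ`, just as the covector `μρ` does. -/
lemma lineDeriv_left_smul (h : IsPhaseExtension Ω φ ΩC ΘC φC) {z : EuclideanSpace ℂ (Fin N)}
    (hz : z ∈ ΩC) {θ : EuclideanSpace ℂ (Fin n)} (hθ : θ ∈ ΘC) {σ : ℝ} (hσ : 0 < σ)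
    (v : EuclideanSpace ℂ (Fin N)) :
    lineDeriv ℂ φC (z, (σ : ℂ) • θ) (v, 0) = σ * lineDeriv ℂ φC (z, θ) (v, 0) := by
  rw [lineDeriv, lineDeriv]
  have hc : Continuous (fun ζ : ℂ => z + ζ • v) := by fun_prop
  have hev : ∀ᶠ ζ : ℂ in 𝓝 0, z + ζ • v ∈ ΩC :=
    hc.continuousAt.eventually (h.isOpen_left.mem_nhds (by simpa using hz))
  rw [← deriv_const_mul_field]
  refine Filter.EventuallyEq.deriv_eq ?_
  filter_upwards [hev] with ζ hζ
  simpa using h.homogeneous _ hζ θ hθ σ hσ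

/-- Differentiating in the frequency lowers the degree of homogeneity from one to zero: the factor
`σ` cancels against the rescaled increment. -/
lemma lineDeriv_right_smul (h : IsPhaseExtension Ω φ ΩC ΘC φC) {z : EuclideanSpace ℂ (Fin N)}
    (hz : z ∈ ΩC) {θ : EuclideanSpace ℂ (Fin n)} (hθ : θ ∈ ΘC) {σ : ℝ} (hσ : 0 < σ)
    (v : EuclideanSpace ℂ (Fin n)) :
    lineDeriv ℂ φC (z, (σ : ℂ) • θ) (0, v) = lineDeriv ℂ φC (z, θ) (0, v) := by
  rw [lineDeriv, lineDeriv]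
  have hσ' : (σ : ℂ) ≠ 0 := by exact_mod_cast hσ.ne'
  have hc : Continuous (fun ζ : ℂ => θ + ((σ : ℂ)⁻¹ * ζ) • v) := by fun_prop
  have hev : ∀ᶠ ζ : ℂ in 𝓝 0, θ + ((σ : ℂ)⁻¹ * ζ) • v ∈ ΘC :=
    hc.continuousAt.eventually (h.isOpen_right.mem_nhds (by simpa using hθ))
  have h1 := deriv_comp_mul_left (σ : ℂ)⁻¹ (fun ζ : ℂ => φC ((z, θ) + ζ • (0, v))) 0
  rw [mul_zero, smul_eq_mul] at h1
  have h2 : deriv (fun ζ : ℂ => φC ((z, (σ : ℂ) • θ) + ζ • (0, v))) 0 =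
      deriv (fun ζ : ℂ => (σ : ℂ) * φC ((z, θ) + ((σ : ℂ)⁻¹ * ζ) • (0, v))) 0 := by
    refine Filter.EventuallyEq.deriv_eq ?_
    filter_upwards [hev] with ζ hζ
    have := h.homogeneous z hz _ hζ σ hσ
    rw [smul_add, smul_smul, mul_inv_cancel_left₀ hσ'] at this
    simpa using this
  rw [h2, deriv_const_mul_field, h1, mul_inv_cancel_left₀ hσ']

lemma differentiableAt_line (h : IsPhaseExtension Ω φ ΩC ΘC φC)
    {p : EuclideanSpace ℂ (Fin N) × EuclideanSpace ℂ (Fin n)} (hp : p ∈ ΩC ×ˢ ΘC)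
    (v : EuclideanSpace ℂ (Fin N) × EuclideanSpace ℂ (Fin n)) :
    DifferentiableAt ℂ (fun ζ : ℂ => φC (p + ζ • v)) 0 := by
  have : DifferentiableAt ℂ φC (p + (0 : ℂ) • v) := by
    simpa using h.holomorphic.differentiableAt (h.isOpen_prod.mem_nhds hp)
  exact this.comp (0 : ℂ) (f := fun ζ : ℂ => p + ζ • v) (by fun_prop)

lemma hasDerivAt_left (h : IsPhaseExtension Ω φ ΩC ΘC φC) {z : EuclideanSpace ℝ (Fin N)}
    (hz : z ∈ Ω) {η : EuclideanSpace ℝ (Fin n)} (hη : η ≠ 0) (i : Fin N) :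
    HasLineDerivAt ℝ (fun z => (φ z η : ℂ)) (lineDeriv ℂ φC (toC z, toC η) (ec i, 0)) z (er i) := by
  have hp : (toC z, toC η) ∈ ΩC ×ˢ ΘC := ⟨h.mem_left z hz, h.mem_right η hη⟩
  have h1 := (h.differentiableAt_line hp (ec i, 0)).hasDerivAt.comp_ofReal (z := 0)
  have hc : Continuous (fun τ : ℝ => z + τ • er i) := by fun_prop
  have hev : ∀ᶠ τ : ℝ in 𝓝 0, z + τ • er i ∈ Ω :=
    hc.continuousAt.eventually (Ω.isOpen.mem_nhds (by simpa using hz))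
  refine HasDerivAt.congr_of_eventuallyEq h1 ?_
  filter_upwards [hev] with τ hτ
  rw [← h.extends_real _ hτ η hη, toC_add_smul]
  simp

lemma hasDerivAt_right (h : IsPhaseExtension Ω φ ΩC ΘC φC) {z : EuclideanSpace ℝ (Fin N)}
    (hz : z ∈ Ω) {η : EuclideanSpace ℝ (Fin n)} (hη : η ≠ 0) (i : Fin n) :
    HasLineDerivAt ℝ (fun η => (φ z η : ℂ)) (lineDeriv ℂ φC (toC z, toC η) (0, ec i)) η (er i) := by
  have hp : (toC z, toC η) ∈ ΩC ×ˢ ΘC := ⟨h.mem_left z hz, h.mem_right η hη⟩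
  have h1 := (h.differentiableAt_line hp (0, ec i)).hasDerivAt.comp_ofReal (z := 0)
  have hc : Continuous (fun τ : ℝ => η + τ • er i) := by fun_prop
  have hev : ∀ᶠ τ : ℝ in 𝓝 0, η + τ • er i ∈ ({0}ᶜ : Set (EuclideanSpace ℝ (Fin n))) :=
    hc.continuousAt.eventually (isOpen_compl_singleton.mem_nhds (by simpa using hη))
  refine HasDerivAt.congr_of_eventuallyEq h1 ?_
  filter_upwards [hev] with τ hτ
  rw [← h.extends_real _ hz _ hτ, toC_add_smul]
  simp

/-- The total differential is linear and determined by the coordinate directions. This is where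
nondegeneracy of the phase enters. -/
lemma exists_lineDeriv_ne_zero (h : IsPhaseExtension Ω φ ΩC ΘC φC)
    {z : EuclideanSpace ℂ (Fin N)} (hz : z ∈ ΩC) {θ : EuclideanSpace ℂ (Fin n)} (hθ : θ ∈ ΘC) :
    (∃ i, lineDeriv ℂ φC (z, θ) (ec i, 0) ≠ 0) ∨ ∃ i, lineDeriv ℂ φC (z, θ) (0, ec i) ≠ 0 := by
  by_contra! hcon
  refine h.fderiv_ne_zero z hz θ hθ ?_
  have hd : DifferentiableAt ℂ φC (z, θ) :=
    h.holomorphic.differentiableAt (h.isOpen_prod.mem_nhds ⟨hz, hθ⟩)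
  simp_rw [hd.lineDeriv_eq_fderiv] at hcon
  refine ContinuousLinearMap.ext fun ⟨v, w⟩ => ?_
  have hv : fderiv ℂ φC (z, θ) (v, 0) = 0 := by
    have : ((v, 0) : EuclideanSpace ℂ (Fin N) × EuclideanSpace ℂ (Fin n)) =
        ∑ i, v i • (ec i, 0) := by
      rw [Prod.ext_iff, Prod.fst_sum, Prod.snd_sum]
      exact ⟨by simpa using eq_sum_ec v, by simp⟩
    rw [this, map_sum]
    exact Finset.sum_eq_zero fun i _ => by rw [map_smul, hcon.1 i, smul_zero]
  have hw : fderiv ℂ φC (z, θ) (0, w) = 0 := by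
    have : ((0, w) : EuclideanSpace ℂ (Fin N) × EuclideanSpace ℂ (Fin n)) =
        ∑ i, w i • (0, ec i) := by
      rw [Prod.ext_iff, Prod.fst_sum, Prod.snd_sum]
      exact ⟨by simp, by simpa using eq_sum_ec w⟩
    rw [this, map_sum]
    exact Finset.sum_eq_zero fun i _ => by rw [map_smul, hcon.2 i, smul_zero]
  have : (v, w) = (v, 0) + (0, w) := by simp
  rw [this, map_add, hv, hw]
  simp

end IsPhaseExtension

/-- This passes from partial derivatives of the holomorphic extension, used in all estimates, to the
real gradients that describe the wavefront set. -/
lemma gradient_eq_of_lineDeriv {d : ℕ} {f : EuclideanSpace ℝ (Fin d) → ℝ}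
    {x v : EuclideanSpace ℝ (Fin d)} (hf : DifferentiableAt ℝ f x)
    (h : ∀ i, HasLineDerivAt ℝ (fun y => (f y : ℂ)) (v i : ℂ) x (er i)) : gradient f x = v := by
  ext i
  have h1 : HasLineDerivAt ℝ f (v i) x (er i) := by
    have := Complex.reCLM.hasFDerivAt.comp_hasDerivAt (0 : ℝ) (h i)
    simpa [HasLineDerivAt, Function.comp_def] using this
  have h2 := h1.lineDeriv
  rw [hf.lineDeriv_eq_fderiv, ← inner_gradient_left] at h2
  rw [EuclideanSpace.inner_single_right] at h2
  simpa using h2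

/-- `aC` is a holomorphic extension of the pseudoanalytic amplitude `a` of order `m` to `ΩC`. -/
structure IsAmplitudeExtension {N n : ℕ} (Ω : Opens (EuclideanSpace ℝ (Fin N))) (m : ℝ)
    (a : EuclideanSpace ℝ (Fin N) → EuclideanSpace ℝ (Fin n) → ℂ)
    (ΩC : Set (EuclideanSpace ℂ (Fin N)))
    (aC : EuclideanSpace ℂ (Fin N) → EuclideanSpace ℝ (Fin n) → ℂ) : Prop where
  smooth : ContDiffOn ℝ ∞
    (fun p : EuclideanSpace ℝ (Fin N) × EuclideanSpace ℝ (Fin n) => a p.1 p.2)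
    ((Ω : Set (EuclideanSpace ℝ (Fin N))) ×ˢ {0}ᶜ)
  isExtension : IsHolomorphicExtension Ω a ΩC aC
  bound : ∀ K : Set (EuclideanSpace ℂ (Fin N)), K ⊆ ΩC → IsCompact K →
    ∃ B : ℝ, ∀ z ∈ K, ∀ η : EuclideanSpace ℝ (Fin n), η ≠ 0 → ‖aC z η‖ ≤ B * (1 + ‖η‖) ^ m
  bound_dirDeriv : ∀ K : Set (EuclideanSpace ℂ (Fin N)), K ⊆ ΩC → IsCompact K →
    ∃ M C R : ℝ, 0 < M ∧ 0 < C ∧ 0 < R ∧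
      ∀ i : Fin n, ∀ k : ℕ, ∀ z ∈ K, ∀ η : EuclideanSpace ℝ (Fin n), η ≠ 0 →
        R * max 1 (k : ℝ) ≤ ‖η‖ →
        ‖dirDeriv (er i) k (aC z) η‖ ≤ M * C ^ k * (k.factorial : ℝ) * ‖η‖ ^ (m - (k : ℝ))

lemma IsPseudoanalyticAmplitude.exists_extension {N n : ℕ}
    {Ω : Opens (EuclideanSpace ℝ (Fin N))} {m : ℝ}
    {a : EuclideanSpace ℝ (Fin N) → EuclideanSpace ℝ (Fin n) → ℂ}
    (h : IsPseudoanalyticAmplitude Ω m a) : ∃ ΩC aC, IsAmplitudeExtension Ω m a ΩC aC := by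
  obtain ⟨h0, ΩC, aC, h1, h2⟩ := h
  refine ⟨ΩC, aC, h0, h1, fun K hK hKc => ?_, fun K hK hKc => ?_⟩
  · obtain ⟨B, hB⟩ := (h2 K hK hKc).1 0
    refine ⟨B, fun z hz η hη => ?_⟩
    have := hB z hz η hη
    rw [multiDeriv_zero] at this
    simp only [multiLength, Pi.zero_apply, Finset.sum_const_zero, Nat.cast_zero, add_zero] at this
    have hpos : (0 : ℝ) < 1 + ‖η‖ := by positivity
    rw [Real.rpow_neg hpos.le, inv_mul_le_iff₀ (by positivity)] at this
    linarith
  · obtain ⟨M, C, R, hM, hC, hR, hb⟩ := (h2 K hK hKc).2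
    refine ⟨M, C, R, hM, hC, hR, fun i k z hz η hη hRη => ?_⟩
    have := hb (Pi.single i k) z hz η hη (by rwa [multiLength_single])
    rwa [multiDeriv_single, multiLength_single, multiFactorial_single] at this

namespace IsAmplitudeExtension

variable {N n : ℕ} {Ω : Opens (EuclideanSpace ℝ (Fin N))} {m : ℝ}
  {a : EuclideanSpace ℝ (Fin N) → EuclideanSpace ℝ (Fin n) → ℂ}
  {ΩC : Set (EuclideanSpace ℂ (Fin N))}
  {aC : EuclideanSpace ℂ (Fin N) → EuclideanSpace ℝ (Fin n) → ℂ}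

lemma smooth_left (h : IsAmplitudeExtension Ω m a ΩC aC) {η : EuclideanSpace ℝ (Fin n)}
    (hη : η ≠ 0) : ContDiffOn ℝ ∞ (fun z => a z η) Ω :=
  h.smooth.comp (contDiff_id.prodMk contDiff_const).contDiffOn fun _ hz => ⟨hz, hη⟩

lemma smooth_right (h : IsAmplitudeExtension Ω m a ΩC aC) {z : EuclideanSpace ℝ (Fin N)}
    (hz : z ∈ Ω) : ContDiffOn ℝ ∞ (fun η => a z η) {0}ᶜ :=
  h.smooth.comp (contDiff_const.prodMk contDiff_id).contDiffOn fun _ hη => ⟨hz, hη⟩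

/-- Since `1 + |η| ≥ 1`, the real order can be rounded up to a natural exponent. Later losses are
then counted in the natural power `μ^(p+n)`. -/
lemma exists_bound_pow (h : IsAmplitudeExtension Ω m a ΩC aC) {p : ℕ} (hp : |m| ≤ p)
    {K : Set (EuclideanSpace ℂ (Fin N))} (hK : K ⊆ ΩC) (hKc : IsCompact K) :
    ∃ B : ℝ, 0 < B ∧ ∀ z ∈ K, ∀ η : EuclideanSpace ℝ (Fin n), η ≠ 0 →
      ‖aC z η‖ ≤ B * (1 + ‖η‖) ^ p := by
  obtain ⟨B, hB⟩ := h.bound K hK hKc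
  refine ⟨max B 1, by positivity, fun z hz η hη => (hB z hz η hη).trans ?_⟩
  have h1 : (1 + ‖η‖) ^ m ≤ (1 + ‖η‖) ^ p := by
    rw [← Real.rpow_natCast]
    exact Real.rpow_le_rpow_of_exponent_le (by linarith [norm_nonneg η])
      ((le_abs_self m).trans hp)
  calc B * (1 + ‖η‖) ^ m ≤ max B 1 * (1 + ‖η‖) ^ m := by gcongr; exact le_max_left _ _
    _ ≤ _ := by gcongr

lemma exists_real_bound_pow (h : IsAmplitudeExtension Ω m a ΩC aC) {p : ℕ} (hp : |m| ≤ p)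
    {K : Set (EuclideanSpace ℝ (Fin N))} (hK : K ⊆ Ω) (hKc : IsCompact K) :
    ∃ B : ℝ, 0 < B ∧ ∀ z ∈ K, ∀ η : EuclideanSpace ℝ (Fin n), η ≠ 0 →
      ‖a z η‖ ≤ B * (1 + ‖η‖) ^ p := by
  obtain ⟨B, hB0, hB⟩ := h.exists_bound_pow hp (K := toC '' K)
    (by rintro _ ⟨z, hz, rfl⟩; exact h.isExtension.mem z (hK hz)) (hKc.image continuous_toC)
  refine ⟨B, hB0, fun z hz η hη => ?_⟩
  rw [← h.isExtension.extends_real z (hK hz) η hη]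
  exact hB _ (mem_image_of_mem _ hz) η hη

end IsAmplitudeExtension

/-! ### The regularized oscillatory integrals -/

section Oscillatory

variable {N n : ℕ}

/-- The integral `∬ g(η) e^{iφ(z,η)} a(z,η) f(z) dη dz`. -/
def oscInt (Ω : Opens (EuclideanSpace ℝ (Fin N)))
    (φ : EuclideanSpace ℝ (Fin N) → EuclideanSpace ℝ (Fin n) → ℝ)
    (a : EuclideanSpace ℝ (Fin N) → EuclideanSpace ℝ (Fin n) → ℂ)
    (g : EuclideanSpace ℝ (Fin n) → ℂ) (f : EuclideanSpace ℝ (Fin N) → ℂ) : ℂ :=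
  ∫ z in (Ω : Set (EuclideanSpace ℝ (Fin N))), ∫ η in ({0}ᶜ : Set (EuclideanSpace ℝ (Fin n))),
    g η * (Complex.exp (Complex.I * (φ z η : ℂ)) * a z η * f z)

variable {Ω : Opens (EuclideanSpace ℝ (Fin N))} {m : ℝ}
  {φ : EuclideanSpace ℝ (Fin N) → EuclideanSpace ℝ (Fin n) → ℝ}
  {a : EuclideanSpace ℝ (Fin N) → EuclideanSpace ℝ (Fin n) → ℂ}
  {ΩC ΩC' : Set (EuclideanSpace ℂ (Fin N))} {ΘC : Set (EuclideanSpace ℂ (Fin n))}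
  {φC : EuclideanSpace ℂ (Fin N) × EuclideanSpace ℂ (Fin n) → ℂ}
  {aC : EuclideanSpace ℂ (Fin N) → EuclideanSpace ℝ (Fin n) → ℂ}
  {g g₁ g₂ : EuclideanSpace ℝ (Fin n) → ℂ} {f f₁ f₂ : EuclideanSpace ℝ (Fin N) → ℂ}

lemma norm_exp_I_mul_ofReal (x : ℝ) : ‖Complex.exp (Complex.I * (x : ℂ))‖ = 1 := by
  rw [mul_comm, Complex.norm_exp_ofReal_mul_I]

/-- The global amplitude bound holds uniformly down to `η = 0`, so the singularity there is
harmless. On the compact product of the supports the integrand is bounded, and it is continuous on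
the open product domain. -/
lemma integrable_oscInt (hφ : IsPhaseExtension Ω φ ΩC ΘC φC)
    (ha : IsAmplitudeExtension Ω m a ΩC' aC) (hg : Continuous g) (hgc : HasCompactSupport g)
    (hf : Continuous f) (hfc : HasCompactSupport f) (hfΩ : tsupport f ⊆ Ω) :
    Integrable (fun p : EuclideanSpace ℝ (Fin N) × EuclideanSpace ℝ (Fin n) =>
      g p.2 * (Complex.exp (Complex.I * (φ p.1 p.2 : ℂ)) * a p.1 p.2 * f p.1))
      ((volume.restrict (Ω : Set (EuclideanSpace ℝ (Fin N)))).prod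
        (volume.restrict ({0}ᶜ : Set (EuclideanSpace ℝ (Fin n))))) := by
  obtain ⟨p, hp⟩ := exists_nat_ge |m|
  obtain ⟨B, hB0, hB⟩ := ha.exists_real_bound_pow hp hfΩ hfc
  rw [Measure.prod_restrict]
  set W : Set (EuclideanSpace ℝ (Fin N) × EuclideanSpace ℝ (Fin n)) :=
    (Ω : Set (EuclideanSpace ℝ (Fin N))) ×ˢ {0}ᶜ with hW
  have hWo : IsOpen W := Ω.isOpen.prod isOpen_compl_singleton
  obtain ⟨Mg, hMg⟩ := hgc.exists_bound_of_continuous hg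
  obtain ⟨Mf, hMf⟩ := hfc.exists_bound_of_continuous hf
  obtain ⟨R, hR⟩ := hgc.isCompact.isBounded.exists_norm_le
  set T := tsupport f ×ˢ tsupport g with hT
  have hTc : IsCompact T := hfc.isCompact.prod hgc.isCompact
  refine Integrable.mono' (g := T.indicator fun _ => Mg * (B * (1 + R) ^ p * Mf)) ?_ ?_ ?_
  · refine (Integrable.mono_measure ?_ Measure.restrict_le_self)
    rw [integrable_indicator_iff hTc.measurableSet]
    exact integrableOn_const hTc.measure_ne_top
  · refine ContinuousOn.aestronglyMeasurable ?_ hWo.measurableSet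
    refine (hg.comp continuous_snd).continuousOn.mul
      ((ContinuousOn.mul ?_ ha.smooth.continuousOn).mul (hf.comp continuous_fst).continuousOn)
    exact (continuousOn_const.mul
      (Complex.continuous_ofReal.comp_continuousOn hφ.smooth.continuousOn)).cexp
  · refine (ae_restrict_iff' hWo.measurableSet).mpr (Eventually.of_forall fun x hx => ?_)
    by_cases hxT : x ∈ T
    · rw [indicator_of_mem hxT, norm_mul, norm_mul, norm_mul, norm_exp_I_mul_ofReal, one_mul]
      have h1 := hB x.1 hxT.1 x.2 hx.2
      have h2 := hR x.2 hxT.2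
      have h0 : 0 ≤ R := (norm_nonneg _).trans h2
      have hMf0 := (norm_nonneg _).trans (hMf x.1)
      have hMg0 := (norm_nonneg _).trans (hMg x.2)
      have h3 : ‖a x.1 x.2‖ ≤ B * (1 + R) ^ p := h1.trans (by gcongr)
      have h4 := hMf x.1
      have h5 := hMg x.2
      gcongr
    · rw [indicator_of_notMem hxT]
      by_cases h1 : x.1 ∈ tsupport f
      · have h2 : x.2 ∉ tsupport g := fun h => hxT ⟨h1, h⟩
        simp [image_eq_zero_of_notMem_tsupport h2]
      · simp [image_eq_zero_of_notMem_tsupport h1]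

lemma oscInt_swap (hφ : IsPhaseExtension Ω φ ΩC ΘC φC)
    (ha : IsAmplitudeExtension Ω m a ΩC' aC) (hg : Continuous g) (hgc : HasCompactSupport g)
    (hf : Continuous f) (hfc : HasCompactSupport f) (hfΩ : tsupport f ⊆ Ω) :
    oscInt Ω φ a g f = ∫ η in ({0}ᶜ : Set (EuclideanSpace ℝ (Fin n))), g η *
      ∫ z in (Ω : Set (EuclideanSpace ℝ (Fin N))),
        Complex.exp (Complex.I * (φ z η : ℂ)) * a z η * f z := by
  rw [oscInt, integral_integral_swap (integrable_oscInt hφ ha hg hgc hf hfc hfΩ)]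
  simp_rw [integral_const_mul]

lemma oscInt_eq_prod (hφ : IsPhaseExtension Ω φ ΩC ΘC φC)
    (ha : IsAmplitudeExtension Ω m a ΩC' aC) (hg : Continuous g) (hgc : HasCompactSupport g)
    (hf : Continuous f) (hfc : HasCompactSupport f) (hfΩ : tsupport f ⊆ Ω) :
    oscInt Ω φ a g f = ∫ p, g p.2 * (Complex.exp (Complex.I * (φ p.1 p.2 : ℂ)) * a p.1 p.2 * f p.1)
      ∂((volume.restrict (Ω : Set (EuclideanSpace ℝ (Fin N)))).prod
        (volume.restrict ({0}ᶜ : Set (EuclideanSpace ℝ (Fin n))))) :=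
  (integral_prod _ (integrable_oscInt hφ ha hg hgc hf hfc hfΩ)).symm

lemma oscInt_add_left (hφ : IsPhaseExtension Ω φ ΩC ΘC φC)
    (ha : IsAmplitudeExtension Ω m a ΩC' aC) (hg₁ : Continuous g₁) (hg₁c : HasCompactSupport g₁)
    (hg₂ : Continuous g₂) (hg₂c : HasCompactSupport g₂)
    (hf : Continuous f) (hfc : HasCompactSupport f) (hfΩ : tsupport f ⊆ Ω) :
    oscInt Ω φ a (fun η => g₁ η + g₂ η) f = oscInt Ω φ a g₁ f + oscInt Ω φ a g₂ f := by
  rw [oscInt_eq_prod hφ ha hg₁ hg₁c hf hfc hfΩ, oscInt_eq_prod hφ ha hg₂ hg₂c hf hfc hfΩ,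
    oscInt_eq_prod (g := fun η => g₁ η + g₂ η) hφ ha (hg₁.add hg₂) (hg₁c.add hg₂c) hf hfc hfΩ, ← integral_add
      (integrable_oscInt hφ ha hg₁ hg₁c hf hfc hfΩ) (integrable_oscInt hφ ha hg₂ hg₂c hf hfc hfΩ)]
  simp_rw [add_mul]

lemma oscInt_add_right (hφ : IsPhaseExtension Ω φ ΩC ΘC φC)
    (ha : IsAmplitudeExtension Ω m a ΩC' aC) (hg : Continuous g) (hgc : HasCompactSupport g)
    (hf₁ : Continuous f₁) (hf₁c : HasCompactSupport f₁) (hf₁Ω : tsupport f₁ ⊆ Ω)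
    (hf₂ : Continuous f₂) (hf₂c : HasCompactSupport f₂) (hf₂Ω : tsupport f₂ ⊆ Ω) :
    oscInt Ω φ a g (fun z => f₁ z + f₂ z) = oscInt Ω φ a g f₁ + oscInt Ω φ a g f₂ := by
  have hΩ : tsupport (fun z => f₁ z + f₂ z) ⊆ Ω :=
    (tsupport_add f₁ f₂).trans (union_subset hf₁Ω hf₂Ω)
  rw [oscInt_eq_prod hφ ha hg hgc hf₁ hf₁c hf₁Ω, oscInt_eq_prod hφ ha hg hgc hf₂ hf₂c hf₂Ω,
    oscInt_eq_prod (f := fun z => f₁ z + f₂ z) hφ ha hg hgc (hf₁.add hf₂) (hf₁c.add hf₂c) hΩ, ← integral_add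
      (integrable_oscInt hφ ha hg hgc hf₁ hf₁c hf₁Ω) (integrable_oscInt hφ ha hg hgc hf₂ hf₂c hf₂Ω)]
  simp_rw [mul_add]

lemma oscInt_const_mul_right (c : ℂ) :
    oscInt Ω φ a g (fun z => c * f z) = c * oscInt Ω φ a g f := by
  unfold oscInt
  simp_rw [← integral_const_mul]
  congr 1
  ext z
  congr 1
  ext η
  ring

lemma oscInt_zero_left : oscInt Ω φ a (fun _ => 0) f = 0 := by
  simp [oscInt]

/-- The function `z ↦ e^{-i⟨z,ξ⟩}`. -/
def wave (ξ z : EuclideanSpace ℝ (Fin N)) : ℂ :=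
  Complex.exp (-Complex.I * ((inner ℝ z ξ : ℝ) : ℂ))

lemma contDiff_wave (ξ : EuclideanSpace ℝ (Fin N)) : ContDiff ℝ ∞ (wave ξ) :=
  (planeWave ξ).2

lemma norm_wave (ξ z : EuclideanSpace ℝ (Fin N)) : ‖wave ξ z‖ = 1 := by
  rw [wave, Complex.norm_exp]
  simp

lemma wave_zero : wave (0 : EuclideanSpace ℝ (Fin N)) = fun _ => 1 := by
  ext z; simp [wave]

end Oscillatory

/-! ### Integration by parts in the base and in the frequency variables -/

section LocalEstimates

variable {N n : ℕ} {Ω : Opens (EuclideanSpace ℝ (Fin N))} {m : ℝ}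
  {φ : EuclideanSpace ℝ (Fin N) → EuclideanSpace ℝ (Fin n) → ℝ}
  {a : EuclideanSpace ℝ (Fin N) → EuclideanSpace ℝ (Fin n) → ℂ}
  {ΩC ΩC' : Set (EuclideanSpace ℂ (Fin N))} {ΘC : Set (EuclideanSpace ℂ (Fin n))}
  {φC : EuclideanSpace ℂ (Fin N) × EuclideanSpace ℂ (Fin n) → ℂ}
  {aC : EuclideanSpace ℂ (Fin N) → EuclideanSpace ℝ (Fin n) → ℂ}

lemma contDiffOn_dirDeriv {E : Type*} [NormedAddCommGroup E] [NormedSpace ℝ E] {f : E → ℂ}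
    {S : Set E} (hS : IsOpen S) (hf : ContDiffOn ℝ ∞ f S) (e : E) :
    ContDiffOn ℝ ∞ (dirDeriv e 1 f) S := by
  have h1 : ContDiffOn ℝ ∞ (fun x => fderiv ℝ f x e) S :=
    (hf.fderiv_of_isOpen hS (m := ∞) (by simp)).clm_apply contDiffOn_const
  refine h1.congr fun x hx => ?_
  rw [dirDeriv_one, DifferentiableAt.lineDeriv_eq_fderiv
    ((hf.contDiffAt (hS.mem_nhds hx)).differentiableAt (by simp))]

lemma eventually_add_smul_mem {E : Type*} [NormedAddCommGroup E] [NormedSpace ℝ E] {S : Set E}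
    (hS : IsOpen S) {x : E} (hx : x ∈ S) (e : E) : ∀ᶠ τ : ℝ in 𝓝 0, x + τ • e ∈ S := by
  have hc : Continuous (fun τ : ℝ => x + τ • e) := by fun_prop
  exact hc.continuousAt.eventually (hS.mem_nhds (by simpa using hx))

lemma toC_add_smul_mem_ball {d : ℕ} {x x₀ : EuclideanSpace ℝ (Fin d)} {r : ℝ}
    (hx : x ∈ Metric.closedBall x₀ r) (i : Fin d) {ζ : ℂ} (hζ : ζ ∈ Metric.ball (0 : ℂ) r) :
    toC x + ζ • ec i ∈ Metric.ball (toC x₀) (2 * r) := by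
  rw [mem_ball_zero_iff] at hζ
  rw [mem_ball_iff_norm]
  calc ‖toC x + ζ • ec i - toC x₀‖ = ‖toC (x - x₀) + ζ • ec i‖ := by
        rw [toC_sub]; congr 1; abel
    _ ≤ ‖toC (x - x₀)‖ + ‖ζ • ec i‖ := norm_add_le _ _
    _ = ‖x - x₀‖ + ‖ζ‖ := by rw [norm_toC, norm_smul, norm_ec, mul_one]
    _ < 2 * r := by
        have := mem_closedBall_iff_norm.mp hx
        linarith

/-- Integration by parts in the base variables, for fixed frequency. -/
theorem exists_norm_integral_left_le (hφ : IsPhaseExtension Ω φ ΩC ΘC φC)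
    (ha : IsAmplitudeExtension Ω m a ΩC' aC) {p : ℕ} (hp : |m| ≤ p)
    {x₀ : EuclideanSpace ℝ (Fin N)} {r : ℝ} (hr : 0 < r)
    (hC : Metric.closedBall (toC x₀) (2 * r) ⊆ ΩC)
    (hC' : Metric.closedBall (toC x₀) (2 * r) ⊆ ΩC')
    (hΩ : Metric.closedBall x₀ (2 * r) ⊆ Ω) :
    ∃ C : ℝ, 0 < C ∧ ∀ (i : Fin N) (η : EuclideanSpace ℝ (Fin n)), η ≠ 0 →
      ∀ (ξ : EuclideanSpace ℝ (Fin N)) (c : ℝ), 0 < c →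
      (∀ z ∈ Metric.ball (toC x₀) (2 * r),
        c ≤ ‖lineDeriv ℂ φC (z, toC η) (ec i, 0) - (ξ i : ℂ)‖) →
      ∀ (L : ℕ) (B M : ℝ) (f : EuclideanSpace ℝ (Fin N) → ℂ), 4 / r * L ≤ B →
        HasBoundsUpTo L B M f → tsupport f ⊆ Metric.closedBall x₀ r →
        ‖∫ z in (Ω : Set (EuclideanSpace ℝ (Fin N))),
          Complex.exp (Complex.I * (φ z η : ℂ)) * a z η * (wave ξ z * f z)‖ ≤
          C * (1 + ‖η‖) ^ p * M * (2 * B / c) ^ L := by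
  obtain ⟨Ba, hBa0, hBa⟩ := ha.exists_bound_pow hp hC' (isCompact_closedBall _ _)
  set K := Metric.closedBall x₀ r with hK
  set V : ℝ := (volume : Measure (EuclideanSpace ℝ (Fin N))).real K with hV
  have hV0 : 0 ≤ V := measureReal_nonneg
  -- `2 * Ba` comes from multiplying `f` by the amplitude, `V` from the domain of integration; the
  -- `1` only ensures positivity.
  refine ⟨2 * Ba * V + 1, by positivity, fun i η hη ξ c hc hbd L B M f hB hf hfK => ?_⟩
  set S := Metric.ball x₀ (2 * r) with hS
  have hSΩ : S ⊆ Ω := Metric.ball_subset_closedBall.trans hΩ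
  have hKS : K ⊆ S := Metric.closedBall_subset_ball (by linarith)
  have hηΘ := hφ.mem_right η hη
  set Φ : EuclideanSpace ℝ (Fin N) → ℂ :=
    fun z => (φ z η : ℂ) + -((inner ℝ z ξ : ℝ) : ℂ) with hΦ
  set D : EuclideanSpace ℂ (Fin N) → ℂ :=
    fun z => lineDeriv ℂ φC (z, toC η) (ec i, 0) - (ξ i : ℂ) with hD
  have hφs : ContDiffOn ℝ ∞ (fun z => (φ z η : ℂ)) S :=
    Complex.ofRealCLM.contDiff.comp_contDiffOn ((hφ.smooth_left hη).mono hSΩ)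
  have hin : ContDiff ℝ ∞ (fun z : EuclideanSpace ℝ (Fin N) => -((inner ℝ z ξ : ℝ) : ℂ)) :=
    (Complex.ofRealCLM.contDiff.comp (contDiff_id.inner ℝ contDiff_const)).neg
  have hΦs : ContDiffOn ℝ ∞ Φ S := hφs.add hin.contDiffOn
  have hΦD : ∀ z ∈ S, dirDeriv (er i) 1 Φ z = D (toC z) := by
    intro z hz
    rw [dirDeriv_one]
    refine HasLineDerivAt.lineDeriv ?_
    have h1 := hφ.hasDerivAt_left (hSΩ hz) hη i
    have h2 : HasLineDerivAt ℝ (fun z : EuclideanSpace ℝ (Fin N) => -((inner ℝ z ξ : ℝ) : ℂ))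
        (-(ξ i : ℂ)) z (er i) := by
      have h3 : HasDerivAt (fun τ : ℝ => -(inner ℝ z ξ + τ * ξ i)) (-(ξ i)) 0 := by
        refine (((hasDerivAt_id (0 : ℝ)).mul_const (ξ i)).const_add (inner ℝ z ξ)).fun_neg.congr_deriv ?_
        rw [one_mul]
      have h4 := h3.ofReal_comp
      refine HasDerivAt.congr_of_eventuallyEq (f := fun τ : ℝ => ((-(inner ℝ z ξ + τ * ξ i) : ℝ) : ℂ))
        (by simpa using h4) (Eventually.of_forall fun τ => ?_)
      simp [inner_add_left, inner_smul_left, EuclideanSpace.inner_single_left]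
    exact (HasDerivAt.fun_add h1 h2).congr_deriv (by simp [hD, sub_eq_add_neg])
  have hDne : ∀ z ∈ Metric.ball (toC x₀) (2 * r), D z ≠ 0 := fun z hz h0 => by
    have := hbd z hz
    rw [hD] at h0
    simp only at h0
    rw [h0, norm_zero] at this
    linarith
  have hSC : ∀ z ∈ S, toC z ∈ Metric.ball (toC x₀) (2 * r) := fun z hz => by
    rw [Metric.mem_ball, dist_toC]; exact hz
  set q : EuclideanSpace ℝ (Fin N) → ℂ := fun z => (dirDeriv (er i) 1 Φ z)⁻¹ with hq
  have hqs : ContDiffOn ℝ ∞ q S :=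
    (contDiffOn_dirDeriv Metric.isOpen_ball hΦs _).inv fun z hz => by
      rw [hΦD z hz]; exact hDne _ (hSC z hz)
  -- Discs of radius `r` around real points of `K` stay in the complex ball of radius `2 r`, where
  -- the phase derivative is bounded below by `c`. Hence `Q = 1 / c` and `A = 2 / r`.
  have hqb : ∀ k ≤ L, ∀ x ∈ K,
      ‖dirDeriv (er i) k q x‖ ≤ c⁻¹ * (2 / r) ^ k * k.factorial := by
    intro k _ x hx
    have hmem : ∀ ζ ∈ Metric.ball (0 : ℂ) r, toC x + ζ • ec i ∈ Metric.ball (toC x₀) (2 * r) :=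
      fun ζ hζ => toC_add_smul_mem_ball hx i hζ
    refine norm_dirDeriv_le_of_holomorphic (F := fun ζ => (D (toC x + ζ • ec i))⁻¹) hr ?_ ?_ ?_ k
    · refine DifferentiableOn.inv ?_ fun ζ hζ => hDne _ (hmem ζ hζ)
      have h1 := differentiableOn_lineDeriv (p := (toC x, toC η)) (v := (ec i, 0)) hφ.holomorphic
        (U := Metric.ball 0 r) Metric.isOpen_ball fun ζ hζ => by
          refine ⟨?_, ?_⟩
          · simpa using hC (Metric.ball_subset_closedBall (hmem ζ hζ))
          · simpa using hηΘ
      simpa [hD] using h1.sub_const (ξ i : ℂ)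
    · intro ζ hζ
      rw [norm_inv]
      exact inv_anti₀ hc (hbd _ (hmem ζ hζ))
    · filter_upwards [eventually_add_smul_mem Metric.isOpen_ball (hKS hx) (er i)] with τ hτ
      rw [hq]
      simp only
      rw [hΦD _ hτ, toC_add_smul]
  have hab : ∀ k ≤ L, ∀ x ∈ K, ‖dirDeriv (er i) k (fun z => a z η) x‖ ≤
      Ba * (1 + ‖η‖) ^ p * (2 / r) ^ k * k.factorial := by
    intro k _ x hx
    have hmem : ∀ ζ ∈ Metric.ball (0 : ℂ) r,
        toC x + ζ • ec i ∈ Metric.closedBall (toC x₀) (2 * r) :=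
      fun ζ hζ => Metric.ball_subset_closedBall (toC_add_smul_mem_ball hx i hζ)
    refine norm_dirDeriv_le_of_holomorphic (F := fun ζ => aC (toC x + ζ • ec i) η) hr ?_ ?_ ?_ k
    · exact differentiableOn_line (ha.isExtension.holomorphic η hη) fun ζ hζ => hC' (hmem ζ hζ)
    · exact fun ζ hζ => hBa _ (hmem ζ hζ) η hη
    · filter_upwards [eventually_add_smul_mem Ω.isOpen (hSΩ (hKS hx)) (er i)] with τ hτ
      rw [← ha.isExtension.extends_real _ hτ η hη, toC_add_smul]
  have has : ContDiffOn ℝ ∞ (fun z => a z η) S := (ha.smooth_left hη).mono hSΩ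
  have hB2 : 2 * (2 / r) * L ≤ B := le_of_eq_of_le (by ring) hB
  have hafs := contDiff_mul_of_tsupport_subset Metric.isOpen_ball has hf.contDiff (hfK.trans hKS)
  have hA : (0 : ℝ) ≤ 2 / r := by positivity
  have main := norm_integral_cexp_mul_le volume (S := S) (K := K) Metric.isOpen_ball
    (isCompact_closedBall _ _) hKS (Φ := Φ) (q := q) (e := er i) hΦs hqs
    (fun x _ => by simp [hΦ]) (fun x hx => by
      rw [hq]; exact inv_mul_cancel₀ (by rw [hΦD x hx]; exact hDne _ (hSC x hx)))
    hA L hB2 hqb (f := fun z => a z η * f z) hafs ((tsupport_mul_subset' _ _).trans hfK)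
    (M := 2 * (Ba * (1 + ‖η‖) ^ p) * M) (fun k hk x hx =>
      norm_dirDeriv_mul_le_of_analytic (has.contDiffAt (Metric.isOpen_ball.mem_nhds (hKS hx)))
        hf.contDiff.contDiffAt hA (le_trans (by gcongr) hB2) (fun j hj => hab j (hj.trans hk) x hx)
        (fun j hj => hf.bound i j (hj.trans hk) x))
  have heq : ∫ z in (Ω : Set (EuclideanSpace ℝ (Fin N))),
      Complex.exp (Complex.I * (φ z η : ℂ)) * a z η * (wave ξ z * f z) =
      ∫ z, Complex.exp (Complex.I * Φ z) * (a z η * f z) := by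
    rw [setIntegral_eq_integral_of_forall_compl_eq_zero]
    · congr 1
      ext z
      have : Complex.exp (Complex.I * Φ z) =
          Complex.exp (Complex.I * (φ z η : ℂ)) * wave ξ z := by
        rw [wave, ← Complex.exp_add, hΦ]
        congr 1
        ring
      rw [this]
      ring
    · intro z hz
      rw [image_eq_zero_of_notMem_tsupport fun h => hz (hΩ (Metric.closedBall_subset_closedBall
        (by linarith) (hfK h)))]
      simp
  rw [heq]
  refine main.trans ?_
  have hM : 0 ≤ M := by
    have := (norm_nonneg _).trans (hf.bound i 0 (Nat.zero_le _) x₀)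
    simpa using this
  have hB0 : 0 ≤ B := le_trans (by positivity) hB
  have : 2 * c⁻¹ * B = 2 * B / c := by ring
  rw [this]
  have h1 : 0 ≤ (1 + ‖η‖) ^ p * M * (2 * B / c) ^ L := by positivity
  nlinarith

/-- The condition at the origin replaces the nullity of `{0}`, which fails for `n = 0`. -/
lemma integral_compl_zero_comp_inv_smul {G : EuclideanSpace ℝ (Fin n) → ℂ} (h0 : G 0 = 0) {μ : ℝ}
    (hμ : 0 < μ) : ∫ η in ({0}ᶜ : Set (EuclideanSpace ℝ (Fin n))), G (μ⁻¹ • η) =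
      (μ : ℂ) ^ n * ∫ θ, G θ := by
  rw [setIntegral_eq_integral_of_forall_compl_eq_zero fun η hη => by
    rw [show η = 0 by simpa using hη, smul_zero, h0], Measure.integral_comp_inv_smul]
  simp [abs_of_pos hμ]

/-- This keeps rescaled frequencies in a shell away from the origin, where `|μθ|` is comparable to
`μ`. -/
lemma ne_zero_of_mem_closedBall {E : Type*} [NormedAddCommGroup E] {θ₀ θ : E} {r : ℝ}
    (hr : 4 * r ≤ ‖θ₀‖) (hr0 : 0 < r) (hθ : θ ∈ Metric.closedBall θ₀ (2 * r)) :
    ‖θ₀‖ / 2 ≤ ‖θ‖ ∧ ‖θ‖ ≤ 2 * ‖θ₀‖ ∧ θ ≠ 0 := by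
  rw [mem_closedBall_iff_norm] at hθ
  have h1 : ‖θ₀‖ ≤ ‖θ‖ + ‖θ - θ₀‖ := by
    have := norm_sub_norm_le θ₀ θ
    rw [norm_sub_rev] at this
    linarith
  have h2 : ‖θ‖ ≤ ‖θ₀‖ + ‖θ - θ₀‖ := by
    have := norm_sub_norm_le θ θ₀
    linarith
  refine ⟨by linarith, by linarith, ?_⟩
  rw [← norm_pos_iff]
  linarith

/-- Integration by parts in the frequency variables, at a point where a frequency derivative of the
phase does not vanish. -/
theorem exists_norm_integral_right_le (hφ : IsPhaseExtension Ω φ ΩC ΘC φC)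
    (ha : IsAmplitudeExtension Ω m a ΩC' aC) {p : ℕ} (hp : |m| ≤ p)
    {x₀ : EuclideanSpace ℝ (Fin N)} (hx₀ : x₀ ∈ Ω) {θ₀ : EuclideanSpace ℝ (Fin n)} (hθ₀ : θ₀ ≠ 0)
    {i : Fin n} (hne : lineDeriv ℂ φC (toC x₀, toC θ₀) (0, ec i) ≠ 0) :
    ∃ r : ℝ, 0 < r ∧ 4 * r ≤ ‖θ₀‖ ∧ Metric.closedBall x₀ r ⊆ Ω ∧
      ∃ C : ℝ, 0 < C ∧ ∀ z ∈ Metric.closedBall x₀ r,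
      ∀ (L : ℕ) (B μ M : ℝ) (g : EuclideanSpace ℝ (Fin n) → ℂ), C * (L + 1) ≤ B →
        C * (L + 1) ≤ μ → HasBoundsUpTo L B M g → tsupport g ⊆ Metric.closedBall θ₀ r →
        ‖∫ η in ({0}ᶜ : Set (EuclideanSpace ℝ (Fin n))),
          g (μ⁻¹ • η) * (Complex.exp (Complex.I * (φ z η : ℂ)) * a z η)‖ ≤
          C * M * μ ^ (p + n) * (C * B / μ) ^ L := by
  set c : ℝ := ‖lineDeriv ℂ φC (toC x₀, toC θ₀) (0, ec i)‖ / 2 with hc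
  have hc0 : 0 < c := by have := norm_pos_iff.mpr hne; positivity
  set t : ℝ := ‖θ₀‖ / 2 with ht
  have ht0 : 0 < t := by have := norm_pos_iff.mpr hθ₀; positivity
  obtain ⟨r, hr0, hrθ, hrΩ, hrC, hrC', hrΘ, hrc⟩ : ∃ r : ℝ, 0 < r ∧ 4 * r ≤ ‖θ₀‖ ∧
      Metric.closedBall x₀ r ⊆ Ω ∧ Metric.closedBall (toC x₀) r ⊆ ΩC ∧
      Metric.closedBall (toC x₀) r ⊆ ΩC' ∧ Metric.closedBall (toC θ₀) (2 * r) ⊆ ΘC ∧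
      ∀ z ∈ Metric.closedBall (toC x₀) r, ∀ θ ∈ Metric.closedBall (toC θ₀) (2 * r),
        c ≤ ‖lineDeriv ℂ φC (z, θ) (0, ec i)‖ := by
    have hmem : (toC x₀, toC θ₀) ∈ ΩC ×ˢ ΘC := ⟨hφ.mem_left x₀ hx₀, hφ.mem_right θ₀ hθ₀⟩
    have hcont : ContinuousAt (fun p => ‖lineDeriv ℂ φC p (0, ec i)‖) (toC x₀, toC θ₀) :=
      ((continuousOn_lineDeriv hφ.isOpen_prod hφ.holomorphic (0, ec i)).continuousAt
        (hφ.isOpen_prod.mem_nhds hmem)).norm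
    have hev : ∀ᶠ p in 𝓝 (toC x₀, toC θ₀), c < ‖lineDeriv ℂ φC p (0, ec i)‖ :=
      hcont.eventually (lt_mem_nhds (by rw [hc]; linarith [norm_pos_iff.mpr hne]))
    obtain ⟨r₁, hr₁, h1⟩ := Metric.nhds_basis_closedBall.mem_iff.mp
      (hev.and (hφ.isOpen_prod.mem_nhds hmem))
    obtain ⟨r₂, hr₂, h2⟩ := Metric.nhds_basis_closedBall.mem_iff.mp (Ω.isOpen.mem_nhds hx₀)
    obtain ⟨r₃, hr₃, h3⟩ := Metric.nhds_basis_closedBall.mem_iff.mp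
      (ha.isExtension.isOpen.mem_nhds (ha.isExtension.mem x₀ hx₀))
    have hr : ∃ r : ℝ, 0 < r ∧ 2 * r ≤ r₁ ∧ r ≤ r₂ ∧ r ≤ r₃ ∧ 4 * r ≤ ‖θ₀‖ := by
      refine ⟨min (min (r₁ / 2) r₂) (min r₃ (t / 2)), by positivity, ?_, ?_, ?_, ?_⟩
      · linarith [min_le_left (min (r₁ / 2) r₂) (min r₃ (t / 2)), min_le_left (r₁ / 2) r₂]
      · linarith [min_le_left (min (r₁ / 2) r₂) (min r₃ (t / 2)), min_le_right (r₁ / 2) r₂]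
      · linarith [min_le_right (min (r₁ / 2) r₂) (min r₃ (t / 2)), min_le_left r₃ (t / 2)]
      · linarith [min_le_right (min (r₁ / 2) r₂) (min r₃ (t / 2)), min_le_right r₃ (t / 2)]
    obtain ⟨r, hr0, hrr₁, hrr₂, hrr₃, hrt⟩ := hr
    have hz : Metric.closedBall (toC x₀) r ×ˢ Metric.closedBall (toC θ₀) (2 * r) ⊆
        Metric.closedBall (toC x₀, toC θ₀) r₁ := by
      rw [← closedBall_prod_same]
      exact prod_mono (Metric.closedBall_subset_closedBall (by linarith))
        (Metric.closedBall_subset_closedBall hrr₁)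
    refine ⟨r, hr0, hrt, (Metric.closedBall_subset_closedBall hrr₂).trans h2, fun z hz' => ?_,
      (Metric.closedBall_subset_closedBall hrr₃).trans h3, fun θ hθ => ?_, fun z hz' θ hθ => ?_⟩
    · exact (h1 (hz (⟨hz', Metric.mem_closedBall_self (by positivity)⟩ :
        (z, toC θ₀) ∈ _ ×ˢ _))).2.1
    · exact (h1 (hz (⟨Metric.mem_closedBall_self hr0.le, hθ⟩ : (toC x₀, θ) ∈ _ ×ˢ _))).2.2
    · exact (h1 (hz (⟨hz', hθ⟩ : (z, θ) ∈ _ ×ˢ _))).1.le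
  obtain ⟨Ma, Ca, R, hMa, hCa, hR, hbd⟩ := ha.bound_dirDeriv _ hrC' (isCompact_closedBall _ _)
  set K := Metric.closedBall θ₀ r with hK
  set V : ℝ := (volume : Measure (EuclideanSpace ℝ (Fin n))).real K with hV
  have hV0 : 0 ≤ V := measureReal_nonneg
  -- One rate serves two functions: `2 / r` is the Cauchy rate for the reciprocal phase derivative,
  -- `Ca / t` the pseudoanalytic rate for `θ ↦ a(z, μθ)`.
  set A : ℝ := 2 / r + Ca / t with hA
  have hA0 : 0 < A := by positivity
  -- In order: `2 A L ≤ B`; the range `|η| ≥ R max(1,k)` for all `k ≤ L`; `μ t ≥ 1`, so that `|η|^m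
  -- ≤ |η|^p`; the gain `2 / (c μ)` per step; the overall factor.
  set C : ℝ := 2 * A + R / t + 1 / t + 2 / c + 2 * Ma * (4 * t) ^ p * V + 1 with hCdef
  have hC1 : 2 * A ≤ C := by
    have : 0 ≤ R / t + 1 / t + 2 / c + 2 * Ma * (4 * t) ^ p * V + 1 := by positivity
    linarith
  have hC2 : R / t ≤ C := by
    have : 0 ≤ 2 * A + 1 / t + 2 / c + 2 * Ma * (4 * t) ^ p * V + 1 := by positivity
    linarith
  have hC3 : 1 / t ≤ C := by
    have : 0 ≤ 2 * A + R / t + 2 / c + 2 * Ma * (4 * t) ^ p * V + 1 := by positivity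
    linarith
  have hC4 : 2 / c ≤ C := by
    have : 0 ≤ 2 * A + R / t + 1 / t + 2 * Ma * (4 * t) ^ p * V + 1 := by positivity
    linarith
  have hC5 : 2 * Ma * (4 * t) ^ p * V ≤ C := by
    have : 0 ≤ 2 * A + R / t + 1 / t + 2 / c + 1 := by positivity
    linarith
  have hC0 : 0 < C := by positivity
  refine ⟨r, hr0, hrθ, hrΩ, C, hC0, fun z hz L B μ M g hB hμ hg hgK => ?_⟩
  have hzΩ := hrΩ hz
  have hzC : toC z ∈ Metric.closedBall (toC x₀) r := by
    rw [Metric.mem_closedBall, dist_toC]; exact hz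
  have hμ0 : 0 < μ := lt_of_lt_of_le (by positivity) hμ
  have hM : 0 ≤ M := by
    have := (norm_nonneg _).trans (hg.bound i 0 (Nat.zero_le _) 0)
    simpa using this
  have hL1 : (1 : ℝ) ≤ L + 1 := by
    have : (0 : ℝ) ≤ L := Nat.cast_nonneg L
    linarith
  have hB0 : 0 ≤ B := le_trans (by positivity) hB
  set S := Metric.ball θ₀ (2 * r) with hS
  have hKS : K ⊆ S := Metric.closedBall_subset_ball (by linarith)
  have hSb : ∀ θ ∈ S, t ≤ ‖θ‖ ∧ ‖θ‖ ≤ 2 * ‖θ₀‖ ∧ θ ≠ 0 := fun θ hθ =>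
    ne_zero_of_mem_closedBall hrθ hr0 (Metric.ball_subset_closedBall hθ)
  have hSC : ∀ θ ∈ S, toC θ ∈ Metric.ball (toC θ₀) (2 * r) := fun θ hθ => by
    rw [Metric.mem_ball, dist_toC]; exact hθ
  have hmaps : MapsTo (fun θ : EuclideanSpace ℝ (Fin n) => μ • θ) S {0}ᶜ := fun θ hθ =>
    smul_ne_zero hμ0.ne' (hSb θ hθ).2.2
  -- In the variable `θ = η / μ` the phase derivative is `μ` times a function homogeneous of degree
  -- zero, hence at least `c μ` in modulus.
  set Φ : EuclideanSpace ℝ (Fin n) → ℂ := fun θ => (φ z (μ • θ) : ℂ) with hΦ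
  have hφs : ContDiffOn ℝ ∞ (fun η => (φ z η : ℂ)) {0}ᶜ :=
    Complex.ofRealCLM.contDiff.comp_contDiffOn (hφ.smooth_right hzΩ)
  have hΦs : ContDiffOn ℝ ∞ Φ S := hφs.comp (contDiff_const_smul μ).contDiffOn hmaps
  set D : EuclideanSpace ℂ (Fin n) → ℂ :=
    fun θ => (μ : ℂ) * lineDeriv ℂ φC (toC z, θ) (0, ec i) with hD
  have hΦD : ∀ θ ∈ S, dirDeriv (er i) 1 Φ θ = D (toC θ) := by
    intro θ hθ
    have hθ0 := (hSb θ hθ).2.2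
    rw [hΦ, dirDeriv_comp_smul (er i) 1 (fun η => (φ z η : ℂ)), pow_one, hD, dirDeriv_one,
      (hφ.hasDerivAt_right hzΩ (smul_ne_zero hμ0.ne' hθ0) i).lineDeriv, toC_smul,
      hφ.lineDeriv_right_smul (hφ.mem_left z hzΩ) (hφ.mem_right θ hθ0) hμ0]
  have hDbd : ∀ θ ∈ Metric.ball (toC θ₀) (2 * r), c * μ ≤ ‖D θ‖ := fun θ hθ => by
    rw [hD]
    simp only
    rw [norm_mul, Complex.norm_real, Real.norm_of_nonneg hμ0.le, mul_comm]
    exact mul_le_mul_of_nonneg_left (hrc _ hzC θ (Metric.ball_subset_closedBall hθ)) hμ0.le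
  have hDne : ∀ θ ∈ Metric.ball (toC θ₀) (2 * r), D θ ≠ 0 := fun θ hθ => by
    rw [← norm_pos_iff]
    exact lt_of_lt_of_le (by positivity) (hDbd θ hθ)
  set q : EuclideanSpace ℝ (Fin n) → ℂ := fun θ => (dirDeriv (er i) 1 Φ θ)⁻¹ with hq
  have hqs : ContDiffOn ℝ ∞ q S :=
    (contDiffOn_dirDeriv Metric.isOpen_ball hΦs _).inv fun θ hθ => by
      rw [hΦD θ hθ]; exact hDne _ (hSC θ hθ)
  have hqb : ∀ k ≤ L, ∀ x ∈ K,
      ‖dirDeriv (er i) k q x‖ ≤ (c * μ)⁻¹ * A ^ k * k.factorial := by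
    intro k _ x hx
    have hmem : ∀ ζ ∈ Metric.ball (0 : ℂ) r, toC x + ζ • ec i ∈ Metric.ball (toC θ₀) (2 * r) :=
      fun ζ hζ => toC_add_smul_mem_ball hx i hζ
    refine (norm_dirDeriv_le_of_holomorphic (M := (c * μ)⁻¹)
      (F := fun ζ => (D (toC x + ζ • ec i))⁻¹) hr0 ?_ ?_ ?_ k).trans ?_
    · refine DifferentiableOn.inv ?_ fun ζ hζ => hDne _ (hmem ζ hζ)
      have h1 := differentiableOn_lineDeriv (p := (toC z, toC x)) (v := (0, ec i)) hφ.holomorphic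
        (U := Metric.ball 0 r) Metric.isOpen_ball fun ζ hζ => by
          refine ⟨?_, ?_⟩
          · simpa using hrC hzC
          · simpa using hrΘ (Metric.ball_subset_closedBall (hmem ζ hζ))
      simpa [hD] using h1.const_mul (μ : ℂ)
    · intro ζ hζ
      rw [norm_inv]
      exact inv_anti₀ (by positivity) (hDbd _ (hmem ζ hζ))
    · filter_upwards [eventually_add_smul_mem Metric.isOpen_ball (hKS hx) (er i)] with τ hτ
      rw [hq]
      simp only
      rw [hΦD _ hτ, toC_add_smul]
    · have : 2 / r ≤ A := by
        have : 0 ≤ Ca / t := by positivity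
        linarith
      gcongr
  set b : EuclideanSpace ℝ (Fin n) → ℂ := fun θ => a z (μ • θ) with hb
  have hbs : ContDiffOn ℝ ∞ b S :=
    (ha.smooth_right hzΩ).comp (contDiff_const_smul μ).contDiffOn hmaps
  have hμt : 1 ≤ μ * t := by
    have h1 : 1 / t ≤ μ := hC3.trans (le_trans (by nlinarith) hμ)
    rwa [div_le_iff₀ ht0] at h1
  -- The chain rule factor `μ ^ k` cancels against `|μθ|^(-k)` in the pseudoanalytic estimate. What
  -- remains is an analytic bound in `θ`, uniform in `μ`.
  have hbb : ∀ k ≤ L, ∀ x ∈ K, ‖dirDeriv (er i) k b x‖ ≤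
      Ma * (μ * (4 * t)) ^ p * A ^ k * k.factorial := by
    intro k hk x hx
    obtain ⟨h1, h2, h3⟩ := hSb x (hKS hx)
    have hμx : μ • x ≠ 0 := smul_ne_zero hμ0.ne' h3
    have hnorm : ‖μ • x‖ = μ * ‖x‖ := by rw [norm_smul, Real.norm_of_nonneg hμ0.le]
    have hx0 : 0 < ‖x‖ := norm_pos_iff.mpr h3
    have hkL : max 1 (k : ℝ) ≤ L + 1 := max_le hL1 (by
      have : (k : ℝ) ≤ L := by exact_mod_cast hk
      linarith)
    have hRle : R * max 1 (k : ℝ) ≤ ‖μ • x‖ := by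
      rw [hnorm]
      calc R * max 1 (k : ℝ) ≤ R * (L + 1) := by gcongr
        _ = R / t * (L + 1) * t := by field_simp
        _ ≤ C * (L + 1) * t := by gcongr
        _ ≤ μ * ‖x‖ := by gcongr
    have hcongr : dirDeriv (er i) k (a z) (μ • x) = dirDeriv (er i) k (aC (toC z)) (μ • x) := by
      refine dirDeriv_congr ?_
      filter_upwards [isOpen_compl_singleton.mem_nhds hμx] with η hη
      exact (ha.isExtension.extends_real z hzΩ η hη).symm
    have hrp : ‖μ • x‖ ^ (m - (k : ℝ)) ≤ (μ * (4 * t)) ^ p / (μ * t) ^ k := by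
      have hpos : 0 < ‖μ • x‖ := norm_pos_iff.mpr hμx
      rw [Real.rpow_sub hpos, Real.rpow_natCast]
      have h1x : 1 ≤ ‖μ • x‖ := by rw [hnorm]; exact hμt.trans (by gcongr)
      have h4 : ‖μ • x‖ ^ m ≤ (μ * (4 * t)) ^ p := by
        calc ‖μ • x‖ ^ m ≤ ‖μ • x‖ ^ (p : ℝ) :=
              Real.rpow_le_rpow_of_exponent_le h1x ((le_abs_self m).trans hp)
          _ = ‖μ • x‖ ^ p := Real.rpow_natCast _ _
          _ ≤ _ := by
            rw [hnorm]
            have : ‖x‖ ≤ 4 * t := by rw [ht]; linarith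
            gcongr
      have h5 : (μ * t) ^ k ≤ ‖μ • x‖ ^ k := by rw [hnorm]; gcongr
      gcongr
    rw [hb, dirDeriv_comp_smul (er i) k (a z), hcongr, norm_mul, norm_pow, Complex.norm_real,
      Real.norm_of_nonneg hμ0.le]
    calc μ ^ k * ‖dirDeriv (er i) k (aC (toC z)) (μ • x)‖
        ≤ μ ^ k * (Ma * Ca ^ k * k.factorial * ((μ * (4 * t)) ^ p / (μ * t) ^ k)) := by
          gcongr
          exact (hbd i k _ hzC _ hμx hRle).trans (by gcongr)
      _ = Ma * (μ * (4 * t)) ^ p * (Ca / t) ^ k * k.factorial := by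
          have haux : ∀ s X : ℝ, 0 < s → μ ^ k * (Ma * Ca ^ k * k.factorial * (X / (μ * s) ^ k)) =
              Ma * X * (Ca / s) ^ k * k.factorial := fun s X hs => by
            rw [mul_pow μ s, div_pow]
            field_simp
          exact haux t _ ht0
      _ ≤ _ := by
          have : Ca / t ≤ A := by
            have : 0 ≤ 2 / r := by positivity
            linarith
          gcongr
  have hB2 : 2 * A * L ≤ B := by
    refine le_trans ?_ hB
    have : (L : ℝ) ≤ L + 1 := by linarith
    gcongr
  have hbgs := contDiff_mul_of_tsupport_subset Metric.isOpen_ball hbs hg.contDiff (hgK.trans hKS)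
  have main := norm_integral_cexp_mul_le volume (S := S) (K := K) Metric.isOpen_ball
    (isCompact_closedBall _ _) hKS (Φ := Φ) (q := q) (e := er i) hΦs hqs
    (fun x _ => by simp [hΦ]) (fun x hx => by
      rw [hq]; exact inv_mul_cancel₀ (by rw [hΦD x hx]; exact hDne _ (hSC x hx)))
    hA0.le L hB2 hqb (f := fun θ => b θ * g θ) hbgs ((tsupport_mul_subset' _ _).trans hgK)
    (M := 2 * (Ma * (μ * (4 * t)) ^ p) * M) (fun k hk x hx =>
      norm_dirDeriv_mul_le_of_analytic (hbs.contDiffAt (Metric.isOpen_ball.mem_nhds (hKS hx)))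
        hg.contDiff.contDiffAt hA0.le (le_trans (by gcongr) hB2) (fun j hj => hbb j (hj.trans hk) x hx)
        (fun j hj => hg.bound i j (hj.trans hk) x))
  have hg0 : g 0 = 0 := image_eq_zero_of_notMem_tsupport fun h =>
    (hSb 0 (hKS (hgK h))).2.2 rfl
  have heq : ∫ η in ({0}ᶜ : Set (EuclideanSpace ℝ (Fin n))),
      g (μ⁻¹ • η) * (Complex.exp (Complex.I * (φ z η : ℂ)) * a z η) =
      (μ : ℂ) ^ n * ∫ θ, Complex.exp (Complex.I * Φ θ) * (b θ * g θ) := by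
    rw [← integral_compl_zero_comp_inv_smul (by simp [hg0]) hμ0]
    congr 1
    ext η
    rw [hΦ, hb]
    simp only
    rw [smul_inv_smul₀ hμ0.ne']
    ring
  rw [heq, norm_mul, norm_pow, Complex.norm_real, Real.norm_of_nonneg hμ0.le]
  calc μ ^ n * ‖∫ θ, Complex.exp (Complex.I * Φ θ) * (b θ * g θ)‖
      ≤ μ ^ n * (V * (2 * (Ma * (μ * (4 * t)) ^ p) * M * (2 * (c * μ)⁻¹ * B) ^ L)) := by gcongr
    _ = (2 * Ma * (4 * t) ^ p * V) * M * μ ^ (p + n) * (2 / c * B / μ) ^ L := by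
        rw [mul_pow μ (4 * t), pow_add, show 2 * (c * μ)⁻¹ * B = 2 / c * B / μ by field_simp]
        ring
    _ ≤ C * M * μ ^ (p + n) * (C * B / μ) ^ L := by gcongr

end LocalEstimates

/-! ### Local control: the three cases at a point `(x₀, θ₀, ρ₀)` -/

section Controlled

variable {N n : ℕ} {Ω : Opens (EuclideanSpace ℝ (Fin N))} {m : ℝ}
  {φ : EuclideanSpace ℝ (Fin N) → EuclideanSpace ℝ (Fin n) → ℝ}
  {a : EuclideanSpace ℝ (Fin N) → EuclideanSpace ℝ (Fin n) → ℂ}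
  {ΩC ΩC' : Set (EuclideanSpace ℂ (Fin N))} {ΘC : Set (EuclideanSpace ℂ (Fin n))}
  {φC : EuclideanSpace ℂ (Fin N) × EuclideanSpace ℂ (Fin n) → ℂ}
  {aC : EuclideanSpace ℂ (Fin N) → EuclideanSpace ℝ (Fin n) → ℂ}

lemma integral_compl_zero_scaled {g F : EuclideanSpace ℝ (Fin n) → ℂ}
    {K : Set (EuclideanSpace ℝ (Fin n))} (hgK : tsupport g ⊆ K) (hK : 0 ∉ K) {μ : ℝ} (hμ : 0 < μ) :
    ∫ η in ({0}ᶜ : Set (EuclideanSpace ℝ (Fin n))), g (μ⁻¹ • η) * F η =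
      (μ : ℂ) ^ n * ∫ θ in K, g θ * F (μ • θ) := by
  have h : ∀ θ, θ ∉ K → g θ * F (μ • θ) = 0 := fun θ hθ => by
    rw [image_eq_zero_of_notMem_tsupport fun h => hθ (hgK h), zero_mul]
  rw [setIntegral_eq_integral_of_forall_compl_eq_zero h,
    ← integral_compl_zero_comp_inv_smul (h 0 hK) hμ]
  simp_rw [smul_inv_smul₀ hμ.ne']

/-- Combine `x^L / L! ≤ e^x` with `L! ≤ L^L`. Exponential decay thereby takes the same form as the
gain from `L` integrations by parts. -/
lemma exp_neg_le_pow {x : ℝ} (hx : 0 < x) (L : ℕ) : Real.exp (-x) ≤ (L / x) ^ L := by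
  have h1 := Real.pow_div_factorial_le_exp x hx.le L
  have h2 : (L.factorial : ℝ) ≤ (L : ℝ) ^ L := by exact_mod_cast Nat.factorial_le_pow L
  rw [Real.exp_neg, div_pow, inv_le_comm₀ (Real.exp_pos x)]
  · rw [inv_div]
    refine le_trans ?_ h1
    gcongr
  · rcases Nat.eq_zero_or_pos L with rfl | hL
    · simp
    · positivity

/-- The frequency integral at a point where the amplitude is exponentially decaying. -/
theorem exists_norm_integral_right_le_of_decay {x₀ : EuclideanSpace ℝ (Fin N)} (hx₀ : x₀ ∈ Ω)
    {θ₀ : EuclideanSpace ℝ (Fin n)} (hθ₀ : θ₀ ≠ 0) (hdec : IsExpDecayingAt Ω m a x₀ θ₀) (p : ℕ) :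
    ∃ r : ℝ, 0 < r ∧ 4 * r ≤ ‖θ₀‖ ∧ Metric.closedBall x₀ r ⊆ Ω ∧
      ∃ C : ℝ, 0 < C ∧ ∀ z ∈ Metric.closedBall x₀ r,
      ∀ (L : ℕ) (B μ M : ℝ) (g : EuclideanSpace ℝ (Fin n) → ℂ), C * (L + 1) ≤ B →
        C * (L + 1) ≤ μ → HasBoundsUpTo L B M g → tsupport g ⊆ Metric.closedBall θ₀ r →
        ‖∫ η in ({0}ᶜ : Set (EuclideanSpace ℝ (Fin n))),
          g (μ⁻¹ • η) * (Complex.exp (Complex.I * (φ z η : ℂ)) * a z η)‖ ≤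
          C * M * μ ^ (p + n) * (C * B / μ) ^ L := by
  obtain ⟨ΩC, aC, hext, hα⟩ := hdec
  -- Decay of the amplitude itself suffices; the multi-index `0` is always admissible because the
  -- bound on `|α|` is a maximum with `0`.
  obtain ⟨C₀, c, hC₀, hc, V, hV, hbd⟩ := hα 0 (by simp [multiLength])
  simp only [multiDeriv_zero] at hbd
  have hθn : 0 < ‖θ₀‖ := norm_pos_iff.mpr hθ₀
  obtain ⟨r, hr0, hrθ, hrΩ, hrV⟩ : ∃ r : ℝ, 0 < r ∧ 4 * r ≤ ‖θ₀‖ ∧ Metric.closedBall x₀ r ⊆ Ω ∧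
      ∀ z ∈ Metric.closedBall x₀ r, ∀ θ ∈ Metric.closedBall θ₀ r, (toC z, ‖θ‖⁻¹ • θ) ∈ V := by
    have hcont : ContinuousAt (fun q : EuclideanSpace ℝ (Fin N) × EuclideanSpace ℝ (Fin n) =>
        (toC q.1, ‖q.2‖⁻¹ • q.2)) (x₀, θ₀) := by
      refine (continuous_toC.comp continuous_fst).continuousAt.prodMk ?_
      exact (continuous_snd.norm.continuousAt.inv₀ hθn.ne').smul continuous_snd.continuousAt
    obtain ⟨r₁, hr₁, h1⟩ := Metric.nhds_basis_closedBall.mem_iff.mp (hcont hV)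
    obtain ⟨r₂, hr₂, h2⟩ := Metric.nhds_basis_closedBall.mem_iff.mp (Ω.isOpen.mem_nhds hx₀)
    refine ⟨min (min r₁ r₂) (‖θ₀‖ / 4), by positivity, ?_, ?_, fun z hz θ hθ => ?_⟩
    · linarith [min_le_right (min r₁ r₂) (‖θ₀‖ / 4)]
    · exact (Metric.closedBall_subset_closedBall
        ((min_le_left _ _).trans (min_le_right _ _))).trans h2
    · have hle : min (min r₁ r₂) (‖θ₀‖ / 4) ≤ r₁ := (min_le_left _ _).trans (min_le_left _ _)
      refine h1 (?_ : (z, θ) ∈ _)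
      rw [← closedBall_prod_same]
      exact ⟨Metric.closedBall_subset_closedBall hle hz,
        Metric.closedBall_subset_closedBall hle hθ⟩
  set K := Metric.closedBall θ₀ r with hK
  set t : ℝ := ‖θ₀‖ / 2 with ht
  have ht0 : 0 < t := by positivity
  set V' : ℝ := (volume : Measure (EuclideanSpace ℝ (Fin n))).real K with hV'
  have hV0 : 0 ≤ V' := measureReal_nonneg
  set C : ℝ := 1 + 1 / (c * t) + C₀ * V' with hC
  have hC1 : 1 ≤ C := by
    have : 0 ≤ 1 / (c * t) + C₀ * V' := by positivity
    linarith
  have hC2 : 1 / (c * t) ≤ C := by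
    have : 0 ≤ 1 + C₀ * V' := by positivity
    linarith
  have hC3 : C₀ * V' ≤ C := by
    have : 0 ≤ 1 + 1 / (c * t) := by positivity
    linarith
  have hC0 : 0 < C := by positivity
  refine ⟨r, hr0, hrθ, hrΩ, C, hC0, fun z hz L B μ M g hB hμ hg hgK => ?_⟩
  have hL : (0 : ℝ) ≤ L := Nat.cast_nonneg L
  have hμ1 : 1 ≤ μ := le_trans (by nlinarith) hμ
  have hμ0 : 0 < μ := by linarith
  have hLB : (L : ℝ) ≤ B := le_trans (by nlinarith) hB
  have hB0 : 0 ≤ B := hL.trans hLB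
  have hM := hg.nonneg
  have hKb : ∀ θ ∈ K, t ≤ ‖θ‖ ∧ ‖θ‖ ≤ 2 * ‖θ₀‖ ∧ θ ≠ 0 := fun θ hθ =>
    ne_zero_of_mem_closedBall hrθ hr0 (Metric.closedBall_subset_closedBall (by linarith) hθ)
  have heq := integral_compl_zero_scaled (g := g)
    (F := fun η => Complex.exp (Complex.I * (φ z η : ℂ)) * a z η) hgK
    (fun h => (hKb 0 h).2.2 rfl) hμ0
  have hpt : ∀ θ ∈ K, ‖g θ * (Complex.exp (Complex.I * (φ z (μ • θ) : ℂ)) * a z (μ • θ))‖ ≤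
      M * (C₀ * (C * B / μ) ^ L) := by
    intro θ hθ
    obtain ⟨h1, -, h3⟩ := hKb θ hθ
    have hμθ : μ • θ ≠ 0 := smul_ne_zero hμ0.ne' h3
    rw [norm_mul, norm_mul, norm_exp_I_mul_ofReal, one_mul]
    have hzΩ := hrΩ hz
    have hn : ‖μ • θ‖ = μ * ‖θ‖ := by rw [norm_smul, Real.norm_of_nonneg hμ0.le]
    have hdir : ‖μ • θ‖⁻¹ • μ • θ = ‖θ‖⁻¹ • θ := by
      rw [hn, smul_smul, mul_inv, mul_assoc, mul_comm, mul_assoc, mul_inv_cancel₀ hμ0.ne', mul_one]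
    have h4 := hbd (toC z) (hext.mem z hzΩ) (μ • θ) hμθ (by rw [hdir]; exact hrV z hz θ hθ)
    rw [hext.extends_real z hzΩ _ hμθ, hn] at h4
    refine mul_le_mul (hg.norm_le θ) (h4.trans ?_) (norm_nonneg _) hM
    refine mul_le_mul_of_nonneg_left ?_ hC₀.le
    have hx : 0 < c * t * μ := by positivity
    calc Real.exp (-c * (μ * ‖θ‖)) ≤ Real.exp (-(c * t * μ)) := by
          refine Real.exp_le_exp.mpr ?_
          have : c * (μ * t) ≤ c * (μ * ‖θ‖) := by gcongr
          linarith
      _ ≤ (L / (c * t * μ)) ^ L := exp_neg_le_pow hx L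
      _ = (1 / (c * t) * L / μ) ^ L := by
          congr 1
          rw [mul_comm (1 / (c * t)), mul_one_div, div_div]
      _ ≤ (C * B / μ) ^ L := by gcongr
  rw [heq, norm_mul, norm_pow, Complex.norm_real, Real.norm_of_nonneg hμ0.le]
  calc μ ^ n * ‖∫ θ in K, g θ * (Complex.exp (Complex.I * (φ z (μ • θ) : ℂ)) * a z (μ • θ))‖
      ≤ μ ^ n * (M * (C₀ * (C * B / μ) ^ L) * V') := by
        gcongr
        exact norm_setIntegral_le_of_norm_le_const (isCompact_closedBall _ _).measure_lt_top hpt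
    _ = (C₀ * V') * M * μ ^ n * (C * B / μ) ^ L := by ring
    _ ≤ C * M * μ ^ (p + n) * (C * B / μ) ^ L := by
        have : μ ^ n ≤ μ ^ (p + n) := pow_le_pow_right₀ hμ1 (by omega)
        gcongr

/-- The localized oscillatory integral, with phase `φ(z,η) - μ⟨z,ρ⟩` at frequencies `η ∼ μ θ₀`, is
controlled by repeated integration by parts. -/
def IsControlledAt (Ω : Opens (EuclideanSpace ℝ (Fin N)))
    (φ : EuclideanSpace ℝ (Fin N) → EuclideanSpace ℝ (Fin n) → ℝ)
    (a : EuclideanSpace ℝ (Fin N) → EuclideanSpace ℝ (Fin n) → ℂ) (p : ℕ)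
    (x₀ : EuclideanSpace ℝ (Fin N)) (θ₀ : EuclideanSpace ℝ (Fin n))
    (ρ₀ : EuclideanSpace ℝ (Fin N)) : Prop :=
  ∃ r : ℝ, 0 < r ∧ ∃ C : ℝ, 0 < C ∧ ∀ ρ ∈ Metric.ball ρ₀ r, ∀ (L : ℕ) (B μ M₁ M₂ : ℝ)
    (f : EuclideanSpace ℝ (Fin N) → ℂ) (g : EuclideanSpace ℝ (Fin n) → ℂ),
    C * (L + 1) ≤ B → C * (L + 1) ≤ μ → HasBoundsUpTo L B M₁ f → HasBoundsUpTo L B M₂ g →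
    tsupport f ⊆ Metric.closedBall x₀ r → tsupport g ⊆ Metric.closedBall θ₀ r →
    ‖oscInt Ω φ a (fun η => g (μ⁻¹ • η)) (fun z => wave (μ • ρ) z * f z)‖ ≤
      C * M₁ * M₂ * μ ^ (p + n) * (C * B / μ) ^ L

/-- The frequency integral is small for each fixed `z`, and the plane wave has modulus one and does
not involve `η`. So `ρ₀` is arbitrary, and the integration over `z` costs only the volume of the
ball. -/
lemma isControlledAt_of_right {p : ℕ} {x₀ ρ₀ : EuclideanSpace ℝ (Fin N)}
    {θ₀ : EuclideanSpace ℝ (Fin n)} (h : ∃ r : ℝ, 0 < r ∧ 4 * r ≤ ‖θ₀‖ ∧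
      Metric.closedBall x₀ r ⊆ Ω ∧ ∃ C : ℝ, 0 < C ∧ ∀ z ∈ Metric.closedBall x₀ r,
      ∀ (L : ℕ) (B μ M : ℝ) (g : EuclideanSpace ℝ (Fin n) → ℂ), C * (L + 1) ≤ B →
        C * (L + 1) ≤ μ → HasBoundsUpTo L B M g → tsupport g ⊆ Metric.closedBall θ₀ r →
        ‖∫ η in ({0}ᶜ : Set (EuclideanSpace ℝ (Fin n))),
          g (μ⁻¹ • η) * (Complex.exp (Complex.I * (φ z η : ℂ)) * a z η)‖ ≤
          C * M * μ ^ (p + n) * (C * B / μ) ^ L) :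
    IsControlledAt Ω φ a p x₀ θ₀ ρ₀ := by
  obtain ⟨r, hr, -, hrΩ, C, hC, hb⟩ := h
  set V : ℝ := (volume : Measure (EuclideanSpace ℝ (Fin N))).real (Metric.closedBall x₀ r) with hV
  have hV0 : 0 ≤ V := measureReal_nonneg
  refine ⟨r, hr, C * (1 + V), by positivity, fun ρ _ L B μ M₁ M₂ f g hB hμ hf hg hfr hgr => ?_⟩
  have hL : (0 : ℝ) < L + 1 := by positivity
  have hCC : C ≤ C * (1 + V) := by nlinarith
  have hB' : C * (L + 1) ≤ B := le_trans (by gcongr) hB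
  have hμ' : C * (L + 1) ≤ μ := le_trans (by gcongr) hμ
  have hμ0 : 0 < μ := lt_of_lt_of_le (by positivity) hμ'
  have hB0 : 0 ≤ B := le_trans (by positivity) hB'
  have h1 := hf.nonneg
  have h2 := hg.nonneg
  have heq : oscInt Ω φ a (fun η => g (μ⁻¹ • η)) (fun z => wave (μ • ρ) z * f z) =
      ∫ z in Metric.closedBall x₀ r, wave (μ • ρ) z * f z *
        ∫ η in ({0}ᶜ : Set (EuclideanSpace ℝ (Fin n))),
          g (μ⁻¹ • η) * (Complex.exp (Complex.I * (φ z η : ℂ)) * a z η) := by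
    have hz : ∀ z, z ∉ Metric.closedBall x₀ r → f z = 0 := fun z hz =>
      image_eq_zero_of_notMem_tsupport fun h => hz (hfr h)
    rw [oscInt, setIntegral_eq_of_subset_of_forall_sdiff_eq_zero Ω.isOpen.measurableSet hrΩ
      fun z hz' => by simp [hz z hz'.2]]
    simp_rw [← integral_const_mul]
    congr 1
    ext z
    congr 1
    ext η
    ring
  rw [heq]
  refine (norm_setIntegral_le_of_norm_le_const (isCompact_closedBall _ _).measure_lt_top
    (C := M₁ * (C * M₂ * μ ^ (p + n) * (C * B / μ) ^ L)) fun z hz => ?_).trans ?_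
  · rw [norm_mul, norm_mul, norm_wave, one_mul]
    exact mul_le_mul (hf.norm_le z) (hb z hz L B μ M₂ g hB' hμ' hg hgr) (norm_nonneg _) h1
  · rw [← hV]
    calc M₁ * (C * M₂ * μ ^ (p + n) * (C * B / μ) ^ L) * V
        = (C * V) * M₁ * M₂ * μ ^ (p + n) * (C * B / μ) ^ L := by ring
      _ ≤ C * (1 + V) * M₁ * M₂ * μ ^ (p + n) * (C * (1 + V) * B / μ) ^ L := by
        have : C * V ≤ C * (1 + V) := by nlinarith
        gcongr

/-- Continuity of `φ_z(z,θ) - ρ` in all three variables, complex in `z`. The doubled radius leaves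
room for the Cauchy discs. -/
lemma exists_radius_left (hφ : IsPhaseExtension Ω φ ΩC ΘC φC)
    (ha : IsAmplitudeExtension Ω m a ΩC' aC)
    {x₀ ρ₀ : EuclideanSpace ℝ (Fin N)} (hx₀ : x₀ ∈ Ω) {θ₀ : EuclideanSpace ℝ (Fin n)}
    (hθ₀ : θ₀ ≠ 0) {i : Fin N} (hne : lineDeriv ℂ φC (toC x₀, toC θ₀) (ec i, 0) ≠ (ρ₀ i : ℂ)) :
    ∃ r : ℝ, 0 < r ∧ 4 * r ≤ ‖θ₀‖ ∧
      Metric.closedBall x₀ (2 * r) ⊆ Ω ∧ Metric.closedBall (toC x₀) (2 * r) ⊆ ΩC ∧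
      Metric.closedBall (toC x₀) (2 * r) ⊆ ΩC' ∧
      ∀ z ∈ Metric.closedBall (toC x₀) (2 * r), ∀ θ ∈ Metric.closedBall θ₀ (2 * r),
        ∀ ρ ∈ Metric.closedBall ρ₀ (2 * r),
        ‖lineDeriv ℂ φC (toC x₀, toC θ₀) (ec i, 0) - (ρ₀ i : ℂ)‖ / 2 ≤
          ‖lineDeriv ℂ φC (z, toC θ) (ec i, 0) - (ρ i : ℂ)‖ := by
  set c : ℝ := ‖lineDeriv ℂ φC (toC x₀, toC θ₀) (ec i, 0) - (ρ₀ i : ℂ)‖ / 2 with hc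
  have hc0' := norm_pos_iff.mpr (sub_ne_zero.mpr hne)
  have hθn : 0 < ‖θ₀‖ := norm_pos_iff.mpr hθ₀
  have hmem : (toC x₀, toC θ₀) ∈ ΩC ×ˢ ΘC := ⟨hφ.mem_left x₀ hx₀, hφ.mem_right θ₀ hθ₀⟩
  have hcont : ContinuousAt (fun q : EuclideanSpace ℂ (Fin N) × EuclideanSpace ℝ (Fin n) ×
      EuclideanSpace ℝ (Fin N) =>
      ‖lineDeriv ℂ φC (q.1, toC q.2.1) (ec i, 0) - (q.2.2 i : ℂ)‖) (toC x₀, θ₀, ρ₀) := by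
    refine (ContinuousAt.sub ?_ ?_).norm
    · have h1 : ContinuousAt (fun p => lineDeriv ℂ φC p (ec i, 0)) (toC x₀, toC θ₀) :=
        (continuousOn_lineDeriv hφ.isOpen_prod hφ.holomorphic (ec i, 0)).continuousAt
          (hφ.isOpen_prod.mem_nhds hmem)
      have h2 : Continuous (fun q : EuclideanSpace ℂ (Fin N) × EuclideanSpace ℝ (Fin n) ×
          EuclideanSpace ℝ (Fin N) => (q.1, toC q.2.1)) :=
        continuous_fst.prodMk (continuous_toC.comp (continuous_fst.comp continuous_snd))
      exact ContinuousAt.comp (x := (toC x₀, θ₀, ρ₀)) h1 h2.continuousAt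
    · fun_prop
  have hev := hcont.eventually (lt_mem_nhds (show c < _ by simp only; linarith))
  obtain ⟨r₁, hr₁, h1⟩ := Metric.nhds_basis_closedBall.mem_iff.mp hev
  obtain ⟨r₂, hr₂, h2⟩ := Metric.nhds_basis_closedBall.mem_iff.mp (Ω.isOpen.mem_nhds hx₀)
  obtain ⟨r₃, hr₃, h3⟩ := Metric.nhds_basis_closedBall.mem_iff.mp
    (((ha.isExtension.isOpen.inter hφ.isOpen_left).mem_nhds
      ⟨ha.isExtension.mem x₀ hx₀, hφ.mem_left x₀ hx₀⟩))
  obtain ⟨r, hr0, hrr₁, hrr₂, hrr₃, hrt⟩ :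
      ∃ r : ℝ, 0 < r ∧ 2 * r ≤ r₁ ∧ 2 * r ≤ r₂ ∧ 2 * r ≤ r₃ ∧ 4 * r ≤ ‖θ₀‖ := by
    set s := min (min r₁ r₂) (min r₃ ‖θ₀‖) with hs
    have hs0 : 0 < s := by positivity
    have e1 : s ≤ r₁ := (min_le_left _ _).trans (min_le_left _ _)
    have e2 : s ≤ r₂ := (min_le_left _ _).trans (min_le_right _ _)
    have e3 : s ≤ r₃ := (min_le_right _ _).trans (min_le_left _ _)
    have e4 : s ≤ ‖θ₀‖ := (min_le_right _ _).trans (min_le_right _ _)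
    exact ⟨s / 4, by positivity, by linarith, by linarith, by linarith, by linarith⟩
  refine ⟨r, hr0, hrt, (Metric.closedBall_subset_closedBall hrr₂).trans h2, fun z hz => ?_,
    fun z hz => ?_, fun z hz θ hθ ρ hρ => ?_⟩
  · exact (h3 (Metric.closedBall_subset_closedBall hrr₃ hz)).2
  · exact (h3 (Metric.closedBall_subset_closedBall hrr₃ hz)).1
  · refine le_of_lt (h1 (?_ : (z, θ, ρ) ∈ _))
    rw [← closedBall_prod_same, ← closedBall_prod_same]
    exact ⟨Metric.closedBall_subset_closedBall hrr₁ hz,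
      Metric.closedBall_subset_closedBall hrr₁ hθ, Metric.closedBall_subset_closedBall hrr₁ hρ⟩

/-- At frequency `μθ` and covector `μρ` the `z`-derivative of the phase is `μ (φ_z - ρ)`, so each
integration by parts gains `1 / (c μ)`. The amplitude costs `μ ^ p`, and the rescaling in `η` costs
`μ ^ n`. -/
lemma isControlledAt_of_left (hφ : IsPhaseExtension Ω φ ΩC ΘC φC)
    (ha : IsAmplitudeExtension Ω m a ΩC' aC) {p : ℕ} (hp : |m| ≤ p)
    {x₀ ρ₀ : EuclideanSpace ℝ (Fin N)} (hx₀ : x₀ ∈ Ω) {θ₀ : EuclideanSpace ℝ (Fin n)}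
    (hθ₀ : θ₀ ≠ 0) {i : Fin N} (hne : lineDeriv ℂ φC (toC x₀, toC θ₀) (ec i, 0) ≠ (ρ₀ i : ℂ)) :
    IsControlledAt Ω φ a p x₀ θ₀ ρ₀ := by
  set c : ℝ := ‖lineDeriv ℂ φC (toC x₀, toC θ₀) (ec i, 0) - (ρ₀ i : ℂ)‖ / 2 with hc
  have hc0' := norm_pos_iff.mpr (sub_ne_zero.mpr hne)
  have hc0 : 0 < c := by positivity
  have hθn : 0 < ‖θ₀‖ := norm_pos_iff.mpr hθ₀
  obtain ⟨r, hr0, hrθ, hrΩ, hrC, hrC', hrc⟩ := exists_radius_left hφ ha hx₀ hθ₀ hne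
  rw [← hc] at hrc
  clear_value c
  obtain ⟨C₁, hC₁, hb⟩ := exists_norm_integral_left_le hφ ha hp hr0 hrC hrC' hrΩ
  set V : ℝ := (volume : Measure (EuclideanSpace ℝ (Fin n))).real (Metric.closedBall θ₀ r) with hV
  have hV0 : 0 ≤ V := measureReal_nonneg
  set D : ℝ := C₁ * (1 + 2 * ‖θ₀‖) ^ p * V with hD
  have hD0 : 0 ≤ D := by positivity
  set C : ℝ := 1 + 4 / r + 2 / c + D with hC
  have h4r : 0 < 4 / r := by positivity
  have h2c : 0 < 2 / c := by positivity
  have hC1 : 1 ≤ C := by linarith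
  refine ⟨r, hr0, C, by positivity, fun ρ hρ L B μ M₁ M₂ f g hB hμ hf hg hfr hgr => ?_⟩
  have hL : (0 : ℝ) ≤ L := Nat.cast_nonneg L
  have hμ1 : 1 ≤ μ := le_trans (by nlinarith) hμ
  have hμ0 : 0 < μ := by linarith
  have hB' : 4 / r * L ≤ B := le_trans (by gcongr <;> linarith) hB
  have hB0 : 0 ≤ B := le_trans (by positivity) hB'
  have h1 := hf.nonneg
  have h2 := hg.nonneg
  have hKb : ∀ θ ∈ Metric.closedBall θ₀ r, ‖θ₀‖ / 2 ≤ ‖θ‖ ∧ ‖θ‖ ≤ 2 * ‖θ₀‖ ∧ θ ≠ 0 := fun θ hθ =>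
    ne_zero_of_mem_closedBall hrθ hr0 (Metric.closedBall_subset_closedBall (by linarith) hθ)
  have hgc : HasCompactSupport g :=
    (isCompact_closedBall _ _).of_isClosed_subset (isClosed_tsupport _) hgr
  have hfc : HasCompactSupport f :=
    (isCompact_closedBall _ _).of_isClosed_subset (isClosed_tsupport _) hfr
  have hts := tsupport_mul_subset' (wave (μ • ρ)) f
  rw [oscInt_swap (g := fun η => g (μ⁻¹ • η)) (f := fun z => wave (μ • ρ) z * f z) hφ ha
    (hg.contDiff.continuous.comp (continuous_const_smul _))
    (hgc.comp_smul (inv_ne_zero hμ0.ne')) ((contDiff_wave _).continuous.mul hf.contDiff.continuous)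
    (hfc.of_isClosed_subset (isClosed_tsupport _) hts)
    (hts.trans (hfr.trans ((Metric.closedBall_subset_closedBall (by linarith)).trans hrΩ)))]
  set J : EuclideanSpace ℝ (Fin n) → ℂ := fun η =>
    ∫ z in (Ω : Set (EuclideanSpace ℝ (Fin N))),
      Complex.exp (Complex.I * (φ z η : ℂ)) * a z η * (wave (μ • ρ) z * f z) with hJ
  have heq := integral_compl_zero_scaled (g := g) (F := J) hgr (fun h => (hKb 0 h).2.2 rfl) hμ0
  have hpt : ∀ θ ∈ Metric.closedBall θ₀ r, ‖g θ * J (μ • θ)‖ ≤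
      M₂ * (C₁ * (μ * (1 + 2 * ‖θ₀‖)) ^ p * M₁ * (2 / c * B / μ) ^ L) := by
    intro θ hθ
    obtain ⟨-, h4, h3⟩ := hKb θ hθ
    have hμθ : μ • θ ≠ 0 := smul_ne_zero hμ0.ne' h3
    rw [norm_mul]
    refine mul_le_mul (hg.norm_le θ) ?_ (norm_nonneg _) h2
    refine (hb i (μ • θ) hμθ (μ • ρ) (c * μ) (by positivity) (fun z hz => ?_) L B M₁ f hB' hf
      hfr).trans ?_
    · have hz' := Metric.ball_subset_closedBall hz
      rw [toC_smul, hφ.lineDeriv_left_smul (hrC hz') (hφ.mem_right θ h3) hμ0]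
      have : (μ : ℂ) * lineDeriv ℂ φC (z, toC θ) (ec i, 0) - (((μ • ρ) i : ℝ) : ℂ) =
          μ * (lineDeriv ℂ φC (z, toC θ) (ec i, 0) - (ρ i : ℂ)) := by
        simp [mul_sub]
      rw [this, norm_mul, Complex.norm_real, Real.norm_of_nonneg hμ0.le, mul_comm]
      refine mul_le_mul_of_nonneg_left (hrc z hz' θ ?_ ρ ?_) hμ0.le
      · exact Metric.closedBall_subset_closedBall (by linarith) hθ
      · exact Metric.closedBall_subset_closedBall (by linarith) (Metric.ball_subset_closedBall hρ)
    · have e1 : 1 + ‖μ • θ‖ ≤ μ * (1 + 2 * ‖θ₀‖) := by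
        rw [norm_smul, Real.norm_of_nonneg hμ0.le]
        nlinarith
      have e2 : 2 * B / (c * μ) = 2 / c * B / μ := by field_simp
      rw [e2]
      gcongr
  rw [heq, norm_mul, norm_pow, Complex.norm_real, Real.norm_of_nonneg hμ0.le]
  calc μ ^ n * ‖∫ θ in Metric.closedBall θ₀ r, g θ * J (μ • θ)‖
      ≤ μ ^ n * (M₂ * (C₁ * (μ * (1 + 2 * ‖θ₀‖)) ^ p * M₁ * (2 / c * B / μ) ^ L) * V) := by
        gcongr
        exact norm_setIntegral_le_of_norm_le_const (isCompact_closedBall _ _).measure_lt_top hpt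
    _ = D * M₁ * M₂ * μ ^ (p + n) * (2 / c * B / μ) ^ L := by
        rw [hD, mul_pow, pow_add]; ring
    _ ≤ C * M₁ * M₂ * μ ^ (p + n) * (C * B / μ) ^ L := by
        gcongr <;> linarith

/-- Control holds unless the differential of `φ(z,θ) - ⟨z,ρ₀⟩` vanishes and the amplitude is not
exponentially decaying. -/
lemma isControlledAt (hφ : IsPhaseExtension Ω φ ΩC ΘC φC)
    (ha : IsAmplitudeExtension Ω m a ΩC' aC) {p : ℕ} (hp : |m| ≤ p)
    {x₀ ρ₀ : EuclideanSpace ℝ (Fin N)} (hx₀ : x₀ ∈ Ω) {θ₀ : EuclideanSpace ℝ (Fin n)}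
    (hθ₀ : θ₀ ≠ 0) (h : (∀ i, lineDeriv ℂ φC (toC x₀, toC θ₀) (ec i, 0) = (ρ₀ i : ℂ)) →
      (∀ i, lineDeriv ℂ φC (toC x₀, toC θ₀) (0, ec i) = 0) → IsExpDecayingAt Ω m a x₀ θ₀) :
    IsControlledAt Ω φ a p x₀ θ₀ ρ₀ := by
  by_cases h1 : ∀ i, lineDeriv ℂ φC (toC x₀, toC θ₀) (ec i, 0) = (ρ₀ i : ℂ)
  · by_cases h2 : ∀ i, lineDeriv ℂ φC (toC x₀, toC θ₀) (0, ec i) = 0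
    · exact isControlledAt_of_right (exists_norm_integral_right_le_of_decay hx₀ hθ₀ (h h1 h2) p)
    · push Not at h2
      obtain ⟨i, hi⟩ := h2
      exact isControlledAt_of_right (exists_norm_integral_right_le hφ ha hp hx₀ hθ₀ hi)
  · push Not at h1
    obtain ⟨i, hi⟩ := h1
    exact isControlledAt_of_left hφ ha hp hx₀ hθ₀ hi

/-- At the zero covector the exceptional case would force `dφ = 0`. This drives the convergence of
the integral and also supplies the endpoint `t = 0` of every ray `t ξ₀`. -/
lemma isControlledAt_zero (hφ : IsPhaseExtension Ω φ ΩC ΘC φC)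
    (ha : IsAmplitudeExtension Ω m a ΩC' aC) {p : ℕ} (hp : |m| ≤ p)
    {x₀ : EuclideanSpace ℝ (Fin N)} (hx₀ : x₀ ∈ Ω) {θ₀ : EuclideanSpace ℝ (Fin n)}
    (hθ₀ : θ₀ ≠ 0) : IsControlledAt Ω φ a p x₀ θ₀ 0 := by
  refine isControlledAt hφ ha hp hx₀ hθ₀ fun h1 h2 => ?_
  exfalso
  rcases hφ.exists_lineDeriv_ne_zero (hφ.mem_left x₀ hx₀) (hφ.mem_right θ₀ hθ₀) with
    ⟨i, hi⟩ | ⟨i, hi⟩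
  · exact hi (by simpa using h1 i)
  · exact hi (h2 i)

end Controlled

/-! ### Cut-off functions with controlled derivatives -/

section Cutoff

/-- The mean of `f` over `[x - h, x + h]`. -/
def slidingMean (h : ℝ) (f : ℝ → ℝ) (x : ℝ) : ℝ := (∫ t in (x - h)..(x + h), f t) / (2 * h)

variable {h : ℝ} {f : ℝ → ℝ}

lemma hasDerivAt_slidingMean (hf : Continuous f) (h x : ℝ) :
    HasDerivAt (slidingMean h f) ((f (x + h) - f (x - h)) / (2 * h)) x := by
  have hF : ∀ y, HasDerivAt (fun y => ∫ t in (0 : ℝ)..y, f t) (f y) y := fun y =>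
    intervalIntegral.integral_hasDerivAt_right (hf.intervalIntegrable _ _)
      (hf.stronglyMeasurableAtFilter _ _) hf.continuousAt
  have h1 := ((hF (x + h)).comp_add_const x h).sub ((hF (x - h)).comp_sub_const x h)
  refine (h1.div_const (2 * h)).congr_of_eventuallyEq (Eventually.of_forall fun y => ?_)
  simp only [slidingMean, Pi.sub_apply]
  rw [intervalIntegral.integral_interval_sub_left (hf.intervalIntegrable _ _)
    (hf.intervalIntegrable _ _)]

lemma deriv_slidingMean (hf : Continuous f) (h : ℝ) :
    deriv (slidingMean h f) = fun x => (f (x + h) - f (x - h)) / (2 * h) :=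
  funext fun x => (hasDerivAt_slidingMean hf h x).deriv

lemma contDiff_slidingMean (hf : ContDiff ℝ ∞ f) (h : ℝ) : ContDiff ℝ ∞ (slidingMean h f) := by
  rw [contDiff_infty_iff_deriv]
  refine ⟨fun x => (hasDerivAt_slidingMean hf.continuous h x).differentiableAt, ?_⟩
  rw [deriv_slidingMean hf.continuous]
  fun_prop

lemma iteratedDeriv_slidingMean (hf : ContDiff ℝ ∞ f) (h : ℝ) (k : ℕ) :
    iteratedDeriv k (slidingMean h f) = slidingMean h (iteratedDeriv k f) := by
  induction k generalizing f with
  | zero => simp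
  | succ k ih =>
    have hd := (contDiff_infty_iff_deriv.mp hf).2
    have : deriv (slidingMean h f) = slidingMean h (deriv f) := by
      rw [deriv_slidingMean hf.continuous]
      ext x
      rw [slidingMean, intervalIntegral.integral_deriv_eq_sub
        (fun y _ => hf.differentiable (by simp) y) (hd.continuous.intervalIntegrable _ _)]
    rw [iteratedDeriv_succ', iteratedDeriv_succ', this, ih hd]

/-- An average absorbs one derivative: the fundamental theorem of calculus turns it into a
difference quotient, costing `1 / h` rather than a higher derivative of `f`. -/
lemma iteratedDeriv_succ_slidingMean (hf : ContDiff ℝ ∞ f) (h : ℝ) (k : ℕ) (x : ℝ) :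
    iteratedDeriv (k + 1) (slidingMean h f) x =
      (iteratedDeriv k f (x + h) - iteratedDeriv k f (x - h)) / (2 * h) := by
  rw [iteratedDeriv_succ, iteratedDeriv_slidingMean hf, deriv_slidingMean]
  exact hf.continuous_iteratedDeriv k (mod_cast le_top)

/-- A mean does not exceed the supremum. Hence the derivative bounds of the initial bump survive any
number of averages, which gives boundedness in `C^∞`. -/
lemma abs_slidingMean_le (hh : 0 < h) {D : ℝ} (hf : ∀ x, |f x| ≤ D) (x : ℝ) :
    |slidingMean h f x| ≤ D := by
  rw [slidingMean, abs_div, abs_of_pos (by positivity : 0 < 2 * h), div_le_iff₀ (by positivity)]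
  have := intervalIntegral.norm_integral_le_of_norm_le_const (a := x - h) (b := x + h) (f := f)
    (C := D) fun y _ => hf y
  rwa [show x + h - (x - h) = 2 * h by ring, abs_of_pos (by positivity : 0 < 2 * h)] at this

lemma slidingMean_eq_of_forall (hh : 0 < h) {c x : ℝ} (hf : ∀ y, |y - x| ≤ h → f y = c) :
    slidingMean h f x = c := by
  have : ∫ t in (x - h)..(x + h), f t = ∫ _ in (x - h)..(x + h), c := by
    refine intervalIntegral.integral_congr fun y hy => hf y ?_
    rw [uIcc_of_le (by linarith)] at hy
    rw [abs_le]
    constructor <;> linarith [hy.1, hy.2]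
  rw [slidingMean, this, intervalIntegral.integral_const, smul_eq_mul]
  field_simp
  ring

/-- Smooth cut-off functions on the line whose derivatives up to order `L` grow at most like powers
of a multiple of `L`, and which are bounded in `C^∞`. -/
theorem exists_cutoff_line : ∃ c : ℕ → ℝ → ℝ, (∀ L, ContDiff ℝ ∞ (c L)) ∧
    (∀ L, ∀ k ≤ L, ∀ x, |iteratedDeriv k (c L) x| ≤ (4 * ((L : ℝ) + 1)) ^ k) ∧
    (∀ k, ∃ D, ∀ L x, |iteratedDeriv k (c L) x| ≤ D) ∧
    (∀ L x, |x| ≤ 1 → c L x = 1) ∧ ∀ L x, 2 ≤ |x| → c L x = 0 := by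
  -- `L` averages of half-width `1 / (4(L+1))` shift these radii by at most `1/4`, so the plateau
  -- still contains `|x| ≤ 1` and the support stays in `|x| ≤ 2`.
  let b : ContDiffBump (0 : ℝ) := ⟨5 / 4, 7 / 4, by norm_num, by norm_num⟩
  have hb : ContDiff ℝ ∞ (b : ℝ → ℝ) := b.contDiff
  have hbc : HasCompactSupport (b : ℝ → ℝ) := b.hasCompactSupport
  have hsm : ∀ h : ℝ, ∀ j, ContDiff ℝ ∞ ((slidingMean h)^[j] b) := fun h j => by
    induction j with
    | zero => exact hb
    | succ j ih => rw [Function.iterate_succ_apply']; exact contDiff_slidingMean ih h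
  have hall : ∀ k D, (∀ x, |iteratedDeriv k (b : ℝ → ℝ) x| ≤ D) → ∀ h : ℝ, 0 < h → ∀ j x,
      |iteratedDeriv k ((slidingMean h)^[j] b) x| ≤ D := fun k D hD h hh j => by
    induction j with
    | zero => exact hD
    | succ j ih =>
      intro x
      rw [Function.iterate_succ_apply', iteratedDeriv_slidingMean (hsm h j)]
      exact abs_slidingMean_le hh ih x
  have hb1 : ∀ x, |(b : ℝ → ℝ) x| ≤ 1 := fun x => by
    rw [abs_of_nonneg b.nonneg]; exact b.le_one
  have hpow : ∀ h : ℝ, 0 < h → ∀ j, ∀ k ≤ j, ∀ x,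
      |iteratedDeriv k ((slidingMean h)^[j] b) x| ≤ (1 / h) ^ k := fun h hh j => by
    induction j with
    | zero =>
      intro k hk x
      obtain rfl : k = 0 := by omega
      simpa using hb1 x
    | succ j ih =>
      intro k hk x
      cases k with
      | zero =>
        simpa using hall 0 1 (by simpa using hb1) h hh (j + 1) x
      | succ k =>
        rw [Function.iterate_succ_apply', iteratedDeriv_succ_slidingMean (hsm h j), abs_div,
          abs_of_pos (by positivity : 0 < 2 * h), div_le_iff₀ (by positivity)]
        refine (abs_sub _ _).trans ?_
        have h1 := ih k (by omega) (x + h)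
        have h2 := ih k (by omega) (x - h)
        have h3 : (1 / h) ^ (k + 1) * (2 * h) = 2 * (1 / h) ^ k := by
          rw [pow_succ]; field_simp
        rw [h3]
        linarith
  have hone : ∀ h : ℝ, 0 < h → ∀ j : ℕ, ∀ x, |x| + j * h ≤ 5 / 4 →
      (slidingMean h)^[j] b x = 1 := fun h hh j => by
    induction j with
    | zero =>
      intro x hx
      refine b.one_of_mem_closedBall ?_
      simpa [b] using hx
    | succ j ih =>
      intro x hx
      rw [Function.iterate_succ_apply']
      refine slidingMean_eq_of_forall hh fun y hy => ih y ?_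
      have := abs_sub_abs_le_abs_sub y x
      push_cast at hx
      linarith
  have hzero : ∀ h : ℝ, 0 < h → ∀ j : ℕ, ∀ x, 7 / 4 ≤ |x| - j * h →
      (slidingMean h)^[j] b x = 0 := fun h hh j => by
    induction j with
    | zero =>
      intro x hx
      refine b.zero_of_le_dist ?_
      simpa [b] using hx
    | succ j ih =>
      intro x hx
      rw [Function.iterate_succ_apply']
      refine slidingMean_eq_of_forall hh fun y hy => ih y ?_
      have := abs_sub_abs_le_abs_sub x y
      rw [abs_sub_comm] at this
      push_cast at hx
      linarith
  have hL : ∀ L : ℕ, (0 : ℝ) < L + 1 := fun L => by positivity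
  have hLh : ∀ L : ℕ, (L : ℝ) * (1 / (4 * (L + 1))) ≤ 1 / 4 := fun L => by
    rw [mul_one_div, div_le_div_iff₀ (by positivity) (by norm_num)]
    linarith
  refine ⟨fun L => (slidingMean (1 / (4 * (L + 1))))^[L] b, fun L => hsm _ L, fun L k hk x => ?_,
    fun k => ?_, fun L x hx => hone _ (by positivity) L x ?_,
    fun L x hx => hzero _ (by positivity) L x ?_⟩
  · simpa using hpow (1 / (4 * (L + 1))) (by positivity) L k hk x
  · obtain ⟨D, hD⟩ := (hbc.iteratedFDeriv (𝕜 := ℝ) k).exists_bound_of_continuous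
      (hb.continuous_iteratedFDeriv (mod_cast le_top))
    refine ⟨D, fun L => hall k D (fun x => ?_) _ (by positivity) L⟩
    rw [← Real.norm_eq_abs, ← norm_iteratedFDeriv_eq_norm_iteratedDeriv]
    exact hD x
  · linarith [hLh L]
  · linarith [hLh L]

lemma iteratedDeriv_ofReal_comp {c : ℝ → ℝ} (hc : ContDiff ℝ ∞ c) (k : ℕ) (x : ℝ) :
    iteratedDeriv k (fun t : ℝ => (c t : ℂ)) x = ((iteratedDeriv k c x : ℝ) : ℂ) := by
  induction k generalizing c with
  | zero => simp
  | succ k ih =>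
    have : deriv (fun t : ℝ => (c t : ℂ)) = fun t => ((deriv c t : ℝ) : ℂ) := by
      ext t
      exact (hc.differentiable (by simp) t).hasDerivAt.ofReal_comp.deriv
    rw [iteratedDeriv_succ', this, ih (contDiff_infty_iff_deriv.mp hc).2, iteratedDeriv_succ']

/-- Smooth cut-off functions around a point whose derivatives up to order `L` grow at most like
powers of a multiple of `L`, and which are bounded in `C^∞`. -/
theorem exists_cutoff {d : ℕ} (x₀ : EuclideanSpace ℝ (Fin d)) {r : ℝ} (hr : 0 < r) :
    ∃ (χ : ℕ → EuclideanSpace ℝ (Fin d) → ℝ) (C δ : ℝ), 0 < C ∧ 0 < δ ∧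
      (∀ L, ContDiff ℝ ∞ (χ L)) ∧
      (∀ L, HasBoundsUpTo L (C * (L + 1)) 1 (fun x => (χ L x : ℂ))) ∧
      (∀ k, ∃ D, ∀ L, HasBoundsUpTo k 1 D (fun x => (χ L x : ℂ))) ∧
      (∀ L, ∀ x ∈ Metric.closedBall x₀ δ, χ L x = 1) ∧
      ∀ L, tsupport (χ L) ⊆ Metric.closedBall x₀ r := by
  obtain ⟨c, hcs, hcL, hcD, hc1, hc0⟩ := exists_cutoff_line
  -- The product cut-off lives in the cube `|x_i - x₀_i| ≤ 2δ`, whose points are at distance at most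
  -- `2dδ ≤ r` from `x₀`. The `d + 1` keeps `δ` meaningful for `d = 0`.
  set δ : ℝ := r / (2 * (d + 1)) with hδ
  have hδ0 : 0 < δ := by positivity
  have hb1 : ∀ L x, |c L x| ≤ 1 := fun L x => by simpa using hcL L 0 (Nat.zero_le _) x
  set χ : ℕ → EuclideanSpace ℝ (Fin d) → ℝ := fun L x => ∏ i, c L (δ⁻¹ * (x i - x₀ i)) with hχ
  have hs : ∀ L, ContDiff ℝ ∞ (χ L) := fun L => by
    refine contDiff_prod fun i _ => (hcs L).comp ?_
    have : ContDiff ℝ ∞ (fun x : EuclideanSpace ℝ (Fin d) => x i) := by fun_prop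
    fun_prop
  have hsC : ∀ L, ContDiff ℝ ∞ (fun x => (χ L x : ℂ)) := fun L =>
    Complex.ofRealCLM.contDiff.comp (hs L)
  have hχ1 : ∀ L x, |χ L x| ≤ 1 := fun L x => by
    rw [hχ]
    simp only
    rw [Finset.abs_prod]
    exact Finset.prod_le_one (fun _ _ => abs_nonneg _) fun i _ => hb1 L _
  have hder : ∀ L i k x, ‖dirDeriv (er i) k (fun x => (χ L x : ℂ)) x‖ ≤
      (δ⁻¹) ^ k * |iteratedDeriv k (c L) (δ⁻¹ * (x i - x₀ i))| := by
    intro L i k x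
    -- Along a coordinate axis only one factor varies and the others are at most one, so the
    -- one-dimensional bounds carry over.
    have hline : (fun τ : ℝ => (χ L (x + τ • er i) : ℂ)) = fun τ : ℝ =>
        ((∏ j ∈ Finset.univ.erase i, c L (δ⁻¹ * (x j - x₀ j)) : ℝ) : ℂ) *
          ((c L (δ⁻¹ * (x i - x₀ i) + δ⁻¹ * τ) : ℝ) : ℂ) := by
      ext τ
      rw [hχ, ← Complex.ofReal_mul]
      simp only
      congr 1
      rw [← Finset.prod_erase_mul _ _ (Finset.mem_univ i)]
      congr 1
      · refine Finset.prod_congr rfl fun j hj => ?_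
        simp [Finset.ne_of_mem_erase hj]
      · congr 1
        simp
        ring
    have hcomp : ContDiff ℝ ∞ (fun y => c L (δ⁻¹ * (x i - x₀ i) + y)) :=
      (hcs L).comp (contDiff_const.add contDiff_id)
    rw [dirDeriv, hline, iteratedDeriv_const_mul_field,
      iteratedDeriv_ofReal_comp (c := fun τ => c L (δ⁻¹ * (x i - x₀ i) + δ⁻¹ * τ))
        (hcomp.comp (contDiff_const.mul contDiff_id)),
      iteratedDeriv_comp_const_mul (f := fun y => c L (δ⁻¹ * (x i - x₀ i) + y))
        (hcomp.of_le (mod_cast le_top)), iteratedDeriv_comp_const_add, norm_mul, Complex.norm_real,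
        Complex.norm_real, Real.norm_eq_abs, Real.norm_eq_abs, abs_mul, abs_pow,
        abs_of_pos (inv_pos.mpr hδ0), Finset.abs_prod]
    simp only [mul_zero, add_zero]
    refine mul_le_of_le_one_left (by positivity) ?_
    exact Finset.prod_le_one (fun _ _ => abs_nonneg _) fun j _ => hb1 L _
  refine ⟨χ, 4 * δ⁻¹, δ, by positivity, hδ0, hs, fun L => ⟨hsC L, fun x => ?_, fun i k hk x => ?_⟩,
    fun k => ?_, fun L x hx => ?_, fun L => ?_⟩
  · rw [Complex.norm_real]; exact hχ1 L x
  · refine (hder L i k x).trans ?_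
    rw [one_mul]
    calc δ⁻¹ ^ k * |iteratedDeriv k (c L) (δ⁻¹ * (x i - x₀ i))|
        ≤ δ⁻¹ ^ k * (4 * ((L : ℝ) + 1)) ^ k := by gcongr; exact hcL L k hk _
      _ = (4 * δ⁻¹ * (L + 1)) ^ k := by rw [← mul_pow]; ring
  · choose D hD using hcD
    set D' : ℝ := 1 + ∑ j ∈ Finset.range (k + 1), δ⁻¹ ^ j * |D j| with hD'
    have hD0 : 0 ≤ ∑ j ∈ Finset.range (k + 1), δ⁻¹ ^ j * |D j| :=
      Finset.sum_nonneg fun j _ => by positivity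
    refine ⟨D', fun L => ⟨hsC L, fun x => ?_, fun i j hj x => ?_⟩⟩
    · rw [Complex.norm_real]
      exact (hχ1 L x).trans (by linarith)
    · rw [one_pow, mul_one]
      refine (hder L i j x).trans ?_
      have h1 : δ⁻¹ ^ j * |D j| ≤ ∑ j ∈ Finset.range (k + 1), δ⁻¹ ^ j * |D j| :=
        Finset.single_le_sum (f := fun j => δ⁻¹ ^ j * |D j|) (fun j _ => by positivity)
          (by simpa [Nat.lt_succ_iff] using hj)
      have h2 : δ⁻¹ ^ j * |iteratedDeriv j (c L) (δ⁻¹ * (x i - x₀ i))| ≤ δ⁻¹ ^ j * |D j| :=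
        mul_le_mul_of_nonneg_left ((hD j L _).trans (le_abs_self _)) (by positivity)
      linarith
  · refine Finset.prod_eq_one fun i _ => hc1 L _ ?_
    rw [abs_mul, abs_of_pos (inv_pos.mpr hδ0), inv_mul_le_iff₀ hδ0, mul_one]
    have h1 := PiLp.norm_apply_le (x - x₀) i
    rw [mem_closedBall_iff_norm] at hx
    exact h1.trans hx
  · refine closure_minimal (fun x hx => ?_) Metric.isClosed_closedBall
    have hlt : ∀ i, ‖(x - x₀) i‖ ≤ 2 * δ := by
      intro i
      by_contra! hcon
      refine hx (Finset.prod_eq_zero (Finset.mem_univ i) (hc0 L _ ?_))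
      rw [abs_mul, abs_of_pos (inv_pos.mpr hδ0), le_inv_mul_iff₀ hδ0, mul_comm]
      exact hcon.le
    rw [mem_closedBall_iff_norm]
    have h1 : ‖x - x₀‖ ≤ ∑ i, ‖(x - x₀) i‖ := by
      have h2 : x - x₀ = ∑ i, (x - x₀) i • er i := by
        ext j
        simp [Finset.sum_apply, Pi.single_apply]
      calc ‖x - x₀‖ = ‖∑ i, (x - x₀) i • er i‖ := by rw [← h2]
        _ ≤ ∑ i, ‖(x - x₀) i • er i‖ := norm_sum_le _ _
        _ = _ := by simp [norm_smul]
    refine h1.trans ((Finset.sum_le_sum fun i _ => hlt i).trans ?_)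
    rw [Finset.sum_const, Finset.card_univ, Fintype.card_fin, nsmul_eq_mul, hδ]
    rw [show (d : ℝ) * (2 * (r / (2 * (d + 1)))) = d * r / (d + 1) by field_simp,
      div_le_iff₀ (by positivity)]
    nlinarith

end Cutoff

/-! ### From points to compact sets of frequencies, covectors and base points -/

section Compactness

variable {N n : ℕ} {Ω : Opens (EuclideanSpace ℝ (Fin N))} {m : ℝ}
  {φ : EuclideanSpace ℝ (Fin N) → EuclideanSpace ℝ (Fin n) → ℝ}
  {a : EuclideanSpace ℝ (Fin N) → EuclideanSpace ℝ (Fin n) → ℂ}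
  {ΩC ΩC' : Set (EuclideanSpace ℂ (Fin N))} {ΘC : Set (EuclideanSpace ℂ (Fin n))}
  {φC : EuclideanSpace ℂ (Fin N) × EuclideanSpace ℂ (Fin n) → ℂ}
  {aC : EuclideanSpace ℂ (Fin N) → EuclideanSpace ℝ (Fin n) → ℂ}

lemma HasBoundsUpTo.one_sub {d L : ℕ} {B M : ℝ} {f : EuclideanSpace ℝ (Fin d) → ℂ}
    (hB : 0 ≤ B) (hf : HasBoundsUpTo L B M f) :
    HasBoundsUpTo L B (1 + M) (fun x => 1 + -f x) := by
  have := (HasBoundsUpTo.const (L := L) (d := d) 1 hB).add hf.neg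
  simpa using this

/-- The combination `f₁ + f₂ (1 - f₁)` equals one wherever `f₁` or `f₂` does. It is the gluing step
that replaces a partition of unity in a compactness induction. -/
lemma HasBoundsUpTo.union {d L : ℕ} {B₁ B₂ M₁ M₂ : ℝ} {f₁ f₂ : EuclideanSpace ℝ (Fin d) → ℂ}
    (hB₁ : 0 ≤ B₁) (hB₂ : 0 ≤ B₂) (h₁ : HasBoundsUpTo L B₁ M₁ f₁) (h₂ : HasBoundsUpTo L B₂ M₂ f₂) :
    HasBoundsUpTo L (B₁ + B₂) (M₁ + M₂ * (1 + M₁)) (fun x => f₁ x + f₂ x * (1 + -f₁ x)) := by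
  have h3 := h₂.mul (h₁.one_sub hB₁)
  rw [add_comm B₂] at h3
  exact (h₁.mono hB₁ (by linarith) le_rfl).add h3

/-- Uniform control over a compact set of frequency directions. -/
theorem exists_uniform_control (hφ : IsPhaseExtension Ω φ ΩC ΘC φC)
    (ha : IsAmplitudeExtension Ω m a ΩC' aC) {p : ℕ}
    {x₀ ρ₀ : EuclideanSpace ℝ (Fin N)} (hx₀ : x₀ ∈ Ω) {K : Set (EuclideanSpace ℝ (Fin n))}
    (hK : IsCompact K) (hctrl : ∀ θ₀ ∈ K, IsControlledAt Ω φ a p x₀ θ₀ ρ₀) :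
    ∃ r : ℝ, 0 < r ∧ Metric.closedBall x₀ r ⊆ Ω ∧ ∃ C : ℝ, 0 < C ∧ ∀ ρ ∈ Metric.ball ρ₀ r,
      ∀ (L : ℕ) (B μ M₁ M₂ : ℝ)
      (f : EuclideanSpace ℝ (Fin N) → ℂ) (g : EuclideanSpace ℝ (Fin n) → ℂ),
      C * (L + 1) ≤ B → C * (L + 1) ≤ μ → HasBoundsUpTo L B M₁ f → HasBoundsUpTo L B M₂ g →
      tsupport f ⊆ Metric.closedBall x₀ r → tsupport g ⊆ K →
      ‖oscInt Ω φ a (fun η => g (μ⁻¹ • η)) (fun z => wave (μ • ρ) z * f z)‖ ≤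
        C * M₁ * M₂ * μ ^ (p + n) * (C * B / μ) ^ L := by
  obtain ⟨r₀, hr₀, hr₀Ω⟩ := Metric.nhds_basis_closedBall.mem_iff.mp (Ω.isOpen.mem_nhds hx₀)
  -- The property is strengthened to be stable under unions: a family `h L`, equal to one on the
  -- set, such that `h L * g` is controlled for every compactly supported `g`. Near a single point,
  -- `h L` is a cut-off supported in the ball of control.
  have main : ∃ r : ℝ, 0 < r ∧ r ≤ r₀ ∧ ∃ C : ℝ, 0 < C ∧ ∃ h : ℕ → EuclideanSpace ℝ (Fin n) → ℂ,
      (∀ L : ℕ, HasBoundsUpTo L (C * (L + 1)) C (h L)) ∧ (∀ L, ∀ θ ∈ K, h L θ = 1) ∧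
      ∀ ρ ∈ Metric.ball ρ₀ r, ∀ (L : ℕ) (B μ M₁ M₂ : ℝ)
      (f : EuclideanSpace ℝ (Fin N) → ℂ) (g : EuclideanSpace ℝ (Fin n) → ℂ),
      C * (L + 1) ≤ B → C * (L + 1) ≤ μ → HasBoundsUpTo L B M₁ f → HasBoundsUpTo L B M₂ g →
      tsupport f ⊆ Metric.closedBall x₀ r → HasCompactSupport g →
      ‖oscInt Ω φ a (fun η => h L (μ⁻¹ • η) * g (μ⁻¹ • η)) (fun z => wave (μ • ρ) z * f z)‖ ≤
        C * M₁ * M₂ * μ ^ (p + n) * (C * B / μ) ^ L := by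
    refine hK.induction_on (p := fun S => ∃ r : ℝ, 0 < r ∧ r ≤ r₀ ∧ ∃ C : ℝ, 0 < C ∧
      ∃ h : ℕ → EuclideanSpace ℝ (Fin n) → ℂ,
      (∀ L : ℕ, HasBoundsUpTo L (C * (L + 1)) C (h L)) ∧ (∀ L, ∀ θ ∈ S, h L θ = 1) ∧
      ∀ ρ ∈ Metric.ball ρ₀ r, ∀ (L : ℕ) (B μ M₁ M₂ : ℝ)
      (f : EuclideanSpace ℝ (Fin N) → ℂ) (g : EuclideanSpace ℝ (Fin n) → ℂ),
      C * (L + 1) ≤ B → C * (L + 1) ≤ μ → HasBoundsUpTo L B M₁ f → HasBoundsUpTo L B M₂ g →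
      tsupport f ⊆ Metric.closedBall x₀ r → HasCompactSupport g →
      ‖oscInt Ω φ a (fun η => h L (μ⁻¹ • η) * g (μ⁻¹ • η)) (fun z => wave (μ • ρ) z * f z)‖ ≤
        C * M₁ * M₂ * μ ^ (p + n) * (C * B / μ) ^ L) ?_ ?_ ?_ ?_
    · refine ⟨r₀, hr₀, le_rfl, 1, one_pos, fun _ _ => 0, fun L => ?_, by simp, ?_⟩
      · have := HasBoundsUpTo.const (L := L) (d := n) 0 (B := 1 * ((L : ℝ) + 1)) (by positivity)
        exact this.mono (by positivity) le_rfl (by simp)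
      · intro ρ _ L B μ M₁ M₂ f g hB hμ hf hg _ _
        simp only [zero_mul, oscInt_zero_left, norm_zero]
        have := hf.nonneg
        have := hg.nonneg
        have hB0 : 0 ≤ B := le_trans (by positivity) hB
        have hμ0 : 0 ≤ μ := le_trans (by positivity) hμ
        positivity
    · rintro S T hST ⟨r, hr, hrr₀, C, hC, h, h1, h2, h3⟩
      exact ⟨r, hr, hrr₀, C, hC, h, h1, fun L θ hθ => h2 L θ (hST hθ), h3⟩
    · rintro S T ⟨r₁, hr₁, hrr₁, C₁, hC₁, h, h1, h2, h3⟩ ⟨r₂, hr₂, hrr₂, C₂, hC₂, k, k1, k2, k3⟩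
      -- The factor `2` pays for `B` becoming `2 B` when `g` is multiplied by `1 - h L`, the factor
      -- `1 + C₁` for the size of `1 - h L`.
      set C : ℝ := 2 * (C₁ + C₂) * (1 + C₁) with hC
      have hC0 : 0 < C := by positivity
      have e1 : C₁ + C₂ ≤ C := by rw [hC]; nlinarith [mul_pos hC₁ hC₁, mul_pos hC₂ hC₁]
      have e2 : C₁ + C₂ * (1 + C₁) ≤ C := by rw [hC]; nlinarith [mul_pos hC₁ hC₁, mul_pos hC₂ hC₁]
      have e3 : C₂ * 2 ≤ C := by rw [hC]; nlinarith [mul_pos hC₁ hC₁, mul_pos hC₂ hC₁]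
      refine ⟨min r₁ r₂, lt_min hr₁ hr₂, (min_le_left _ _).trans hrr₁, C, hC0,
        fun L θ => h L θ + k L θ * (1 + -h L θ), fun L => ?_, ?_, ?_⟩
      · refine (HasBoundsUpTo.union (by positivity) (by positivity) (h1 L) (k1 L)).mono
          (by positivity) ?_ e2
        rw [← add_mul]
        gcongr
      · rintro L θ (hθ | hθ)
        · simp [h2 L θ hθ]
        · simp [k2 L θ hθ]
      · intro ρ hρ L B μ M₁ M₂ f g hB hμ hf hg hfr hgc
        have hL : (0 : ℝ) < L + 1 := by positivity
        have hB0 : 0 ≤ B := le_trans (by positivity) hB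
        have hμ0 : 0 < μ := lt_of_lt_of_le (by positivity) hμ
        have hM₁ := hf.nonneg
        have hM₂ := hg.nonneg
        have hfr₁ := hfr.trans (Metric.closedBall_subset_closedBall (min_le_left r₁ r₂))
        have hfr₂ := hfr.trans (Metric.closedBall_subset_closedBall (min_le_right r₁ r₂))
        have hg2 : HasBoundsUpTo L (B * 2) ((1 + C₁) * M₂) (fun θ => (1 + -h L θ) * g θ) := by
          refine (((h1 L).one_sub (by positivity)).mul hg).mono (by positivity) ?_ le_rfl
          have : C₁ * (L + 1) ≤ C * (L + 1) := by gcongr; linarith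
          linarith
        have hg2c : HasCompactSupport (fun θ => (1 + -h L θ) * g θ) := hgc.mul_left
        have b1 := h3 ρ (Metric.ball_subset_ball (min_le_left _ _) hρ) L B μ M₁ M₂ f g
          (le_trans (by gcongr; linarith) hB) (le_trans (by gcongr; linarith) hμ) hf hg hfr₁ hgc
        have b2 := k3 ρ (Metric.ball_subset_ball (min_le_right _ _) hρ) L (B * 2) μ M₁
          ((1 + C₁) * M₂) f (fun θ => (1 + -h L θ) * g θ)
          (le_trans (by gcongr; linarith) (hB.trans (by linarith)))
          (le_trans (by gcongr; linarith) hμ) (hf.mono hB0 (by linarith) le_rfl) hg2 hfr₂ hg2c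
        have hsplit := oscInt_add_left (Ω := Ω) (g₁ := fun η => h L (μ⁻¹ • η) * g (μ⁻¹ • η))
          (g₂ := fun η => k L (μ⁻¹ • η) * ((1 + -h L (μ⁻¹ • η)) * g (μ⁻¹ • η)))
          (f := fun z => wave (μ • ρ) z * f z) hφ ha
          (((h1 L).contDiff.continuous.mul hg.contDiff.continuous).comp (continuous_const_smul μ⁻¹))
          ((hgc.comp_smul (inv_ne_zero hμ0.ne')).mul_left)
          (((k1 L).contDiff.continuous.mul hg2.contDiff.continuous).comp
            (continuous_const_smul μ⁻¹))
          ((hg2c.comp_smul (inv_ne_zero hμ0.ne')).mul_left)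
          ((contDiff_wave _).continuous.mul hf.contDiff.continuous)
          (((isCompact_closedBall x₀ r₁).of_isClosed_subset (isClosed_tsupport _)
            ((tsupport_mul_subset' _ _).trans hfr₁)))
          ((tsupport_mul_subset' _ _).trans (hfr₁.trans
            ((Metric.closedBall_subset_closedBall hrr₁).trans hr₀Ω)))
        have heq : (fun η => (h L (μ⁻¹ • η) + k L (μ⁻¹ • η) * (1 + -h L (μ⁻¹ • η))) * g (μ⁻¹ • η)) =
            fun η => h L (μ⁻¹ • η) * g (μ⁻¹ • η) +
              k L (μ⁻¹ • η) * ((1 + -h L (μ⁻¹ • η)) * g (μ⁻¹ • η)) := by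
          ext η; ring
        simp only
        rw [heq, hsplit]
        refine (norm_add_le _ _).trans ((add_le_add b1 b2).trans ?_)
        calc C₁ * M₁ * M₂ * μ ^ (p + n) * (C₁ * B / μ) ^ L +
              C₂ * M₁ * ((1 + C₁) * M₂) * μ ^ (p + n) * (C₂ * (B * 2) / μ) ^ L
            ≤ C₁ * M₁ * M₂ * μ ^ (p + n) * (C * B / μ) ^ L +
              C₂ * M₁ * ((1 + C₁) * M₂) * μ ^ (p + n) * (C * B / μ) ^ L := by
              have e4 : C₂ * (B * 2) ≤ C * B := by nlinarith
              have e5 : C₁ ≤ C := by linarith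
              gcongr
          _ = (C₁ + C₂ * (1 + C₁)) * M₁ * M₂ * μ ^ (p + n) * (C * B / μ) ^ L := by ring
          _ ≤ C * M₁ * M₂ * μ ^ (p + n) * (C * B / μ) ^ L := by gcongr
    · intro θ₀ hθ₀
      obtain ⟨r, hr, C, hC, hb⟩ := hctrl θ₀ hθ₀
      obtain ⟨χ, Cχ, δ, hCχ, hδ, -, hχb, -, hχ1, hχs⟩ := exists_cutoff θ₀ hr
      refine ⟨Metric.closedBall θ₀ δ, mem_nhdsWithin_of_mem_nhds (Metric.closedBall_mem_nhds _ hδ),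
        min r r₀, lt_min hr hr₀, min_le_right _ _, 2 * C + Cχ + 1, by positivity,
        fun L θ => (χ L θ : ℂ), fun L => ?_, fun L θ hθ => by simp [hχ1 L θ hθ], ?_⟩
      · exact (hχb L).mono (by positivity) (by gcongr; linarith) (by linarith)
      · intro ρ hρ L B μ M₁ M₂ f g hB hμ hf hg hfr hgc
        have hL : (0 : ℝ) < L + 1 := by positivity
        have hB0 : 0 ≤ B := le_trans (by positivity) hB
        have hμ0 : 0 < μ := lt_of_lt_of_le (by positivity) hμ
        have hM₁ := hf.nonneg
        have hM₂ := hg.nonneg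
        have hg2 : HasBoundsUpTo L (B * 2) M₂ (fun θ => (χ L θ : ℂ) * g θ) := by
          have := (hχb L).mul hg
          rw [one_mul] at this
          refine this.mono (by positivity) ?_ le_rfl
          have : Cχ * (L + 1) ≤ (2 * C + Cχ + 1) * (L + 1) := by gcongr; linarith
          linarith
        have hsupp : tsupport (fun θ => (χ L θ : ℂ) * g θ) ⊆ Metric.closedBall θ₀ r := by
          refine closure_minimal (fun θ hθ => hχs L (subset_tsupport _ fun h0 => hθ ?_))
            Metric.isClosed_closedBall
          simp [h0]
        refine (hb ρ (Metric.ball_subset_ball (min_le_left _ _) hρ) L (B * 2) μ M₁ M₂ f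
          (fun θ => (χ L θ : ℂ) * g θ)
          (le_trans (by gcongr; linarith) (hB.trans (by linarith)))
          (le_trans (by gcongr; linarith) hμ) (hf.mono hB0 (by linarith) le_rfl) hg2
          (hfr.trans (Metric.closedBall_subset_closedBall (min_le_left _ _))) hsupp).trans ?_
        have e1 : C ≤ 2 * C + Cχ + 1 := by linarith
        have e2 : C * (B * 2) ≤ (2 * C + Cχ + 1) * B := by nlinarith
        gcongr
  obtain ⟨r, hr, hrr₀, C, hC, h, -, h2, h3⟩ := main
  refine ⟨r, hr, (Metric.closedBall_subset_closedBall hrr₀).trans hr₀Ω, C, hC,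
    fun ρ hρ L B μ M₁ M₂ f g hB hμ hf hg hfr hgK => ?_⟩
  have := h3 ρ hρ L B μ M₁ M₂ f g hB hμ hf hg hfr
    (hK.of_isClosed_subset (isClosed_tsupport _) hgK)
  have heq : ∀ θ, h L θ * g θ = g θ := fun θ => by
    by_cases hθ : θ ∈ K
    · rw [h2 L θ hθ, one_mul]
    · rw [image_eq_zero_of_notMem_tsupport fun h' => hθ (hgK h'), mul_zero]
  simpa only [heq] using this

/-- Uniform control over a compact set of frequency directions and a segment of covectors. -/
theorem exists_uniform_control_segment (hφ : IsPhaseExtension Ω φ ΩC ΘC φC)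
    (ha : IsAmplitudeExtension Ω m a ΩC' aC) {p : ℕ}
    {x₀ w₀ : EuclideanSpace ℝ (Fin N)} (hx₀ : x₀ ∈ Ω) {K : Set (EuclideanSpace ℝ (Fin n))}
    (hK : IsCompact K) {T : Set ℝ} (hT : IsCompact T)
    (hctrl : ∀ t ∈ T, ∀ θ₀ ∈ K, IsControlledAt Ω φ a p x₀ θ₀ (t • w₀)) :
    ∃ r : ℝ, 0 < r ∧ Metric.closedBall x₀ r ⊆ Ω ∧ ∃ C : ℝ, 0 < C ∧ ∀ t ∈ T,
      ∀ w ∈ Metric.ball w₀ r, ∀ (L : ℕ) (B μ M₁ M₂ : ℝ)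
      (f : EuclideanSpace ℝ (Fin N) → ℂ) (g : EuclideanSpace ℝ (Fin n) → ℂ),
      C * (L + 1) ≤ B → C * (L + 1) ≤ μ → HasBoundsUpTo L B M₁ f → HasBoundsUpTo L B M₂ g →
      tsupport f ⊆ Metric.closedBall x₀ r → tsupport g ⊆ K →
      ‖oscInt Ω φ a (fun η => g (μ⁻¹ • η)) (fun z => wave (μ • t • w) z * f z)‖ ≤
        C * M₁ * M₂ * μ ^ (p + n) * (C * B / μ) ^ L := by
  obtain ⟨r₀, hr₀, hr₀Ω⟩ := Metric.nhds_basis_closedBall.mem_iff.mp (Ω.isOpen.mem_nhds hx₀)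
  refine hT.induction_on (p := fun S => ∃ r : ℝ, 0 < r ∧ Metric.closedBall x₀ r ⊆ Ω ∧
      ∃ C : ℝ, 0 < C ∧ ∀ t ∈ S,
      ∀ w ∈ Metric.ball w₀ r, ∀ (L : ℕ) (B μ M₁ M₂ : ℝ)
      (f : EuclideanSpace ℝ (Fin N) → ℂ) (g : EuclideanSpace ℝ (Fin n) → ℂ),
      C * (L + 1) ≤ B → C * (L + 1) ≤ μ → HasBoundsUpTo L B M₁ f → HasBoundsUpTo L B M₂ g →
      tsupport f ⊆ Metric.closedBall x₀ r → tsupport g ⊆ K →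
      ‖oscInt Ω φ a (fun η => g (μ⁻¹ • η)) (fun z => wave (μ • t • w) z * f z)‖ ≤
        C * M₁ * M₂ * μ ^ (p + n) * (C * B / μ) ^ L) ?_ ?_ ?_ ?_
  · exact ⟨r₀, hr₀, hr₀Ω, 1, one_pos, fun t ht => absurd ht (notMem_empty t)⟩
  · rintro S S' hSS ⟨r, hr, hrΩ, C, hC, h⟩
    exact ⟨r, hr, hrΩ, C, hC, fun t ht => h t (hSS ht)⟩
  · rintro S S' ⟨r₁, hr₁, hrΩ₁, C₁, hC₁, h₁⟩ ⟨r₂, hr₂, hrΩ₂, C₂, hC₂, h₂⟩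
    refine ⟨min r₁ r₂, lt_min hr₁ hr₂, (Metric.closedBall_subset_closedBall
      (min_le_left _ _)).trans hrΩ₁, C₁ + C₂, by positivity, ?_⟩
    intro t ht w hw L B μ M₁ M₂ f g hB hμ hf hg hfr hgK
    have hL : (0 : ℝ) < L + 1 := by positivity
    have hB0 : 0 ≤ B := le_trans (by positivity) hB
    have hμ0 : 0 < μ := lt_of_lt_of_le (by positivity) hμ
    have hM₁ := hf.nonneg
    have hM₂ := hg.nonneg
    rcases ht with ht | ht
    · refine (h₁ t ht w (Metric.ball_subset_ball (min_le_left _ _) hw) L B μ M₁ M₂ f g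
        (le_trans (by gcongr; linarith) hB) (le_trans (by gcongr; linarith) hμ) hf hg
        (hfr.trans (Metric.closedBall_subset_closedBall (min_le_left _ _))) hgK).trans ?_
      have e1 : C₁ ≤ C₁ + C₂ := by linarith
      gcongr
    · refine (h₂ t ht w (Metric.ball_subset_ball (min_le_right _ _) hw) L B μ M₁ M₂ f g
        (le_trans (by gcongr; linarith) hB) (le_trans (by gcongr; linarith) hμ) hf hg
        (hfr.trans (Metric.closedBall_subset_closedBall (min_le_right _ _))) hgK).trans ?_
      have e1 : C₂ ≤ C₁ + C₂ := by linarith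
      gcongr
  · intro t₀ ht₀
    obtain ⟨r, hr, hrΩ, C, hC, h⟩ := exists_uniform_control hφ ha hx₀ hK (hctrl t₀ ht₀)
    -- Joint continuity of `(t, w) ↦ t • w` lets the ball of covectors around `t₀ • w₀` absorb
    -- variations of both `t` and `w`.
    have hcont : Tendsto (fun q : ℝ × EuclideanSpace ℝ (Fin N) => dist (q.1 • q.2) (t₀ • w₀))
        (𝓝 (t₀, w₀)) (𝓝 0) := by
      have : ContinuousAt (fun q : ℝ × EuclideanSpace ℝ (Fin N) => dist (q.1 • q.2) (t₀ • w₀))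
        (t₀, w₀) := by fun_prop
      simpa [ContinuousAt] using this
    have hev : ∀ᶠ q : ℝ × EuclideanSpace ℝ (Fin N) in 𝓝 (t₀, w₀),
        dist (q.1 • q.2) (t₀ • w₀) < r := hcont.eventually (gt_mem_nhds hr)
    obtain ⟨s, hs, hsb⟩ := Metric.eventually_nhds_iff.mp hev
    refine ⟨Metric.ball t₀ s, mem_nhdsWithin_of_mem_nhds (Metric.ball_mem_nhds _ hs),
      min r s, lt_min hr hs, (Metric.closedBall_subset_closedBall (min_le_left _ _)).trans hrΩ, C,
      hC, ?_⟩
    intro t ht w hw L B μ M₁ M₂ f g hB hμ hf hg hfr hgK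
    have hm : dist (t, w) (t₀, w₀) < s := by
      rw [Prod.dist_eq]
      exact max_lt ht (lt_of_lt_of_le hw (min_le_right _ _))
    have hm2 := hsb hm
    have hfr' := hfr.trans (Metric.closedBall_subset_closedBall (min_le_left r s))
    exact h (t • w) (Metric.mem_ball.mpr hm2) L B μ M₁ M₂ f g hB hμ hf hg hfr' hgK

/-- Decay of the dyadic pieces of the oscillatory integral, uniformly for test functions supported
in a compact set. -/
theorem exists_dyadic_decay (hφ : IsPhaseExtension Ω φ ΩC ΘC φC)
    (ha : IsAmplitudeExtension Ω m a ΩC' aC) {p : ℕ} (hp : |m| ≤ p)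
    {X : Set (EuclideanSpace ℝ (Fin N))} (hX : IsCompact X) (hXΩ : X ⊆ Ω)
    {K : Set (EuclideanSpace ℝ (Fin n))} (hK : IsCompact K) (hK0 : 0 ∉ K) (k : ℕ) :
    ∃ C : ℝ, 0 < C ∧ ∀ (μ M₁ M₂ : ℝ)
      (f : EuclideanSpace ℝ (Fin N) → ℂ) (g : EuclideanSpace ℝ (Fin n) → ℂ),
      C ≤ μ → HasBoundsUpTo k 1 M₁ f → HasBoundsUpTo k 1 M₂ g →
      tsupport f ⊆ X → tsupport g ⊆ K →
      ‖oscInt Ω φ a (fun η => g (μ⁻¹ • η)) f‖ ≤ C * M₁ * M₂ * μ ^ (p + n) / μ ^ k := by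
  -- The same gluing, now in the base. Since the order `k` is fixed, a single cut-off suffices, and
  -- growth of `B` is absorbed into the constant as `2 ^ k`.
  have main : ∃ C : ℝ, 0 < C ∧ ∃ h : EuclideanSpace ℝ (Fin N) → ℂ, HasBoundsUpTo k 1 C h ∧
      (∀ z ∈ X, h z = 1) ∧ ∀ (μ M₁ M₂ : ℝ)
      (f : EuclideanSpace ℝ (Fin N) → ℂ) (g : EuclideanSpace ℝ (Fin n) → ℂ),
      C ≤ μ → HasBoundsUpTo k 1 M₁ f → HasBoundsUpTo k 1 M₂ g →
      HasCompactSupport f → tsupport f ⊆ Ω → tsupport g ⊆ K →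
      ‖oscInt Ω φ a (fun η => g (μ⁻¹ • η)) (fun z => h z * f z)‖ ≤
        C * M₁ * M₂ * μ ^ (p + n) / μ ^ k := by
    refine hX.induction_on (p := fun S => ∃ C : ℝ, 0 < C ∧ ∃ h : EuclideanSpace ℝ (Fin N) → ℂ,
      HasBoundsUpTo k 1 C h ∧ (∀ z ∈ S, h z = 1) ∧ ∀ (μ M₁ M₂ : ℝ)
      (f : EuclideanSpace ℝ (Fin N) → ℂ) (g : EuclideanSpace ℝ (Fin n) → ℂ),
      C ≤ μ → HasBoundsUpTo k 1 M₁ f → HasBoundsUpTo k 1 M₂ g →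
      HasCompactSupport f → tsupport f ⊆ Ω → tsupport g ⊆ K →
      ‖oscInt Ω φ a (fun η => g (μ⁻¹ • η)) (fun z => h z * f z)‖ ≤
        C * M₁ * M₂ * μ ^ (p + n) / μ ^ k) ?_ ?_ ?_ ?_
    · refine ⟨1, one_pos, fun _ => 0, ?_, by simp, ?_⟩
      · exact (HasBoundsUpTo.const (L := k) (d := N) 0 zero_le_one).mono zero_le_one le_rfl
          (by simp)
      · intro μ M₁ M₂ f g hμ hf hg _ _ _
        have := hf.nonneg
        have := hg.nonneg
        have hμ0 : 0 ≤ μ := zero_le_one.trans hμ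
        simp only [zero_mul, oscInt, mul_zero, integral_zero, norm_zero]
        positivity
    · rintro S T hST ⟨C, hC, h, h1, h2, h3⟩
      exact ⟨C, hC, h, h1, fun z hz => h2 z (hST hz), h3⟩
    · rintro S T ⟨C₁, hC₁, h, h1, h2, h3⟩ ⟨C₂, hC₂, l, l1, l2, l3⟩
      have hu := HasBoundsUpTo.union zero_le_one zero_le_one h1 l1
      have hD : ∃ D : ℝ, 0 < D ∧ ∀ (M : ℝ) (f : EuclideanSpace ℝ (Fin N) → ℂ),
          HasBoundsUpTo k 1 M f → HasBoundsUpTo k 1 (D * M) (fun z => (1 + -h z) * f z) := by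
        refine ⟨(1 + C₁) * 2 ^ k, by positivity, fun M f hf => ?_⟩
        have h4 := (h1.one_sub zero_le_one).mul hf
        have hM := hf.nonneg
        refine ⟨h4.contDiff, fun x => (h4.norm_le x).trans ?_, fun i j hj x =>
          (h4.bound i j hj x).trans ?_⟩
        · have : (1 : ℝ) ≤ 2 ^ k := one_le_pow₀ (by norm_num)
          have h5 : 0 ≤ (1 + C₁) * M := by positivity
          nlinarith
        · have : (1 + 1 : ℝ) ^ j ≤ 2 ^ k := by
            rw [one_add_one_eq_two]; exact pow_le_pow_right₀ (by norm_num) hj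
          have h5 : 0 ≤ (1 + C₁) * M := by positivity
          rw [one_pow]
          nlinarith
      have hD' : ∃ D : ℝ, 0 < D ∧
          HasBoundsUpTo k 1 D (fun z => h z + l z * (1 + -h z)) := by
        have hnn := hu.nonneg
        refine ⟨(C₁ + C₂ * (1 + C₁)) * 2 ^ k, by positivity, hu.contDiff, fun x =>
          (hu.norm_le x).trans ?_, fun i j hj x => (hu.bound i j hj x).trans ?_⟩
        · have : (1 : ℝ) ≤ 2 ^ k := one_le_pow₀ (by norm_num)
          nlinarith
        · have : (1 + 1 : ℝ) ^ j ≤ 2 ^ k := by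
            rw [one_add_one_eq_two]; exact pow_le_pow_right₀ (by norm_num) hj
          rw [one_pow]
          nlinarith
      obtain ⟨D, hD0, hD⟩ := hD
      obtain ⟨D', hD'0, hD'⟩ := hD'
      have hcd : 0 < C₂ * D := by positivity
      refine ⟨C₁ + C₂ + C₂ * D + D', by positivity, fun z => h z + l z * (1 + -h z),
        hD'.mono zero_le_one le_rfl (by linarith), ?_, ?_⟩
      · rintro z (hz | hz)
        · simp [h2 z hz]
        · simp [l2 z hz]
      · intro μ M₁ M₂ f g hμ hf hg hfc hfΩ hgK
        have hμ0 : 0 < μ := lt_of_lt_of_le (by positivity) hμ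
        have hM₁ := hf.nonneg
        have hM₂ := hg.nonneg
        have hgc : HasCompactSupport g := hK.of_isClosed_subset (isClosed_tsupport _) hgK
        have hf2 := hD M₁ f hf
        have b1 := h3 μ M₁ M₂ f g (by linarith) hf hg hfc hfΩ hgK
        have b2 := l3 μ (D * M₁) M₂ (fun z => (1 + -h z) * f z) g (by linarith) hf2 hg hfc.mul_left
          ((tsupport_mul_subset' _ _).trans hfΩ) hgK
        have hsplit := oscInt_add_right (Ω := Ω) (g := fun η => g (μ⁻¹ • η))
          (f₁ := fun z => h z * f z) (f₂ := fun z => l z * ((1 + -h z) * f z)) hφ ha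
          (hg.contDiff.continuous.comp (continuous_const_smul μ⁻¹))
          (hgc.comp_smul (inv_ne_zero hμ0.ne'))
          (h1.contDiff.continuous.mul hf.contDiff.continuous) hfc.mul_left
          ((tsupport_mul_subset' _ _).trans hfΩ)
          (l1.contDiff.continuous.mul hf2.contDiff.continuous) hfc.mul_left.mul_left
          ((tsupport_mul_subset' _ _).trans ((tsupport_mul_subset' _ _).trans hfΩ))
        have heq : (fun z => (h z + l z * (1 + -h z)) * f z) =
            fun z => h z * f z + l z * ((1 + -h z) * f z) := by
          ext z; ring
        simp only
        rw [heq, hsplit]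
        refine (norm_add_le _ _).trans ((add_le_add b1 b2).trans ?_)
        rw [← add_div]
        have h5 : 0 ≤ M₁ * M₂ * μ ^ (p + n) := by positivity
        refine div_le_div_of_nonneg_right ?_ (by positivity)
        calc _ = (C₁ + C₂ * D) * (M₁ * M₂ * μ ^ (p + n)) := by ring
          _ ≤ (C₁ + C₂ + C₂ * D + D') * (M₁ * M₂ * μ ^ (p + n)) :=
            mul_le_mul_of_nonneg_right (by linarith) h5
          _ = _ := by ring
    · intro x₀ hx₀
      have hx₀Ω := hXΩ hx₀
      obtain ⟨r, hr, hrΩ, C, hC, hb⟩ := exists_uniform_control (ρ₀ := 0) hφ ha hx₀Ω hK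
        fun θ₀ hθ₀ => isControlledAt_zero hφ ha hp hx₀Ω fun h => hK0 (h ▸ hθ₀)
      obtain ⟨χ, -, δ, -, hδ, -, -, hχD, hχ1, hχs⟩ := exists_cutoff x₀ hr
      obtain ⟨D, hD⟩ := hχD k
      have hD := hD 0
      have hD0 := hD.nonneg
      -- With `k` fixed, `B` may be a constant: `C (k+1)` is the threshold of the control, and `2`
      -- covers the product of `f` with the cut-off.
      set B : ℝ := C * (k + 1) + 2 with hB
      set C' : ℝ := C * (k + 1) + D + C * D * (C * B) ^ k + 1 with hC'
      have e1 : 0 ≤ C * D * (C * B) ^ k := by positivity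
      have e2 : 0 < C * (k + 1) := by positivity
      refine ⟨Metric.closedBall x₀ δ, mem_nhdsWithin_of_mem_nhds (Metric.closedBall_mem_nhds _ hδ),
        C', by positivity, fun z => (χ 0 z : ℂ), hD.mono zero_le_one le_rfl (by linarith),
        fun z hz => by simp [hχ1 0 z hz], ?_⟩
      intro μ M₁ M₂ f g hμ hf hg hfc hfΩ hgK
      have hμ0 : 0 < μ := lt_of_lt_of_le (by positivity) hμ
      have hM₁ := hf.nonneg
      have hM₂ := hg.nonneg
      have hsupp : tsupport (fun z => (χ 0 z : ℂ) * f z) ⊆ Metric.closedBall x₀ r := by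
        refine closure_minimal (fun θ hθ => hχs 0 (subset_tsupport _ fun h0 => hθ ?_))
          Metric.isClosed_closedBall
        simp [h0]
      have hB2 : (1 + 1 : ℝ) ≤ B := by linarith
      have := hb 0 (Metric.mem_ball_self hr) k B μ (D * M₁) M₂ (fun z => (χ 0 z : ℂ) * f z) g
        (by linarith) (by linarith) ((hD.mul hf).mono (by norm_num) hB2 le_rfl)
        (hg.mono zero_le_one (by linarith) le_rfl) hsupp hgK
      simp only [smul_zero, wave_zero, one_mul] at this
      refine this.trans ?_
      have h6 : C * (D * M₁) * M₂ * μ ^ (p + n) * (C * B / μ) ^ k =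
          (C * D * (C * B) ^ k) * M₁ * M₂ * μ ^ (p + n) / μ ^ k := by
        rw [div_pow]; ring
      rw [h6]
      gcongr
      linarith
  obtain ⟨C, hC, h, -, h2, h3⟩ := main
  refine ⟨C, hC, fun μ M₁ M₂ f g hμ hf hg hfX hgK => ?_⟩
  have := h3 μ M₁ M₂ f g hμ hf hg (hX.of_isClosed_subset (isClosed_tsupport _) hfX)
    (hfX.trans hXΩ) hgK
  have heq : ∀ z, h z * f z = f z := fun z => by
    by_cases hz : z ∈ X
    · rw [h2 z hz, one_mul]
    · rw [image_eq_zero_of_notMem_tsupport fun h' => hz (hfX h'), mul_zero]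
  simpa only [heq] using this

end Compactness

/-! ### Existence of the oscillatory integral -/

section Existence

variable {N n : ℕ} {Ω : Opens (EuclideanSpace ℝ (Fin N))} {m : ℝ}
  {φ : EuclideanSpace ℝ (Fin N) → EuclideanSpace ℝ (Fin n) → ℝ}
  {a : EuclideanSpace ℝ (Fin N) → EuclideanSpace ℝ (Fin n) → ℂ}
  {ΩC ΩC' : Set (EuclideanSpace ℂ (Fin N))} {ΘC : Set (EuclideanSpace ℂ (Fin n))}
  {φC : EuclideanSpace ℂ (Fin N) × EuclideanSpace ℂ (Fin n) → ℂ}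
  {aC : EuclideanSpace ℂ (Fin N) → EuclideanSpace ℝ (Fin n) → ℂ}

lemma HasBoundsUpTo.of_norm_iteratedFDeriv_le {d k : ℕ} {M : ℝ} {f : EuclideanSpace ℝ (Fin d) → ℂ}
    (hf : ContDiff ℝ ∞ f) (h : ∀ j ≤ k, ∀ x, ‖iteratedFDeriv ℝ j f x‖ ≤ M) :
    HasBoundsUpTo k 1 M f := by
  refine ⟨hf, fun x => ?_, fun i j hj x => (norm_dirDeriv_le hf _ _ _).trans ?_⟩
  · simpa using h 0 (Nat.zero_le _) x
  · simpa [er] using h j hj x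

lemma exists_hasBoundsUpTo {d : ℕ} (k : ℕ) {f : EuclideanSpace ℝ (Fin d) → ℂ}
    (hf : ContDiff ℝ ∞ f) (hfc : HasCompactSupport f) : ∃ M, HasBoundsUpTo k 1 M f := by
  have hb : ∀ j, ∃ C, ∀ x, ‖iteratedFDeriv ℝ j f x‖ ≤ C := fun j =>
    (hfc.iteratedFDeriv j).exists_bound_of_continuous
      (hf.continuous_iteratedFDeriv (by exact_mod_cast le_top))
  choose C hC using hb
  refine ⟨∑ j ∈ Finset.range (k + 1), C j, .of_norm_iteratedFDeriv_le hf fun j hj x => ?_⟩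
  exact (hC j x).trans (Finset.single_le_sum (f := C)
    (fun i _ => (norm_nonneg _).trans (hC i x)) (Finset.mem_range.mpr (by omega)))

/-- For a fixed cut-off in the frequency, the oscillatory integral is bounded by the supremum
norm. -/
lemma exists_norm_oscInt_le (hφ : IsPhaseExtension Ω φ ΩC ΘC φC)
    (ha : IsAmplitudeExtension Ω m a ΩC' aC) {X : Set (EuclideanSpace ℝ (Fin N))}
    (hX : IsCompact X) (hXΩ : X ⊆ Ω) {g : EuclideanSpace ℝ (Fin n) → ℂ} (hg : Continuous g)
    (hgc : HasCompactSupport g) :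
    ∃ C : ℝ, 0 ≤ C ∧ ∀ (M : ℝ) (f : EuclideanSpace ℝ (Fin N) → ℂ), Continuous f →
      (∀ x, ‖f x‖ ≤ M) → tsupport f ⊆ X → ‖oscInt Ω φ a g f‖ ≤ C * M := by
  obtain ⟨p, hp⟩ := exists_nat_ge |m|
  obtain ⟨B, hB0, hB⟩ := ha.exists_real_bound_pow hp hXΩ hX
  obtain ⟨Mg, hMg⟩ := hgc.exists_bound_of_continuous hg
  have hMg0 := (norm_nonneg _).trans (hMg 0)
  obtain ⟨R, hR⟩ := hgc.isCompact.isBounded.exists_norm_le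
  set ν := (volume.restrict (Ω : Set (EuclideanSpace ℝ (Fin N)))).prod
        (volume.restrict ({0}ᶜ : Set (EuclideanSpace ℝ (Fin n)))) with hν
  set T := X ×ˢ tsupport g with hT
  have hTc : IsCompact T := hX.prod hgc.isCompact
  have hνT : ν T ≠ ⊤ := by
    rw [hν, Measure.prod_restrict]
    exact ((Measure.restrict_le_self _).trans_lt hTc.measure_lt_top).ne
  refine ⟨ν.real T * (Mg * (B * (1 + |R|) ^ p)), by positivity, fun M f hf hfM hfX => ?_⟩
  have hM0 : 0 ≤ M := (norm_nonneg _).trans (hfM 0)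
  rw [oscInt_eq_prod hφ ha hg hgc hf (hX.of_isClosed_subset (isClosed_tsupport _) hfX)
    (hfX.trans hXΩ)]
  refine (norm_integral_le_of_norm_le (g := T.indicator fun _ => Mg * (B * (1 + |R|) ^ p * M))
    ?_ ?_).trans_eq ?_
  · rw [integrable_indicator_iff hTc.measurableSet]
    exact integrableOn_const hνT
  · rw [Measure.prod_restrict]
    refine (ae_restrict_iff' (Ω.isOpen.prod isOpen_compl_singleton).measurableSet).mpr
      (Eventually.of_forall fun x hx => ?_)
    by_cases hxT : x ∈ T
    · rw [indicator_of_mem hxT, norm_mul, norm_mul, norm_mul, norm_exp_I_mul_ofReal, one_mul]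
      have h1 := hB x.1 hxT.1 x.2 hx.2
      have h2 := (hR x.2 hxT.2).trans (le_abs_self R)
      have h3 : ‖a x.1 x.2‖ ≤ B * (1 + |R|) ^ p := h1.trans (by gcongr)
      have h4 := hfM x.1
      have h5 := hMg x.2
      gcongr
    · rw [indicator_of_notMem hxT]
      by_cases h1 : x.1 ∈ tsupport f
      · have h2 : x.2 ∉ tsupport g := fun h => hxT ⟨hfX h1, h⟩
        simp [image_eq_zero_of_notMem_tsupport h2]
      · simp [image_eq_zero_of_notMem_tsupport h1]
  · rw [integral_indicator_const _ hTc.measurableSet, smul_eq_mul]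
    ring

/-- `χ` is a smooth cut-off function equal to one near the origin. -/
structure IsCutoff (χ : EuclideanSpace ℝ (Fin n) → ℝ) : Prop where
  contDiff : ContDiff ℝ ∞ χ
  hasCompactSupport : HasCompactSupport χ
  eventually_eq_one : ∀ᶠ η in 𝓝 0, χ η = 1

namespace IsCutoff

variable {χ : EuclideanSpace ℝ (Fin n) → ℝ}

lemma contDiff_ofReal (h : IsCutoff χ) : ContDiff ℝ ∞ fun η => (χ η : ℂ) :=
  Complex.ofRealCLM.contDiff.comp h.contDiff

lemma hasCompactSupport_ofReal (h : IsCutoff χ) : HasCompactSupport fun η => (χ η : ℂ) :=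
  h.hasCompactSupport.comp_left (g := fun x : ℝ => (x : ℂ)) Complex.ofReal_zero

lemma continuous_smul (h : IsCutoff χ) (ε : ℝ) : Continuous fun η => (χ (ε • η) : ℂ) :=
  h.contDiff_ofReal.continuous.comp (continuous_const_smul ε)

lemma hasCompactSupport_smul (h : IsCutoff χ) {ε : ℝ} (hε : ε ≠ 0) :
    HasCompactSupport fun η => (χ (ε • η) : ℂ) :=
  h.hasCompactSupport_ofReal.comp_smul hε

end IsCutoff

lemma exists_isCutoff (n : ℕ) : ∃ χ : EuclideanSpace ℝ (Fin n) → ℝ, IsCutoff χ := by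
  obtain ⟨χ, -, δ, -, hδ, h1, -, -, h4, h5⟩ := exists_cutoff (0 : EuclideanSpace ℝ (Fin n)) one_pos
  exact ⟨χ 0, h1 0, (isCompact_closedBall _ _).of_isClosed_subset (isClosed_tsupport _) (h5 0),
    Filter.eventually_of_mem (Metric.closedBall_mem_nhds _ hδ) (h4 0)⟩

/-- Two regularizations at comparable scales are close. -/
theorem exists_norm_oscInt_sub_le (hφ : IsPhaseExtension Ω φ ΩC ΘC φC)
    (ha : IsAmplitudeExtension Ω m a ΩC' aC) {p : ℕ} (hp : |m| ≤ p)
    {X : Set (EuclideanSpace ℝ (Fin N))} (hX : IsCompact X) (hXΩ : X ⊆ Ω)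
    {χ₁ χ₂ : EuclideanSpace ℝ (Fin n) → ℝ} (h₁ : IsCutoff χ₁) (h₂ : IsCutoff χ₂) :
    ∃ C : ℝ, 0 < C ∧ ∀ s ∈ Icc (1 / 2 : ℝ) 1, ∀ ε : ℝ, 0 < ε → C * ε ≤ 1 → ∀ (M : ℝ)
      (f : EuclideanSpace ℝ (Fin N) → ℂ), HasBoundsUpTo (p + n + 1) 1 M f → tsupport f ⊆ X →
      ‖oscInt Ω φ a (fun η => (χ₁ ((s * ε) • η) : ℂ)) f -
        oscInt Ω φ a (fun η => (χ₂ (ε • η) : ℂ)) f‖ ≤ C * M * ε := by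
  obtain ⟨M₁, hM₁⟩ := exists_hasBoundsUpTo (p + n + 1) h₁.contDiff_ofReal
    h₁.hasCompactSupport_ofReal
  obtain ⟨M₂, hM₂⟩ := exists_hasBoundsUpTo (p + n + 1) h₂.contDiff_ofReal
    h₂.hasCompactSupport_ofReal
  obtain ⟨R₁, hR₁⟩ := h₁.hasCompactSupport.isCompact.isBounded.exists_norm_le
  obtain ⟨R₂, hR₂⟩ := h₂.hasCompactSupport.isCompact.isBounded.exists_norm_le
  obtain ⟨r, hr, hrb⟩ := Metric.eventually_nhds_iff.mp
    (h₁.eventually_eq_one.and h₂.eventually_eq_one)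
  -- Both cut-offs equal one near the origin, so `χ₁(sθ) - χ₂(θ)` is supported in an annulus. The `2
  -- |R₁|` accounts for `s ≥ 1/2`.
  set K : Set (EuclideanSpace ℝ (Fin n)) :=
    Metric.closedBall 0 (2 * |R₁| + |R₂|) \ Metric.ball 0 r with hKdef
  have hK : IsCompact K := (isCompact_closedBall _ _).diff Metric.isOpen_ball
  -- At scale `μ = 1/ε`, order `p + n + 1` beats the loss `μ ^ (p+n)` by exactly one power, leaving
  -- the rate `ε`.
  obtain ⟨C, hC, h⟩ := exists_dyadic_decay hφ ha hp hX hXΩ hK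
    (fun h => h.2 (Metric.mem_ball_self hr)) (p + n + 1)
  have hM₁0 := hM₁.nonneg
  have hM₂0 := hM₂.nonneg
  refine ⟨C + C * (M₁ + M₂), by positivity, fun s hs ε hε hεC M f hf hfX => ?_⟩
  have hM := hf.nonneg
  have hs0 : 0 < s := lt_of_lt_of_le (by norm_num) hs.1
  set g : EuclideanSpace ℝ (Fin n) → ℂ := fun θ => (χ₁ (s • θ) : ℂ) + -(χ₂ θ : ℂ) with hgdef
  have hg : HasBoundsUpTo (p + n + 1) 1 (M₁ + M₂) g :=
    ((hM₁.comp_smul hs0.le).mono (by linarith) (by linarith [hs.2]) le_rfl).add hM₂.neg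
  have hgK : tsupport g ⊆ K := by
    refine closure_minimal (fun θ hθ => ⟨?_, fun hb => hθ ?_⟩) hK.isClosed
    · rw [mem_closedBall_zero_iff]
      by_contra hlt
      push Not at hlt
      have e1 : χ₂ θ = 0 := image_eq_zero_of_notMem_tsupport fun h' => by
        have := hR₂ θ h'
        have := le_abs_self R₂
        have := abs_nonneg R₁
        linarith
      have e2 : χ₁ (s • θ) = 0 := image_eq_zero_of_notMem_tsupport fun h' => by
        have e3 := hR₁ _ h'
        rw [norm_smul, Real.norm_of_nonneg hs0.le] at e3
        have := le_abs_self R₁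
        have := abs_nonneg R₂
        have := mul_le_mul_of_nonneg_right hs.1 (norm_nonneg θ)
        linarith
      exact hθ (by simp [hgdef, e1, e2])
    · rw [mem_ball_zero_iff] at hb
      have e1 := (hrb (y := θ) (by rwa [dist_zero_right])).2
      have e2 := (hrb (y := s • θ) (by
        rw [dist_zero_right, norm_smul, Real.norm_of_nonneg hs0.le]
        exact (mul_le_of_le_one_left (norm_nonneg _) hs.2).trans_lt hb)).1
      simp [hgdef, e1, e2]
  have key := h ε⁻¹ M (M₁ + M₂) f g (by
    rw [le_inv_comm₀ hC hε, inv_eq_one_div, le_div_iff₀ hC]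
    refine le_trans ?_ hεC
    rw [mul_comm ε]
    gcongr
    nlinarith) hf hg hfX hgK
  have hfc : HasCompactSupport f := hX.of_isClosed_subset (isClosed_tsupport _) hfX
  have hsplit := oscInt_add_left (g₁ := fun η => g (ε • η)) (g₂ := fun η => (χ₂ (ε • η) : ℂ))
    hφ ha (hg.contDiff.continuous.comp (continuous_const_smul ε))
    (HasCompactSupport.comp_smul (hK.of_isClosed_subset (isClosed_tsupport _) hgK) hε.ne')
    (h₂.continuous_smul ε) (h₂.hasCompactSupport_smul hε.ne') hf.contDiff.continuous hfc
    (hfX.trans hXΩ)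
  have heq : (fun η => g (ε • η) + (χ₂ (ε • η) : ℂ)) = fun η => (χ₁ ((s * ε) • η) : ℂ) := by
    ext η; simp [hgdef, smul_smul]
  rw [heq] at hsplit
  rw [hsplit, add_sub_cancel_right]
  rw [inv_inv] at key
  refine key.trans ?_
  have : ε⁻¹ ^ (p + n) / ε⁻¹ ^ (p + n + 1) = ε := by
    rw [pow_succ]; field_simp
  rw [mul_div_assoc, this]
  have e5 : 0 ≤ C * M * ε := by positivity
  nlinarith

/-- `A` is the limit of the regularized oscillatory integrals, with a rate which is uniform for
functions supported in a compact set with bounds on `k` derivatives. -/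
def IsOscLimit (Ω : Opens (EuclideanSpace ℝ (Fin N)))
    (φ : EuclideanSpace ℝ (Fin N) → EuclideanSpace ℝ (Fin n) → ℝ)
    (a : EuclideanSpace ℝ (Fin N) → EuclideanSpace ℝ (Fin n) → ℂ) (k : ℕ)
    (A : (EuclideanSpace ℝ (Fin N) → ℂ) → ℂ) : Prop :=
  ∀ X : Set (EuclideanSpace ℝ (Fin N)), IsCompact X → X ⊆ Ω →
    ∀ χ : EuclideanSpace ℝ (Fin n) → ℝ, IsCutoff χ →
    ∃ C : ℝ, 0 < C ∧ ∀ ε : ℝ, 0 < ε → C * ε ≤ 1 → ∀ (M : ℝ) (f : EuclideanSpace ℝ (Fin N) → ℂ),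
      HasBoundsUpTo k 1 M f → tsupport f ⊆ X →
      ‖oscInt Ω φ a (fun η => (χ (ε • η) : ℂ)) f - A f‖ ≤ C * M * ε

theorem exists_isOscLimit (hφ : IsPhaseExtension Ω φ ΩC ΘC φC)
    (ha : IsAmplitudeExtension Ω m a ΩC' aC) {p : ℕ} (hp : |m| ≤ p) :
    ∃ A, IsOscLimit Ω φ a (p + n + 1) A := by
  obtain ⟨h, hh⟩ := exists_isCutoff n
  set F : ℕ → (EuclideanSpace ℝ (Fin N) → ℂ) → ℂ := fun J f =>
    oscInt Ω φ a (fun η => (h (((1 / 2 : ℝ) ^ J) • η) : ℂ)) f with hF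
  -- The limit is defined along dyadic scales with one fixed cut-off; comparison at neighbouring
  -- scales then gives the same value for every `χ` and every `ε → 0`.
  refine ⟨fun f => limUnder atTop fun J => F J f, fun X hX hXΩ χ hχ => ?_⟩
  obtain ⟨C₁, hC₁, h₁⟩ := exists_norm_oscInt_sub_le hφ ha hp hX hXΩ hh hh
  obtain ⟨C₂, hC₂, h₂⟩ := exists_norm_oscInt_sub_le hφ ha hp hX hXΩ hχ hh
  refine ⟨2 * (C₁ + C₂ + 1) + 4 * C₁ + 2 * C₂, by positivity, fun ε hε hεC M f hf hfX => ?_⟩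
  have hM := hf.nonneg
  have hε1 : ε ≤ 1 := by nlinarith
  -- The dyadic scale `δ = 2^(-J)` satisfies `ε ≤ δ < 2ε`, so `ε / δ` lies in the range `[1/2, 1]`
  -- where the comparison applies.
  obtain ⟨J, hJ1, hJ2⟩ := exists_nat_pow_near (one_le_inv₀ hε |>.mpr hε1) (one_lt_two (α := ℝ))
  set δ : ℝ := (1 / 2) ^ J with hδ
  have hδ' : δ = (2 ^ J)⁻¹ := by rw [hδ, one_div, inv_pow]
  have hδ0 : 0 < δ := by positivity
  have hle : ε ≤ δ := by rw [hδ']; exact (le_inv_comm₀ (by positivity) hε).mp hJ1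
  have hlt : δ < 2 * ε := by
    rw [pow_succ, inv_lt_comm₀ hε (by positivity), mul_inv] at hJ2
    rw [hδ']; linarith
  have hdist : ∀ i, dist (F (i + J) f) (F (i + 1 + J) f) ≤ 2 * (C₁ * M * δ) / 2 / 2 ^ i := by
    intro i
    have hpow : (1 / 2 : ℝ) ^ (i + J) = δ / 2 ^ i := by
      rw [pow_add, ← hδ, one_div, inv_pow]; ring
    have hpow' : (1 / 2 : ℝ) ^ (i + 1 + J) = 1 / 2 * (δ / 2 ^ i) := by
      rw [← hpow]; ring
    have hi : δ / 2 ^ i ≤ δ := div_le_self hδ0.le (one_le_pow₀ (by norm_num))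
    have := h₁ (1 / 2) ⟨le_rfl, by norm_num⟩ (δ / 2 ^ i) (by positivity) (by nlinarith) M f hf hfX
    rw [dist_comm, dist_eq_norm]
    simp only [hF, hpow, hpow']
    refine this.trans_eq ?_
    ring
  have hlim : Tendsto (fun J => F J f) atTop (𝓝 (limUnder atTop fun J => F J f)) := by
    have hc : CauchySeq fun i => F (i + J) f := cauchySeq_of_le_geometric_two hdist
    obtain ⟨l, hl⟩ := cauchySeq_tendsto_of_complete hc
    exact tendsto_nhds_limUnder ⟨l, (tendsto_add_atTop_iff_nat J).mp hl⟩
  have hd := dist_le_of_le_geometric_two_of_tendsto₀ hdist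
    ((tendsto_add_atTop_iff_nat J).mpr hlim)
  rw [Nat.zero_add, dist_eq_norm] at hd
  have hs : ε / δ ∈ Icc (1 / 2 : ℝ) 1 :=
    ⟨by rw [le_div_iff₀ hδ0]; linarith, by rw [div_le_one hδ0]; exact hle⟩
  have h3 := h₂ (ε / δ) hs δ hδ0 (by nlinarith) M f hf hfX
  rw [div_mul_cancel₀ _ hδ0.ne'] at h3
  have h4 := norm_sub_le_norm_sub_add_norm_sub
    (oscInt Ω φ a (fun η => (χ (ε • η) : ℂ)) f) (F J f) (limUnder atTop fun J => F J f)
  refine h4.trans ((add_le_add h3 hd).trans ?_)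
  have e1 : C₂ * M * δ ≤ C₂ * M * (2 * ε) := by gcongr
  have e2 : C₁ * M * δ ≤ C₁ * M * (2 * ε) := by gcongr
  have e3 : 0 ≤ (C₁ + C₂ + 1) * M * ε := by positivity
  linarith

namespace IsOscLimit

variable {k : ℕ} {A : (EuclideanSpace ℝ (Fin N) → ℂ) → ℂ}
  {f f₁ f₂ : EuclideanSpace ℝ (Fin N) → ℂ}

lemma tendsto (hA : IsOscLimit Ω φ a k A) {χ : EuclideanSpace ℝ (Fin n) → ℝ} (hχ : IsCutoff χ)
    (hf : ContDiff ℝ ∞ f) (hfc : HasCompactSupport f) (hfΩ : tsupport f ⊆ Ω) :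
    Tendsto (fun ε : ℝ => oscInt Ω φ a (fun η => (χ (ε • η) : ℂ)) f) (𝓝[>] 0) (𝓝 (A f)) := by
  obtain ⟨M, hM⟩ := exists_hasBoundsUpTo k hf hfc
  obtain ⟨C, hC, h⟩ := hA _ hfc.isCompact hfΩ χ hχ
  rw [tendsto_iff_norm_sub_tendsto_zero]
  have hlim : Tendsto (fun ε : ℝ => C * M * ε) (𝓝[>] 0) (𝓝 0) := by
    have : Tendsto (fun ε : ℝ => C * M * ε) (𝓝 0) (𝓝 (C * M * 0)) :=
      (continuous_const.mul continuous_id).tendsto 0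
    rw [mul_zero] at this
    exact this.mono_left nhdsWithin_le_nhds
  refine squeeze_zero' (Eventually.of_forall fun _ => norm_nonneg _) ?_ hlim
  filter_upwards [Ioo_mem_nhdsGT (inv_pos.mpr hC)] with ε hε
  exact h ε hε.1 (by
    have := mul_lt_mul_of_pos_left hε.2 hC
    rw [mul_inv_cancel₀ hC.ne'] at this
    exact this.le) M f hM subset_rfl

lemma map_add (hA : IsOscLimit Ω φ a k A) (hφ : IsPhaseExtension Ω φ ΩC ΘC φC)
    (ha : IsAmplitudeExtension Ω m a ΩC' aC)
    (hf₁ : ContDiff ℝ ∞ f₁) (hf₁c : HasCompactSupport f₁) (hf₁Ω : tsupport f₁ ⊆ Ω)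
    (hf₂ : ContDiff ℝ ∞ f₂) (hf₂c : HasCompactSupport f₂) (hf₂Ω : tsupport f₂ ⊆ Ω) :
    A (fun z => f₁ z + f₂ z) = A f₁ + A f₂ := by
  obtain ⟨χ, hχ⟩ := exists_isCutoff n
  refine tendsto_nhds_unique (hA.tendsto hχ (hf₁.add hf₂) (hf₁c.add hf₂c)
    ((tsupport_add f₁ f₂).trans (union_subset hf₁Ω hf₂Ω))) ?_
  refine ((hA.tendsto hχ hf₁ hf₁c hf₁Ω).add (hA.tendsto hχ hf₂ hf₂c hf₂Ω)).congr' ?_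
  filter_upwards [self_mem_nhdsWithin] with ε hε
  exact (oscInt_add_right hφ ha (hχ.continuous_smul ε)
    (hχ.hasCompactSupport_smul (ne_of_gt hε)) hf₁.continuous hf₁c hf₁Ω hf₂.continuous hf₂c
    hf₂Ω).symm

lemma map_const_mul (hA : IsOscLimit Ω φ a k A) (hf : ContDiff ℝ ∞ f)
    (hfc : HasCompactSupport f) (hfΩ : tsupport f ⊆ Ω) (c : ℂ) :
    A (fun z => c * f z) = c * A f := by
  obtain ⟨χ, hχ⟩ := exists_isCutoff n
  refine tendsto_nhds_unique (hA.tendsto hχ (contDiff_const.mul hf) hfc.mul_left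
    ((tsupport_mul_subset' _ _).trans hfΩ)) ?_
  refine ((hA.tendsto hχ hf hfc hfΩ).const_mul c).congr fun ε => ?_
  exact oscInt_const_mul_right c |>.symm

/-- Freeze `ε = 1/C`: there `A f` differs by at most `M` from an absolutely convergent integral,
which is bounded by the supremum of `f`. Uniformity of the rate is what makes `A` a distribution of
finite order. -/
lemma exists_norm_le (hA : IsOscLimit Ω φ a k A) (hφ : IsPhaseExtension Ω φ ΩC ΘC φC)
    (ha : IsAmplitudeExtension Ω m a ΩC' aC) {X : Set (EuclideanSpace ℝ (Fin N))}
    (hX : IsCompact X) (hXΩ : X ⊆ Ω) :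
    ∃ C : ℝ, 0 < C ∧ ∀ (M : ℝ) (f : EuclideanSpace ℝ (Fin N) → ℂ),
      HasBoundsUpTo k 1 M f → tsupport f ⊆ X → ‖A f‖ ≤ C * M := by
  obtain ⟨χ, hχ⟩ := exists_isCutoff n
  obtain ⟨C, hC, h⟩ := hA X hX hXΩ χ hχ
  have hCi : 0 < C⁻¹ := inv_pos.mpr hC
  obtain ⟨D, hD, hb⟩ := exists_norm_oscInt_le hφ ha hX hXΩ (hχ.continuous_smul C⁻¹)
    (hχ.hasCompactSupport_smul hCi.ne')
  refine ⟨1 + D, by positivity, fun M f hf hfX => ?_⟩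
  have h1 := h C⁻¹ hCi (mul_inv_cancel₀ hC.ne').le M f hf hfX
  have h2 := hb M f hf.contDiff.continuous hf.norm_le hfX
  have h3 := norm_sub_norm_le (A f) (oscInt Ω φ a (fun η => (χ (C⁻¹ • η) : ℂ)) f)
  rw [norm_sub_rev] at h3
  have h4 : C * M * C⁻¹ = M := by field_simp
  linarith

/-- The limit as a distribution. -/
theorem exists_distribution (hA : IsOscLimit Ω φ a k A) (hφ : IsPhaseExtension Ω φ ΩC ΘC φC)
    (ha : IsAmplitudeExtension Ω m a ΩC' aC) :
    ∃ T : 𝓓(Ω, ℂ) →L[ℂ] ℂ, ∀ u, T u = A u := by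
  have hadd : ∀ f g : 𝓓(Ω, ℂ), A ⇑(f + g) = A f + A g := fun f g =>
    hA.map_add hφ ha f.contDiff f.hasCompactSupport f.tsupport_subset g.contDiff
      g.hasCompactSupport g.tsupport_subset
  have hsmul : ∀ (c : ℂ) (f : 𝓓(Ω, ℂ)), A ⇑(c • f) = c • A f := fun c f =>
    hA.map_const_mul f.contDiff f.hasCompactSupport f.tsupport_subset c
  refine ⟨TestFunction.mkCLM ℂ (fun u => A u) hadd hsmul fun K hK => ?_, fun u => rfl⟩
  obtain ⟨C, hC, h⟩ := hA.exists_norm_le hφ ha K.isCompact hK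
  refine (ContDiffMapSupportedIn.mkCLMtoNormedSpace ℂ
    (fun f => A (TestFunction.ofSupportedIn hK f)) (fun f g => hadd (.ofSupportedIn hK f) (.ofSupportedIn hK g))
    (fun c f => hsmul c (.ofSupportedIn hK f))
    ⟨Finset.range (k + 1), C, hC.le, fun f => ?_⟩).continuous
  refine h _ _ (.of_norm_iteratedFDeriv_le f.contDiff fun j hj x => ?_) f.tsupport_subset
  refine (ContDiffMapSupportedIn.norm_iteratedFDeriv_apply_le_seminorm_top ℂ).trans ?_
  exact Seminorm.le_def.mp (Finset.le_sup (f := fun i =>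
    ContDiffMapSupportedIn.seminorm ℂ (EuclideanSpace ℝ (Fin N)) ℂ ⊤ K i)
    (Finset.mem_range.mpr (by omega))) f

end IsOscLimit

end Existence

/-! ### The analytic wavefront set of the oscillatory integral -/

section Wavefront

variable {N n : ℕ} {Ω : Opens (EuclideanSpace ℝ (Fin N))} {m : ℝ}
  {φ : EuclideanSpace ℝ (Fin N) → EuclideanSpace ℝ (Fin n) → ℝ}
  {a : EuclideanSpace ℝ (Fin N) → EuclideanSpace ℝ (Fin n) → ℂ}
  {ΩC ΩC' : Set (EuclideanSpace ℂ (Fin N))} {ΘC : Set (EuclideanSpace ℂ (Fin n))}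
  {φC : EuclideanSpace ℂ (Fin N) × EuclideanSpace ℂ (Fin n) → ℂ}
  {aC : EuclideanSpace ℂ (Fin N) → EuclideanSpace ℝ (Fin n) → ℂ}

lemma IsExpDecayingAt.of_smul {x₀ : EuclideanSpace ℝ (Fin N)} {θ₀ : EuclideanSpace ℝ (Fin n)}
    {σ : ℝ} (hσ : 0 < σ) (h : IsExpDecayingAt Ω m a x₀ (σ • θ₀)) : IsExpDecayingAt Ω m a x₀ θ₀ := by
  have heq : ‖σ • θ₀‖⁻¹ • σ • θ₀ = ‖θ₀‖⁻¹ • θ₀ := by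
    rw [norm_smul, Real.norm_of_nonneg hσ.le, smul_smul, mul_inv, mul_right_comm,
      inv_mul_cancel₀ hσ.ne', one_mul]
  unfold IsExpDecayingAt at h ⊢
  rwa [heq] at h

/-- The projection of a point which is not a critical value of the phase on the essential support
is controlled along the whole ray through its covector. -/
lemma isControlledAt_ray (hφ : IsPhaseExtension Ω φ ΩC ΘC φC)
    (ha : IsAmplitudeExtension Ω m a ΩC' aC) {p : ℕ} (hp : |m| ≤ p)
    {x₀ ξ₀ : EuclideanSpace ℝ (Fin N)} (hx₀ : x₀ ∈ Ω)
    (h : ∀ η : EuclideanSpace ℝ (Fin n), (x₀, η) ∈ essSupp Ω m a →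
      gradient (fun θ => φ x₀ θ) η = 0 → ξ₀ ≠ gradient (fun z => φ z η) x₀)
    {t : ℝ} (ht : 0 ≤ t) {θ₀ : EuclideanSpace ℝ (Fin n)} (hθ₀ : θ₀ ≠ 0) :
    IsControlledAt Ω φ a p x₀ θ₀ (t • ξ₀) := by
  rcases ht.eq_or_lt with rfl | ht
  · rw [zero_smul]
    exact isControlledAt_zero hφ ha hp hx₀ hθ₀
  refine isControlledAt hφ ha hp hx₀ hθ₀ fun h1 h2 => ?_
  -- The assumption concerns `ξ₀` alone. If `φ_z(x₀, θ₀) = t ξ₀`, homogeneity gives `φ_z(x₀, θ₀/t) =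
  -- ξ₀`, while `φ_η = 0` and exponential decay depend only on the direction of the frequency.
  have hσ : 0 < t⁻¹ := inv_pos.mpr ht
  have hη : t⁻¹ • θ₀ ≠ 0 := smul_ne_zero hσ.ne' hθ₀
  have hxC := hφ.mem_left x₀ hx₀
  have hθC := hφ.mem_right θ₀ hθ₀
  have g1 : gradient (fun z => φ z (t⁻¹ • θ₀)) x₀ = ξ₀ := by
    refine gradient_eq_of_lineDeriv (((hφ.smooth_left hη).differentiableOn (by simp)).differentiableAt
      (Ω.isOpen.mem_nhds hx₀)) fun i => ?_
    have := hφ.hasDerivAt_left hx₀ hη i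
    rwa [toC_smul, hφ.lineDeriv_left_smul hxC hθC hσ, h1 i, PiLp.smul_apply, smul_eq_mul,
      Complex.ofReal_mul, ← mul_assoc, ← Complex.ofReal_mul, inv_mul_cancel₀ ht.ne',
      Complex.ofReal_one, one_mul] at this
  have g2 : gradient (fun θ => φ x₀ θ) (t⁻¹ • θ₀) = 0 := by
    refine gradient_eq_of_lineDeriv (((hφ.smooth_right hx₀).differentiableOn
      (by simp)).differentiableAt (isOpen_compl_singleton.mem_nhds hη)) fun i => ?_
    have := hφ.hasDerivAt_right hx₀ hη i
    rw [toC_smul, hφ.lineDeriv_right_smul hxC hθC hσ, h2 i] at this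
    simpa using this
  by_contra hcon
  exact h _ ⟨hx₀, hη, fun hd => hcon (hd.of_smul hσ)⟩ g2 g1.symm

/-- The contribution of the frequencies which are small compared to the covector. -/
theorem exists_low_frequency_bound (hφ : IsPhaseExtension Ω φ ΩC ΘC φC)
    (ha : IsAmplitudeExtension Ω m a ΩC' aC) {p : ℕ} (hp : |m| ≤ p)
    {x₀ w₀ : EuclideanSpace ℝ (Fin N)} (hx₀ : x₀ ∈ Ω) (hw₀ : w₀ ≠ 0) :
    ∃ r : ℝ, 0 < r ∧ Metric.closedBall x₀ r ⊆ Ω ∧ ∃ c₁ : ℝ, 0 < c₁ ∧ c₁ ≤ 1 ∧ ∃ C : ℝ, 0 < C ∧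
      ∀ w ∈ Metric.ball w₀ r, ∀ lam : ℝ, 1 ≤ lam → ∀ (L : ℕ) (B M₁ M₂ : ℝ)
      (f : EuclideanSpace ℝ (Fin N) → ℂ) (g : EuclideanSpace ℝ (Fin n) → ℂ),
      C * (L + 1) ≤ B → HasBoundsUpTo L B M₁ f → Continuous g → (∀ θ, ‖g θ‖ ≤ M₂) →
      tsupport f ⊆ Metric.closedBall x₀ r → tsupport g ⊆ Metric.closedBall 0 1 →
      ‖oscInt Ω φ a (fun η => g ((c₁ * lam)⁻¹ • η)) (fun z => wave (lam • w) z * f z)‖ ≤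
        C * M₁ * M₂ * lam ^ (p + n) * (C * B / lam) ^ L := by
  obtain ⟨i, hi⟩ : ∃ i, w₀ i ≠ 0 := by
    by_contra! hcon
    exact hw₀ (by ext i; simpa using hcon i)
  set b : ℝ := |w₀ i| with hb
  have hb0 : 0 < b := abs_pos.mpr hi
  obtain ⟨r₁, hr₁, h1⟩ := Metric.nhds_basis_closedBall.mem_iff.mp (Ω.isOpen.mem_nhds hx₀)
  obtain ⟨r₂, hr₂, h2⟩ := Metric.nhds_basis_closedBall.mem_iff.mp
    (((ha.isExtension.isOpen.inter hφ.isOpen_left).mem_nhds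
      ⟨ha.isExtension.mem x₀ hx₀, hφ.mem_left x₀ hx₀⟩))
  obtain ⟨r, hr, hrr₁, hrr₂, hrb⟩ : ∃ r : ℝ, 0 < r ∧ 2 * r ≤ r₁ ∧ 2 * r ≤ r₂ ∧ r ≤ b / 2 := by
    refine ⟨min (min r₁ r₂) b / 2, by positivity, ?_, ?_, ?_⟩
    · have := (min_le_left (min r₁ r₂) b).trans (min_le_left _ _)
      linarith
    · have := (min_le_left (min r₁ r₂) b).trans (min_le_right _ _)
      linarith
    · have := min_le_right (min r₁ r₂) b
      linarith
  have hΩ : Metric.closedBall x₀ (2 * r) ⊆ Ω := (Metric.closedBall_subset_closedBall hrr₁).trans h1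
  have hC' : Metric.closedBall (toC x₀) (2 * r) ⊆ ΩC' := fun z hz =>
    (h2 (Metric.closedBall_subset_closedBall hrr₂ hz)).1
  have hC : Metric.closedBall (toC x₀) (2 * r) ⊆ ΩC := fun z hz =>
    (h2 (Metric.closedBall_subset_closedBall hrr₂ hz)).2
  obtain ⟨C₁, hC₁, hbd⟩ := exists_norm_integral_left_le hφ ha hp hr hC hC' hΩ
  obtain ⟨D, hD⟩ : ∃ D : ℝ, ∀ q ∈ Metric.closedBall (toC x₀) (2 * r) ×ˢ
      (toC '' Metric.sphere (0 : EuclideanSpace ℝ (Fin n)) 1),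
      ‖lineDeriv ℂ φC q (ec i, 0)‖ ≤ D := by
    refine ((isCompact_closedBall _ _).prod ((isCompact_sphere _ _).image
      continuous_toC)).exists_bound_of_continuousOn
      ((continuousOn_lineDeriv hφ.isOpen_prod hφ.holomorphic (ec i, 0)).mono
      (prod_mono hC ?_))
    rintro _ ⟨θ, hθ, rfl⟩
    exact hφ.mem_right θ fun h0 => by simp [h0] at hθ
  have hlin : ∀ z ∈ Metric.closedBall (toC x₀) (2 * r), ∀ η : EuclideanSpace ℝ (Fin n), η ≠ 0 →
      ‖lineDeriv ℂ φC (z, toC η) (ec i, 0)‖ ≤ (|D| + 1) * ‖η‖ := fun z hz η hη => by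
    have hη0 : 0 < ‖η‖ := norm_pos_iff.mpr hη
    have hu : ‖η‖⁻¹ • η ≠ 0 := smul_ne_zero (inv_ne_zero hη0.ne') hη
    have e1 := hφ.lineDeriv_left_smul (hC hz) (hφ.mem_right _ hu) hη0 (ec i)
    rw [← toC_smul, smul_inv_smul₀ hη0.ne'] at e1
    have e2 := hD (z, toC (‖η‖⁻¹ • η)) ⟨hz, mem_image_of_mem _ (by
      rw [mem_sphere_zero_iff_norm, norm_smul, norm_inv, norm_norm, inv_mul_cancel₀ hη0.ne'])⟩
    rw [e1, norm_mul, Complex.norm_real, norm_norm, mul_comm]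
    have := le_abs_self D
    gcongr
    linarith
  -- For `|η| ≤ c₁ λ` the `i`-th component of `φ_z` is at most `bλ/4`, while that of `λw` is at
  -- least `bλ/2`. The phase derivative thus stays above `bλ/4`, with no lower bound on `|η|`
  -- required.
  set c₁ : ℝ := min 1 (b / 4 / (|D| + 1)) with hc₁
  have hc₁0 : 0 < c₁ := by positivity
  have hc₁1 : c₁ ≤ 1 := min_le_left _ _
  have hc₁D : c₁ * (|D| + 1) ≤ b / 4 := by
    rw [← le_div_iff₀ (by positivity)]
    exact min_le_right _ _
  clear_value c₁
  set V : ℝ := (volume : Measure (EuclideanSpace ℝ (Fin n))).real (Metric.closedBall 0 1) with hV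
  have hV0 : 0 ≤ V := measureReal_nonneg
  set C : ℝ := 4 / r + 8 / b + C₁ * 2 ^ p * V with hCdef
  have e1 : 0 < 4 / r := by positivity
  have e2 : 0 < 8 / b := by positivity
  have e3 : 0 ≤ C₁ * 2 ^ p * V := by positivity
  refine ⟨r, hr, (Metric.closedBall_subset_closedBall (by linarith)).trans hΩ, c₁, hc₁0, hc₁1, C,
    by positivity, fun w hw lam hlam L B M₁ M₂ f g hB hf hg hgM hfr hgs => ?_⟩
  have hl0 : 0 < lam := by linarith
  have hL : (0 : ℝ) ≤ L := Nat.cast_nonneg L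
  have hC0 : 0 < C := by positivity
  have hB' : 4 / r * L ≤ B := le_trans (by gcongr <;> linarith) hB
  have hB0 : 0 ≤ B := le_trans (by positivity) hB'
  have hM₁ := hf.nonneg
  have hM₂ : 0 ≤ M₂ := (norm_nonneg _).trans (hgM 0)
  have hν : 0 < c₁ * lam := by positivity
  have hgc : HasCompactSupport g :=
    (isCompact_closedBall _ _).of_isClosed_subset (isClosed_tsupport _) hgs
  have hfc : HasCompactSupport f :=
    (isCompact_closedBall _ _).of_isClosed_subset (isClosed_tsupport _) hfr
  have hts := tsupport_mul_subset' (wave (lam • w)) f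
  rw [oscInt_swap (g := fun η => g ((c₁ * lam)⁻¹ • η)) (f := fun z => wave (lam • w) z * f z) hφ ha
    (hg.comp (continuous_const_smul _)) (hgc.comp_smul (inv_ne_zero hν.ne'))
    ((contDiff_wave _).continuous.mul hf.contDiff.continuous)
    (hfc.of_isClosed_subset (isClosed_tsupport _) hts)
    (hts.trans (hfr.trans ((Metric.closedBall_subset_closedBall (by linarith)).trans hΩ)))]
  -- Only the `z`-integral is integrated by parts, so `g` contributes its supremum and the volume of
  -- its rescaled support, of order `λ ^ n`.
  set S : Set (EuclideanSpace ℝ (Fin n)) := {0}ᶜ ∩ Metric.closedBall 0 (c₁ * lam) with hS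
  rw [setIntegral_eq_of_subset_of_forall_sdiff_eq_zero (s := S)
    (measurableSet_singleton 0).compl inter_subset_left]
  swap
  · rintro η ⟨hη, hηS⟩
    rw [image_eq_zero_of_notMem_tsupport (f := g) fun h => hηS ⟨hη, ?_⟩, zero_mul]
    have := hgs h
    rw [mem_closedBall_zero_iff, norm_smul, norm_inv, Real.norm_of_nonneg hν.le,
      inv_mul_le_iff₀ hν, mul_one] at this
    rwa [mem_closedBall_zero_iff]
  have hwi : b / 2 ≤ |w i| := by
    have h3 : |w₀ i - w i| ≤ r := by
      have := PiLp.norm_apply_le (w₀ - w) i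
      rw [Real.norm_eq_abs, PiLp.sub_apply] at this
      rw [mem_ball_iff_norm'] at hw
      linarith
    have := abs_sub_abs_le_abs_sub (w₀ i) (w i)
    linarith
  have hSm : volume S ≤ volume (Metric.closedBall (0 : EuclideanSpace ℝ (Fin n)) (c₁ * lam)) :=
    measure_mono inter_subset_right
  have hSV : volume.real S ≤ lam ^ n * V := by
    have h3 : volume.real S ≤
        volume.real (Metric.closedBall (0 : EuclideanSpace ℝ (Fin n)) (c₁ * lam)) :=
      measureReal_mono inter_subset_right measure_closedBall_lt_top.ne
    rw [Measure.addHaar_real_closedBall _ _ hν.le, finrank_euclideanSpace_fin] at h3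
    rw [hV, Measure.addHaar_real_closedBall _ _ zero_le_one, one_pow, one_mul]
    refine h3.trans ?_
    have : c₁ * lam ≤ lam := by nlinarith
    gcongr
  refine (norm_setIntegral_le_of_norm_le_const
    (C := M₂ * (C₁ * (2 * lam) ^ p * M₁ * (C * B / lam) ^ L))
    (hSm.trans_lt measure_closedBall_lt_top) fun η hη => ?_).trans ?_
  · rw [norm_mul]
    have hηn : ‖η‖ ≤ c₁ * lam := mem_closedBall_zero_iff.mp hη.2
    have h3 := hbd i η hη.1 (lam • w) (b / 4 * lam) (by positivity) (fun z hz => by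
      have h4 := hlin z (Metric.ball_subset_closedBall hz) η hη.1
      have h5 : (|D| + 1) * ‖η‖ ≤ b / 4 * lam :=
        calc (|D| + 1) * ‖η‖ ≤ (|D| + 1) * (c₁ * lam) := by gcongr
          _ = c₁ * (|D| + 1) * lam := by ring
          _ ≤ b / 4 * lam := by gcongr
      have h6 : b / 2 * lam ≤ ‖(((lam • w) i : ℝ) : ℂ)‖ := by
        rw [Complex.norm_real, PiLp.smul_apply, smul_eq_mul, Real.norm_eq_abs, abs_mul,
          abs_of_pos hl0, mul_comm]
        gcongr
      have h7 := norm_sub_norm_le (((lam • w) i : ℝ) : ℂ) (lineDeriv ℂ φC (z, toC η) (ec i, 0))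
      rw [norm_sub_rev] at h7
      linarith) L B M₁ f hB' hf hfr
    have h8 : 1 + ‖η‖ ≤ 2 * lam := by nlinarith
    have h9 : 2 * B / (b / 4 * lam) ≤ C * B / lam := by
      rw [show 2 * B / (b / 4 * lam) = 8 / b * B / lam by field_simp; ring]
      gcongr
      linarith
    have h10 := hgM ((c₁ * lam)⁻¹ • η)
    refine mul_le_mul h10 (h3.trans ?_) (norm_nonneg _) hM₂
    gcongr
  · calc _ ≤ M₂ * (C₁ * (2 * lam) ^ p * M₁ * (C * B / lam) ^ L) * (lam ^ n * V) := by gcongr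
      _ = (C₁ * 2 ^ p * V) * M₁ * M₂ * lam ^ (p + n) * (C * B / lam) ^ L := by
        rw [mul_pow, pow_add]; ring
      _ ≤ _ := by
        gcongr
        linarith

end Wavefront

/-! ### Dyadic summation over all frequencies -/

section Wavefront

variable {N n : ℕ} {Ω : Opens (EuclideanSpace ℝ (Fin N))} {m : ℝ}
  {φ : EuclideanSpace ℝ (Fin N) → EuclideanSpace ℝ (Fin n) → ℝ}
  {a : EuclideanSpace ℝ (Fin N) → EuclideanSpace ℝ (Fin n) → ℂ}
  {ΩC ΩC' : Set (EuclideanSpace ℂ (Fin N))} {ΘC : Set (EuclideanSpace ℂ (Fin n))}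
  {φC : EuclideanSpace ℂ (Fin N) × EuclideanSpace ℂ (Fin n) → ℂ}
  {aC : EuclideanSpace ℂ (Fin N) → EuclideanSpace ℝ (Fin n) → ℂ}

/-- Summation of a geometric series of dyadic pieces. -/
lemma norm_le_add_of_dyadic {u : ℕ → ℂ} {T : ℝ} (hT : 0 ≤ T)
    (h : ∀ J, ‖u (J + 1) - u J‖ ≤ T * (1 / 2) ^ (J + 1)) (J : ℕ) : ‖u J‖ ≤ ‖u 0‖ + T := by
  have key : ‖u J‖ ≤ ‖u 0‖ + T * (1 - (1 / 2) ^ J) := by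
    induction J with
    | zero => simp
    | succ J ih =>
      have h1 := norm_sub_norm_le (u (J + 1)) (u J)
      have h2 := h J
      rw [pow_succ] at h2 ⊢
      linarith
  have : 0 ≤ T * (1 / 2) ^ J := by positivity
  linarith

/-- One spare power of `2 ^ j` beyond the loss `q` is enough to make the dyadic bounds summable. -/
lemma dyadic_pow_le {q L : ℕ} (hqL : q + 1 ≤ L) {ν A : ℝ} (hν : 0 < ν) (hA : 0 ≤ A) (j : ℕ) :
    (2 ^ j * ν) ^ q * (A / (2 ^ j * ν)) ^ L ≤ ν ^ q * (A / ν) ^ L * (1 / 2) ^ j := by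
  have h1 : (2 ^ j * ν) ^ q * (A / (2 ^ j * ν)) ^ L =
      ν ^ q * (A / ν) ^ L * ((2 ^ j) ^ q / (2 ^ j) ^ L) := by
    rw [div_pow, div_pow, mul_pow, mul_pow]
    field_simp
  rw [h1]
  have h2 : ((2 : ℝ) ^ j) ^ q / (2 ^ j) ^ L ≤ (1 / 2) ^ j := by
    rw [div_le_iff₀ (by positivity), one_div, inv_pow, ← div_eq_inv_mul,
      le_div_iff₀ (by positivity), ← pow_succ]
    exact pow_le_pow_right₀ (one_le_pow₀ (by norm_num)) hqL
  gcongr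

/-- The Fourier transform of a localization of the oscillatory integral at a point which is
controlled along a whole ray of covectors. -/
theorem IsOscLimit.exists_norm_wave_mul_le (hφ : IsPhaseExtension Ω φ ΩC ΘC φC)
    (ha : IsAmplitudeExtension Ω m a ΩC' aC) {p : ℕ} (hp : |m| ≤ p) {k : ℕ}
    {A : (EuclideanSpace ℝ (Fin N) → ℂ) → ℂ} (hA : IsOscLimit Ω φ a k A)
    {x₀ w₀ : EuclideanSpace ℝ (Fin N)} (hx₀ : x₀ ∈ Ω) (hw₀ : w₀ ≠ 0)
    (hctrl : ∀ t : ℝ, 0 ≤ t → ∀ θ₀ : EuclideanSpace ℝ (Fin n), θ₀ ≠ 0 →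
      IsControlledAt Ω φ a p x₀ θ₀ (t • w₀)) :
    ∃ r : ℝ, 0 < r ∧ Metric.closedBall x₀ r ⊆ Ω ∧ ∃ C : ℝ, 0 < C ∧ ∀ w ∈ Metric.ball w₀ r,
      ∀ L : ℕ, p + n + 1 ≤ L → ∀ (B lam M : ℝ) (f : EuclideanSpace ℝ (Fin N) → ℂ),
      C * (L + 1) ≤ B → C * (L + 1) ≤ lam → HasBoundsUpTo L B M f →
      tsupport f ⊆ Metric.closedBall x₀ r →
      ‖A (fun z => wave (lam • w) z * f z)‖ ≤ C * M * lam ^ (p + n) * (C * B / lam) ^ L := by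
  obtain ⟨r₁, hr₁, hrΩ, c₁, hc₁, hc₁1, C₁, hC₁, hlow⟩ :=
    exists_low_frequency_bound hφ ha hp hx₀ hw₀
  obtain ⟨h, Ch, δ, hCh, hδ, hhs, hhL, -, hh1, hhsupp⟩ :=
    exists_cutoff (0 : EuclideanSpace ℝ (Fin n)) one_pos
  have hcut : ∀ L, IsCutoff (h L) := fun L => ⟨hhs L,
    (isCompact_closedBall _ _).of_isClosed_subset (isClosed_tsupport _) (hhsupp L),
    Filter.eventually_of_mem (Metric.closedBall_mem_nhds _ hδ) (hh1 L)⟩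
  set K : Set (EuclideanSpace ℝ (Fin n)) := Metric.closedBall 0 1 \ Metric.ball 0 (δ / 2) with hKdef
  have hK : IsCompact K := (isCompact_closedBall _ _).diff Metric.isOpen_ball
  -- At scale `μ = 2 ^ (J+1) c₁ λ` the covector is `λw = μ t w` with `t = λ/μ ≤ 1/c₁`. All scales
  -- are thus covered by a compact segment; including `t = 0` makes the control uniform as `μ → ∞`.
  obtain ⟨r₂, hr₂, -, C₂, hC₂, hhigh⟩ := exists_uniform_control_segment hφ ha hx₀ hK
    (T := Icc 0 c₁⁻¹) isCompact_Icc fun t ht θ hθ => hctrl t ht.1 θ fun h0 => hθ.2 (by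
      rw [h0]; exact Metric.mem_ball_self (by positivity))
  have hq : 0 < C₂ / c₁ := by positivity
  set C : ℝ := 1 + C₁ + 2 * C₂ + C₂ / c₁ + 2 * Ch with hCdef
  have hC0 : 0 < C := by positivity
  refine ⟨min r₁ r₂, lt_min hr₁ hr₂, (Metric.closedBall_subset_closedBall
    (min_le_left _ _)).trans hrΩ, C, hC0, fun w hw L hL B lam M f hB hlam hf hfr => ?_⟩
  have hw₁ : w ∈ Metric.ball w₀ r₁ := Metric.ball_subset_ball (min_le_left _ _) hw
  have hw₂ : w ∈ Metric.ball w₀ r₂ := Metric.ball_subset_ball (min_le_right _ _) hw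
  have hf₁ := hfr.trans (Metric.closedBall_subset_closedBall (min_le_left r₁ r₂))
  have hf₂ := hfr.trans (Metric.closedBall_subset_closedBall (min_le_right r₁ r₂))
  have hM := hf.nonneg
  have hL1 : (1 : ℝ) ≤ L + 1 := by
    have : (0 : ℝ) ≤ L := Nat.cast_nonneg L
    linarith
  have hL0 : (0 : ℝ) < L + 1 := by linarith
  have hlam1 : 1 ≤ lam := le_trans (by nlinarith) hlam
  have hl0 : 0 < lam := by linarith
  have hB0 : 0 ≤ B := le_trans (by positivity) hB
  set ν : ℝ := c₁ * lam with hν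
  have hν0 : 0 < ν := by positivity
  have hνC : C₂ * (L + 1) ≤ ν := by
    have : C₂ / c₁ * (L + 1) ≤ lam := le_trans (by gcongr; linarith) hlam
    rw [div_mul_eq_mul_div, div_le_iff₀ hc₁] at this
    rw [hν]; linarith
  have hfc : HasCompactSupport f :=
    (isCompact_closedBall _ _).of_isClosed_subset (isClosed_tsupport _) hf₁
  have hts := tsupport_mul_subset' (wave (lam • w)) f
  have hFs : ContDiff ℝ ∞ fun z => wave (lam • w) z * f z := (contDiff_wave _).mul hf.contDiff
  have hFc : HasCompactSupport fun z => wave (lam • w) z * f z :=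
    hfc.of_isClosed_subset (isClosed_tsupport _) hts
  have hFΩ : tsupport (fun z => wave (lam • w) z * f z) ⊆ Ω := hts.trans (hf₁.trans hrΩ)
  -- The dyadic piece is built from the same `L`-dependent cut-off, so it keeps bounds of rate `B`
  -- up to order `L` and telescopes exactly between consecutive scales.
  set ψ : EuclideanSpace ℝ (Fin n) → ℂ := fun θ => (h L θ : ℂ) + -(h L ((2 : ℝ) • θ) : ℂ) with hψ
  have hψb : HasBoundsUpTo L B 2 ψ := by
    have e1 := (hhL L).mono (B₂ := B) (by positivity)
      (le_trans (by gcongr; linarith) hB) le_rfl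
    have e2 := ((hhL L).comp_smul zero_le_two).mono (B₂ := B) (by positivity)
      (le_trans (by rw [← mul_assoc]; gcongr; linarith) hB) le_rfl
    have := e1.add e2.neg
    rwa [one_add_one_eq_two] at this
  have hψK : tsupport ψ ⊆ K := by
    refine closure_minimal (fun θ hθ => ⟨?_, fun hb => hθ ?_⟩) hK.isClosed
    · rw [mem_closedBall_zero_iff]
      by_contra hlt
      push Not at hlt
      have e1 : h L θ = 0 := image_eq_zero_of_notMem_tsupport fun h' => by
        have := mem_closedBall_zero_iff.mp (hhsupp L h')
        linarith
      have e2 : h L ((2 : ℝ) • θ) = 0 := image_eq_zero_of_notMem_tsupport fun h' => by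
        have := mem_closedBall_zero_iff.mp (hhsupp L h')
        rw [norm_smul, Real.norm_ofNat] at this
        linarith
      exact hθ (by simp [hψ, e1, e2])
    · rw [mem_ball_zero_iff] at hb
      have e1 := hh1 L θ (mem_closedBall_zero_iff.mpr (by linarith))
      have e2 := hh1 L ((2 : ℝ) • θ) (mem_closedBall_zero_iff.mpr (by
        rw [norm_smul, Real.norm_ofNat]; linarith))
      simp [hψ, e1, e2]
  have hψc : HasCompactSupport ψ := hK.of_isClosed_subset (isClosed_tsupport _) hψK
  set u : ℕ → ℂ := fun J => oscInt Ω φ a (fun η => (h L ((2 ^ J * ν)⁻¹ • η) : ℂ))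
    (fun z => wave (lam • w) z * f z) with hu
  set T : ℝ := 2 * C₂ * M * (ν ^ (p + n) * (C₂ * B / ν) ^ L) with hT
  have hT0 : 0 ≤ T := by positivity
  have hstep : ∀ J, ‖u (J + 1) - u J‖ ≤ T * (1 / 2) ^ (J + 1) := by
    intro J
    have hμ0 : 0 < 2 ^ (J + 1) * ν := by positivity
    have hsplit := oscInt_add_left (g₁ := fun η => ψ ((2 ^ (J + 1) * ν)⁻¹ • η))
      (g₂ := fun η => (h L ((2 ^ J * ν)⁻¹ • η) : ℂ)) hφ ha
      (hψb.contDiff.continuous.comp (continuous_const_smul _))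
      (hψc.comp_smul (inv_ne_zero hμ0.ne')) ((hcut L).continuous_smul _)
      ((hcut L).hasCompactSupport_smul (by positivity)) hFs.continuous hFc hFΩ
    have heq : (fun η => ψ ((2 ^ (J + 1) * ν)⁻¹ • η) + (h L ((2 ^ J * ν)⁻¹ • η) : ℂ)) =
        fun η => (h L ((2 ^ (J + 1) * ν)⁻¹ • η) : ℂ) := by
      ext η
      have : (2 : ℝ) * (2 ^ (J + 1) * ν)⁻¹ = (2 ^ J * ν)⁻¹ := by
        rw [pow_succ]; field_simp
      simp only [hψ, smul_smul, this]
      ring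
    rw [heq] at hsplit
    simp only [hu]
    rw [hsplit, add_sub_cancel_right]
    have h2J : (1 : ℝ) ≤ 2 ^ (J + 1) := one_le_pow₀ (by norm_num)
    have ht : lam / (2 ^ (J + 1) * ν) ∈ Icc 0 c₁⁻¹ := by
      refine ⟨by positivity, ?_⟩
      rw [div_le_iff₀ hμ0, hν]
      field_simp
      exact h2J
    have key := hhigh _ ht w hw₂ L B (2 ^ (J + 1) * ν) M 2 f ψ
      (le_trans (by gcongr; linarith) hB) (hνC.trans (le_mul_of_one_le_left hν0.le h2J)) hf hψb
      hf₂ hψK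
    have e3 : (2 ^ (J + 1) * ν) • (lam / (2 ^ (J + 1) * ν)) • w = lam • w := by
      rw [smul_smul, mul_div_cancel₀ _ hμ0.ne']
    rw [e3] at key
    refine key.trans ?_
    have e4 := dyadic_pow_le hL hν0 (A := C₂ * B) (by positivity) (J + 1)
    calc _ = 2 * C₂ * M * ((2 ^ (J + 1) * ν) ^ (p + n) * (C₂ * B / (2 ^ (J + 1) * ν)) ^ L) := by
          ring
      _ ≤ 2 * C₂ * M * (ν ^ (p + n) * (C₂ * B / ν) ^ L * (1 / 2) ^ (J + 1)) := by gcongr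
      _ = _ := by rw [hT]; ring
  have hu0 : ‖u 0‖ ≤ C₁ * M * 1 * lam ^ (p + n) * (C₁ * B / lam) ^ L := by
    have := hlow w hw₁ lam hlam1 L B M 1 f (fun θ => (h L θ : ℂ))
      (le_trans (by gcongr; linarith) hB) hf (hhL L).contDiff.continuous (hhL L).norm_le hf₁
      (closure_minimal (fun θ hθ => hhsupp L (subset_tsupport _ fun h0 => hθ (by simp [h0])))
        Metric.isClosed_closedBall)
    simpa only [hu, pow_zero, one_mul] using this
  -- The cut-off varies with `L`; it is the independence of the limit from `χ` that identifies all
  -- these limits with the one `A`.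
  have hlim : Tendsto (fun J : ℕ => u J) atTop (𝓝 (A fun z => wave (lam • w) z * f z)) := by
    refine (hA.tendsto (hcut L) hFs hFc hFΩ).comp (tendsto_inv_atTop_nhdsGT_zero.comp ?_)
    exact (tendsto_pow_atTop_atTop_of_one_lt one_lt_two).atTop_mul_const hν0
  refine le_of_tendsto hlim.norm (Eventually.of_forall fun J => ?_)
  refine (norm_le_add_of_dyadic hT0 hstep J).trans ?_
  have hTle : T ≤ 2 * C₂ * M * (lam ^ (p + n) * (C * B / lam) ^ L) := by
    have e5 : ν ≤ lam := mul_le_of_le_one_left hl0.le hc₁1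
    have e6 : C₂ * B / ν ≤ C * B / lam := by
      rw [show C₂ * B / ν = C₂ / c₁ * B / lam by rw [hν]; field_simp]
      gcongr
      linarith
    rw [hT]
    gcongr
  have hu0' : ‖u 0‖ ≤ C₁ * M * (lam ^ (p + n) * (C * B / lam) ^ L) := by
    refine hu0.trans ?_
    rw [mul_one, ← mul_assoc]
    have : C₁ ≤ C := by linarith
    gcongr
  have e7 : 0 ≤ M * (lam ^ (p + n) * (C * B / lam) ^ L) := by positivity
  have e8 : C₁ + 2 * C₂ ≤ C := by linarith
  nlinarith [mul_le_mul_of_nonneg_right e8 e7]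

end Wavefront

/-! ### From Fourier decay to microlocal analyticity -/

section Microlocal

variable {N n : ℕ} {Ω : Opens (EuclideanSpace ℝ (Fin N))} {m : ℝ}
  {φ : EuclideanSpace ℝ (Fin N) → EuclideanSpace ℝ (Fin n) → ℝ}
  {a : EuclideanSpace ℝ (Fin N) → EuclideanSpace ℝ (Fin n) → ℂ}
  {ΩC ΩC' : Set (EuclideanSpace ℂ (Fin N))} {ΘC : Set (EuclideanSpace ℂ (Fin n))}
  {φC : EuclideanSpace ℂ (Fin N) × EuclideanSpace ℂ (Fin n) → ℂ}
  {aC : EuclideanSpace ℂ (Fin N) → EuclideanSpace ℝ (Fin n) → ℂ}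

lemma dirDeriv_wave (ξ e : EuclideanSpace ℝ (Fin N)) (k : ℕ) (x : EuclideanSpace ℝ (Fin N)) :
    dirDeriv e k (wave ξ) x = (-Complex.I * ((inner ℝ e ξ : ℝ) : ℂ)) ^ k * wave ξ x := by
  have h1 : dirDeriv e 1 (wave ξ) = fun x => (-Complex.I * ((inner ℝ e ξ : ℝ) : ℂ)) * wave ξ x := by
    ext x
    rw [dirDeriv_one]
    refine HasLineDerivAt.lineDeriv ?_
    have h2 : HasDerivAt (fun τ : ℝ => ((inner ℝ x ξ + τ * inner ℝ e ξ : ℝ) : ℂ))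
        ((inner ℝ e ξ : ℝ) : ℂ) 0 := by
      refine HasDerivAt.ofReal_comp ?_
      simpa using ((hasDerivAt_id (0 : ℝ)).mul_const (inner ℝ e ξ)).const_add (inner ℝ x ξ)
    have h3 := (h2.const_mul (-Complex.I)).cexp
    unfold HasLineDerivAt
    refine (h3.congr_deriv ?_).congr_of_eventuallyEq (Eventually.of_forall fun τ => ?_)
    · simp [wave, mul_comm]
    · simp [wave, inner_add_left, inner_smul_left]
  induction k with
  | zero => simp
  | succ k ih => rw [dirDeriv_succ', h1, dirDeriv_const_mul, ih, pow_succ]; ring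

lemma hasBoundsUpTo_wave (ξ : EuclideanSpace ℝ (Fin N)) (k : ℕ) :
    HasBoundsUpTo k ‖ξ‖ 1 (wave ξ) := by
  refine ⟨contDiff_wave ξ, fun x => (norm_wave ξ x).le, fun i j _ x => ?_⟩
  rw [dirDeriv_wave, norm_mul, norm_wave, mul_one, one_mul, norm_pow, norm_mul, norm_neg,
    Complex.norm_I, one_mul, Complex.norm_real]
  have := norm_inner_le_norm (𝕜 := ℝ) (er i) ξ
  rw [norm_er, one_mul] at this
  gcongr

lemma HasBoundsUpTo.one_of_one_le {d k : ℕ} {B M : ℝ} {f : EuclideanSpace ℝ (Fin d) → ℂ}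
    (hf : HasBoundsUpTo k B M f) (hB : 1 ≤ B) : HasBoundsUpTo k 1 (M * B ^ k) f := by
  have hM := hf.nonneg
  refine ⟨hf.contDiff, fun x => (hf.norm_le x).trans ?_, fun i j hj x =>
    (hf.bound i j hj x).trans ?_⟩
  · exact le_mul_of_one_le_right hM (one_le_pow₀ hB)
  · rw [one_pow, mul_one]
    exact mul_le_mul_of_nonneg_left (pow_le_pow_right₀ hB hj) hM

/-- Derivatives of `f` are needed only on a compact set containing the support of the cut-off; this
is the form of estimate that boundedness in `ℰ'(Ω)` asks for. -/
lemma HasBoundsUpTo.mul_of_tsupport_subset {d k : ℕ} {D B : ℝ}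
    {χ f : EuclideanSpace ℝ (Fin d) → ℂ} {K : Set (EuclideanSpace ℝ (Fin d))}
    (hχ : HasBoundsUpTo k 1 D χ) (hχK : tsupport χ ⊆ K) (hf : ContDiff ℝ ∞ f) (hB : 0 ≤ B)
    (hfB : ∀ j ≤ k, ∀ x ∈ K, ‖iteratedFDeriv ℝ j f x‖ ≤ B) :
    HasBoundsUpTo k 1 (D * B * 2 ^ k) (fun x => χ x * f x) := by
  have hD := hχ.nonneg
  have h0 : 0 ≤ D * B * 2 ^ k := by positivity
  refine ⟨hχ.contDiff.mul hf, fun x => ?_, fun i j hj x => ?_⟩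
  · by_cases hx : x ∈ K
    · rw [norm_mul]
      have h1 := hfB 0 (Nat.zero_le _) x hx
      rw [norm_iteratedFDeriv_zero] at h1
      have h2 := hχ.norm_le x
      calc ‖χ x‖ * ‖f x‖ ≤ D * B := by gcongr
        _ ≤ D * B * 2 ^ k := le_mul_of_one_le_right (by positivity) (one_le_pow₀ (by norm_num))
    · rw [image_eq_zero_of_notMem_tsupport fun h => hx (hχK h), zero_mul, norm_zero]
      exact h0
  · rw [one_pow, mul_one]
    by_cases hx : x ∈ K
    · refine (norm_dirDeriv_mul_le (M₁ := D) (B₁ := 1) (M₂ := B) (B₂ := 1) hχ.contDiff.contDiffAt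
        hf.contDiffAt (fun l hl => hχ.bound i l (hl.trans hj) x) fun l hl => ?_).trans ?_
      · have := norm_dirDeriv_le hf (er i) l x
        rw [norm_er, one_pow, mul_one] at this
        rw [one_pow, mul_one]
        exact this.trans (hfB l (hl.trans hj) x hx)
      · rw [one_add_one_eq_two]
        have : (2 : ℝ) ^ j ≤ 2 ^ k := pow_le_pow_right₀ (by norm_num) hj
        gcongr
    · rw [dirDeriv_eq_zero_of_notMem_tsupport, norm_zero]
      · exact h0
      · have hsub : tsupport (fun x => χ x * f x) ⊆ tsupport χ :=
          closure_mono fun y hy h' => hy (by simp [h'])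
        exact fun h => hx (hχK (hsub h))

/-- Polynomial losses in `L` are dominated by `e^(L+1) ≤ 3^(L+1)`, and a geometric factor is
harmless inside `C (C(L+1)/|ξ|)^L`. -/
lemma exists_add_one_pow_le (k : ℕ) :
    ∃ G : ℝ, 0 < G ∧ ∀ L : ℕ, ((L : ℝ) + 1) ^ k ≤ G * 3 ^ L := by
  refine ⟨k.factorial * 3, by positivity, fun L => ?_⟩
  have h1 := Real.pow_div_factorial_le_exp ((L : ℝ) + 1) (by positivity) k
  rw [div_le_iff₀ (by positivity)] at h1
  have h2 : Real.exp ((L : ℝ) + 1) ≤ 3 ^ (L + 1) := by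
    have : Real.exp ((L : ℝ) + 1) = Real.exp 1 ^ (L + 1) := by
      rw [← Real.exp_nat_mul]; push_cast; ring_nf
    rw [this]
    have := Real.exp_one_lt_three
    gcongr
  calc _ ≤ Real.exp ((L : ℝ) + 1) * k.factorial := h1
    _ ≤ 3 ^ (L + 1) * k.factorial := by gcongr
    _ = _ := by ring

/-- The hypothesis loses `λ ^ q`; running it at order `L + q + 1` recovers this at the price of a
power of `L + 1`. For `|ξ|` below a multiple of `L + 1` the hypothesis is unavailable, but there the
target bound is so weak that finite order of `A` suffices. -/
theorem IsOscLimit.isMicroAnalyticAt (hφ : IsPhaseExtension Ω φ ΩC ΘC φC)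
    (ha : IsAmplitudeExtension Ω m a ΩC' aC) {k : ℕ}
    {A : (EuclideanSpace ℝ (Fin N) → ℂ) → ℂ} (hA : IsOscLimit Ω φ a k A)
    {T : 𝓓(Ω, ℂ) →L[ℂ] ℂ} (hT : ∀ u, T u = A u)
    {x₀ ξ₀ : EuclideanSpace ℝ (Fin N)} (hξ₀ : ξ₀ ≠ 0) {q : ℕ}
    (h : ∃ r : ℝ, 0 < r ∧ Metric.closedBall x₀ r ⊆ Ω ∧ ∃ C : ℝ, 0 < C ∧
      ∀ w ∈ Metric.ball (‖ξ₀‖⁻¹ • ξ₀) r,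
      ∀ L : ℕ, q + 1 ≤ L → ∀ (B lam M : ℝ) (f : EuclideanSpace ℝ (Fin N) → ℂ),
      C * (L + 1) ≤ B → C * (L + 1) ≤ lam → HasBoundsUpTo L B M f →
      tsupport f ⊆ Metric.closedBall x₀ r →
      ‖A (fun z => wave (lam • w) z * f z)‖ ≤ C * M * lam ^ q * (C * B / lam) ^ L) :
    IsMicroAnalyticAt Ω T x₀ ξ₀ := by
  obtain ⟨r, hr, hrΩ, C, hC, hb⟩ := h
  obtain ⟨χ, Cχ, δ, hCχ, hδ, hχs, hχL, hχD, hχ1, hχsupp⟩ := exists_cutoff x₀ hr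
  have hχc : ∀ L, ContDiff ℝ ∞ fun x => (χ L x : ℂ) := fun L => (hχL L).contDiff
  have hχt : ∀ L, tsupport (fun x => (χ L x : ℂ)) ⊆ Metric.closedBall x₀ r := fun L =>
    closure_minimal (fun θ hθ => hχsupp L (subset_tsupport _ fun h0 => hθ (by simp [h0])))
      Metric.isClosed_closedBall
  have hft : ∀ (L : ℕ) (f : EuclideanSpace ℝ (Fin N) → ℂ),
      tsupport (fun x => (χ L x : ℂ) * f x) ⊆ Metric.closedBall x₀ r := fun L f =>
    closure_minimal (fun θ hθ => hχsupp L (subset_tsupport _ fun h0 => hθ (by simp [h0])))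
      Metric.isClosed_closedBall
  have hfc : ∀ (L : ℕ) (f : EuclideanSpace ℝ (Fin N) → ℂ),
      HasCompactSupport (fun x => (χ L x : ℂ) * f x) := fun L f =>
    (isCompact_closedBall _ _).of_isClosed_subset (isClosed_tsupport _) (hft L f)
  obtain ⟨D, hD⟩ := hχD k
  have hD0 := (hD 0).nonneg
  obtain ⟨C₂, hC₂, hA₂⟩ := hA.exists_norm_le hφ ha (isCompact_closedBall x₀ r) hrΩ
  let v : ℕ → smoothFunctions N →ₗ[ℂ] ℂ := fun L =>
    -- The index shift supplies `q + 1` extra derivatives of the cut-off. Boundedness of the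
    -- sequence comes from the bounds on `χ` that are uniform in its index.
    { toFun := fun f => A fun x => (χ (L + (q + 1)) x : ℂ) * (f : EuclideanSpace ℝ (Fin N) → ℂ) x
      map_add' := fun f g => by
        rw [← hA.map_add hφ ha ((hχc _).mul f.2) (hfc _ _) ((hft _ _).trans hrΩ)
          ((hχc _).mul g.2) (hfc _ _) ((hft _ _).trans hrΩ)]
        congr 1
        ext x
        exact mul_add _ _ _
      map_smul' := fun c f => by
        rw [RingHom.id_apply, smul_eq_mul,
          ← hA.map_const_mul ((hχc _).mul f.2) (hfc _ _) ((hft _ _).trans hrΩ)]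
        congr 1
        ext x
        exact mul_left_comm _ _ _ }
  have hv : ∀ L f, v L f =
    A fun x => (χ (L + (q + 1)) x : ℂ) * (f : EuclideanSpace ℝ (Fin N) → ℂ) x := fun _ _ => rfl
  refine ⟨Metric.ball x₀ δ, {ξ | ξ ≠ 0 ∧ ‖ξ‖⁻¹ • ξ ∈ Metric.ball (‖ξ₀‖⁻¹ • ξ₀) r},
    Metric.isOpen_ball, Metric.mem_ball_self hδ, fun x hx => hrΩ (hχsupp 0 (subset_tsupport _ ?_)),
    ?_, ⟨hξ₀, Metric.mem_ball_self hr⟩, ?_, v, ?_, ?_, ?_⟩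
  · rw [Function.mem_support, hχ1 0 x (Metric.ball_subset_closedBall hx)]
    exact one_ne_zero
  · refine ContinuousOn.isOpen_inter_preimage (f := fun ξ => ‖ξ‖⁻¹ • ξ) (s := {0}ᶜ) ?_
      isOpen_compl_singleton Metric.isOpen_ball
    exact (continuousOn_id.norm.inv₀ fun x hx => norm_ne_zero_iff.mpr hx).smul continuousOn_id
  · rintro ξ ⟨hξ, hξr⟩ σ hσ
    refine ⟨smul_ne_zero hσ.ne' hξ, ?_⟩
    rwa [norm_smul, Real.norm_of_nonneg hσ.le, smul_smul, mul_inv, mul_right_comm,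
      inv_mul_cancel₀ hσ.ne', one_mul]
  · refine ⟨Metric.closedBall x₀ r, isCompact_closedBall _ _, hrΩ, k, C₂ * (D * 2 ^ k),
      fun L f B hB hfB => ?_⟩
    have := hA₂ _ _ ((hD (L + (q + 1))).mul_of_tsupport_subset (hχt _) f.2 hB hfB) (hft _ _)
    rw [hv]
    refine this.trans_eq ?_
    ring
  · intro L f hf
    rw [hv, hT]
    congr 1
    ext x
    by_cases hx : x ∈ tsupport f
    · rw [hχ1 _ x (Metric.ball_subset_closedBall (hf hx)), Complex.ofReal_one, one_mul]
      rfl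
    · have : f x = 0 := image_eq_zero_of_notMem_tsupport hx
      change _ * f x = f x
      rw [this, mul_zero]
  · obtain ⟨G₁, hG₁, hG₁L⟩ := exists_add_one_pow_le (q + 1)
    obtain ⟨G₂, hG₂, hG₂L⟩ := exists_add_one_pow_le k
    -- Chosen so that `L + q + 2 ≤ s (L + 1)`, which returns the shifted order to a multiple of `L +
    -- 1`.
    set s : ℝ := (q : ℝ) + 2 with hs
    have hs0 : 0 < s := by positivity
    set Q₁ : ℝ := C * ((C + Cχ) * s) with hQ₁
    set Q₂ : ℝ := (C + 1) * s with hQ₂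
    have hQ₁0 : 0 < Q₁ := by positivity
    have hQ₂0 : 0 < Q₂ := by positivity
    set E₁ : ℝ := C * Q₁ ^ (q + 1) * G₁ with hE₁
    set E₂ : ℝ := C₂ * (D * ((1 + Q₂) ^ k * G₂)) with hE₂
    have hE₁0 : 0 < E₁ := by positivity
    have hE₂0 : 0 ≤ E₂ := by positivity
    set E : ℝ := E₁ + E₂ + 3 * Q₁ + 3 * Q₂ with hE
    refine ⟨E, by positivity, fun L ξ hξΓ hξ => ?_⟩
    set lam : ℝ := ‖ξ‖ with hlam
    have hlam0 : 0 < lam := norm_pos_iff.mpr hξ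
    have hL0 : (0 : ℝ) ≤ L := Nat.cast_nonneg L
    have hLs : (((L + (q + 1) : ℕ) : ℝ) + 1) ≤ s * (L + 1) := by
      rw [hs]; push_cast; nlinarith [Nat.cast_nonneg (α := ℝ) q]
    rw [hv]
    have hcomm : (fun x => (χ (L + (q + 1)) x : ℂ) *
        (planeWave ξ : EuclideanSpace ℝ (Fin N) → ℂ) x) =
        fun x => wave ξ x * (χ (L + (q + 1)) x : ℂ) := by
      ext x; exact mul_comm _ _
    rw [hcomm]
    -- Above this threshold the decay hypothesis applies at order `L + q + 1`, and also `λ ≥ 1`.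
    rcases le_or_gt ((C + 1) * (((L + (q + 1) : ℕ) : ℝ) + 1)) lam with hbig | hsmall
    · have hlam1 : 1 ≤ lam := by
        refine le_trans ?_ hbig
        have : (0 : ℝ) ≤ ((L + (q + 1) : ℕ) : ℝ) := Nat.cast_nonneg _
        nlinarith
      have key := hb _ hξΓ.2 (L + (q + 1)) (by omega)
        ((C + Cχ) * (((L + (q + 1) : ℕ) : ℝ) + 1)) lam 1 (fun x => (χ (L + (q + 1)) x : ℂ))
        (by gcongr; linarith) (le_trans (by gcongr; linarith) hbig)
        ((hχL _).mono (by positivity) (by gcongr; linarith) le_rfl) (hχt _)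
      rw [smul_inv_smul₀ hlam0.ne'] at key
      refine key.trans ?_
      have e1 : C * ((C + Cχ) * (((L + (q + 1) : ℕ) : ℝ) + 1)) ≤ Q₁ * (L + 1) := by
        calc _ ≤ C * ((C + Cχ) * (s * (L + 1))) := by gcongr
          _ = _ := by rw [hQ₁]; ring
      calc C * 1 * lam ^ q * (C * ((C + Cχ) * (((L + (q + 1) : ℕ) : ℝ) + 1)) / lam) ^ (L + (q + 1))
          ≤ C * 1 * lam ^ q * (Q₁ * (L + 1) / lam) ^ (L + (q + 1)) := by gcongr
        _ = C * Q₁ ^ (q + 1) * ((L + 1) ^ (q + 1)) * (Q₁ * (L + 1) / lam) ^ L *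
            (lam ^ q / lam ^ (q + 1)) := by
          rw [pow_add _ L, div_pow _ _ (q + 1), mul_pow]
          field_simp
        _ ≤ C * Q₁ ^ (q + 1) * (G₁ * 3 ^ L) * (Q₁ * (L + 1) / lam) ^ L * 1 := by
          have e2 : lam ^ q / lam ^ (q + 1) ≤ 1 := by
            rw [div_le_one (by positivity)]
            exact pow_le_pow_right₀ hlam1 (Nat.le_succ q)
          have e3 := hG₁L L
          gcongr
        _ = E₁ * (3 * Q₁ * (L + 1) / lam) ^ L := by
          rw [hE₁, show 3 * Q₁ * ((L : ℝ) + 1) / lam = 3 * (Q₁ * (L + 1) / lam) by ring,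
            mul_pow 3]
          ring
        _ ≤ E * (E * (L + 1) / lam) ^ L := by
          have e4 : E₁ ≤ E := by linarith
          have e5 : 3 * Q₁ ≤ E := by linarith
          gcongr
    -- Here `Q₂ (L+1) / λ ≥ 1`, so its `L`-th power may be inserted for free. The order `k` bound
    -- gives `(|ξ| + 1)^k`, a polynomial in `L + 1`.
    · have hlam2 : lam ≤ Q₂ * (L + 1) := by
        refine hsmall.le.trans ?_
        calc _ ≤ (C + 1) * (s * (L + 1)) := by gcongr
          _ = _ := by rw [hQ₂]; ring
      have hbd := ((hasBoundsUpTo_wave ξ k).mul (hD (L + (q + 1)))).one_of_one_le (by linarith)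
      have key := hA₂ _ _ hbd ((tsupport_mul_subset' _ _).trans (hχt _))
      refine key.trans ?_
      have e1 : ‖ξ‖ + 1 ≤ (1 + Q₂) * (L + 1) := by
        rw [← hlam]; nlinarith
      have e2 : 1 ≤ Q₂ * (L + 1) / lam := (one_le_div hlam0).mpr hlam2
      calc C₂ * (1 * D * (‖ξ‖ + 1) ^ k) ≤ C₂ * (1 * D * ((1 + Q₂) * (L + 1)) ^ k) := by gcongr
        _ = C₂ * (D * ((1 + Q₂) ^ k * (L + 1) ^ k)) := by rw [mul_pow]; ring
        _ ≤ C₂ * (D * ((1 + Q₂) ^ k * (G₂ * 3 ^ L))) := by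
          have e3 := hG₂L L
          gcongr
        _ = E₂ * (3 ^ L * 1) := by rw [hE₂]; ring
        _ ≤ E₂ * (3 ^ L * (Q₂ * (L + 1) / lam) ^ L) := by
          have e4 := one_le_pow₀ (n := L) e2
          gcongr
        _ = E₂ * (3 * Q₂ * (L + 1) / lam) ^ L := by
          rw [show 3 * Q₂ * ((L : ℝ) + 1) / lam = 3 * (Q₂ * (L + 1) / lam) by ring, mul_pow 3]
        _ ≤ E * (E * (L + 1) / lam) ^ L := by
          have e4 : E₂ ≤ E := by linarith
          have e5 : 3 * Q₂ ≤ E := by linarith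
          gcongr

end Microlocal

end

end PseudoAnalytic

theorem mainTheorem9 {N n : ℕ} (Ω : TopologicalSpace.Opens (EuclideanSpace ℝ (Fin N))) (m : ℝ)
    (a : EuclideanSpace ℝ (Fin N) → EuclideanSpace ℝ (Fin n) → ℂ)
    (ha : PseudoAnalytic.IsPseudoanalyticAmplitude Ω m a)
    (φ : EuclideanSpace ℝ (Fin N) → EuclideanSpace ℝ (Fin n) → ℝ)
    (hφ : PseudoAnalytic.IsAnalyticPhase Ω φ) :
    ∃ A : 𝓓(Ω, ℂ) →L[ℂ] ℂ,
      PseudoAnalytic.IsOscillatoryIntegral Ω φ a A ∧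
      PseudoAnalytic.analyticWavefrontSet Ω A ⊆
        {p | p.2 ≠ 0 ∧ ∃ η : EuclideanSpace ℝ (Fin n),
          (p.1, η) ∈ PseudoAnalytic.essSupp Ω m a ∧
          gradient (fun θ => φ p.1 θ) η = 0 ∧
          p.2 = gradient (fun z => φ z η) p.1} := by
  obtain ⟨p, hp⟩ := exists_nat_ge |m|
  obtain ⟨ΩC, ΘC, φC, hφC⟩ := hφ.exists_extension
  obtain ⟨ΩC', aC, haC⟩ := ha.exists_extension
  obtain ⟨A, hA⟩ := PseudoAnalytic.exists_isOscLimit hφC haC hp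
  obtain ⟨T, hT⟩ := hA.exists_distribution hφC haC
  refine ⟨T, fun χ hχ hχc hχ1 u => ?_, ?_⟩
  · rw [hT]
    exact hA.tendsto ⟨hχ, hχc, hχ1⟩ u.contDiff u.hasCompactSupport u.tsupport_subset
  · rintro ⟨x₀, ξ₀⟩ ⟨hx₀, hξ₀, hWF⟩
    refine ⟨hξ₀, ?_⟩
    by_contra! hcon
    -- The Fourier estimate is centred at the unit covector, so that `λ = |ξ|`; its ray coincides
    -- with the ray through `ξ₀`.
    have hinv : 0 < ‖ξ₀‖⁻¹ := inv_pos.mpr (norm_pos_iff.mpr hξ₀)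
    refine hWF (hA.isMicroAnalyticAt hφC haC hT hξ₀ (hA.exists_norm_wave_mul_le hφC haC hp hx₀
      (smul_ne_zero hinv.ne' hξ₀) fun t ht θ₀ hθ₀ => ?_))
    rw [smul_smul]
    exact PseudoAnalytic.isControlledAt_ray hφC haC hp hx₀ hcon (mul_nonneg ht hinv.le) hθ₀
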